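/- Let $k$ be a commutative ring, $R$ a $k$-algebra, $C$ an $R$-coring with coproduct $\Delta$ and counit $\varepsilon$, and $A$ an $R$-ring with multiplication $\mu$ and unit map $\eta$ (all algebras are associative and unital). Let $(A,C,\psi)_R$ be a bijective right entwining structure over $R$, that is, $\psi: C\otimes_R A\to A\otimes_R C$ is a bijective $R$-$R$ bilinear map such that $\psi\circ(C\otimes_R\mu)=(\mu\otimes_R C)\circ(A\otimes_R\psi)\circ(\psi\otimes_R A)$, $\psi\circ(C\otimes_R\eta)=\eta\otimes_R C$, $(A\otimes_R\Delta)\circ\psi=(\psi\otimes_R C)\circ(C\otimes_R\psi)\circ(\Delta\otimes_R A)$ and $(A\otimes_R\varepsilon)\circ\psi=\varepsilon\otimes_R A$. Let $(A\otimes_R C)_\psi$ be the associated $A$-coring: $A\otimes_R C$ with the obvious left $A$-action, right $A$-action $(a\otimes c)a'=a\,\psi(c\otimes a')$, coproduct $A\otimes_R\Delta$ and counit $A\otimes_R\varepsilon$. Suppose that $A$ is a right $C$-comodule, with coaction $\varrho^A:A\to A\otimes_R C$, which is a right entwined module with respect to the right regular action, i.e. $\varrho^A\circ\mu=(\mu\otimes_R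 C)\circ(A\otimes_R\psi)\circ(\varrho^A\otimes_R A)$, and let $B=\{b\in A\mid \varrho^A(b)=b\varrho^A(1_A)\}$ be the $k$-subalgebra of coinvariants (so that $B\subseteq A$ is an entwined extension). Then $A$ is a left $C$-comodule with the coaction ${}^A\!\varrho(a)=\psi^{-1}(a\varrho^A(1_A))$. Let $T$ be a $k$-subalgebra of $B$. A strong $T$-connection in $(A,C,\psi)_R$ is a left and right $C$-comodule map $\ell: C\to A\otimes_T A$ (where $A\otimes_T A$ has the right coaction $A\otimes_T\varrho^A$ and the left coaction ${}^A\!\varrho\otimes_T A$) whose composite with $A\otimes_T A\to A\otimes_R C$, $a\otimes a'\mapsto a\varrho^A(a')$, is the map $c\mapsto 1_A\otimes c$. The coring $(A\otimes_R C)_\psi$ is called a Galois $A$-coring if, for its grouplike element $e=\varrho^A(1_A)$, the map $A\otimes_B A\to A\otimes_R C$, $a\otimes a'\mapsto a\,e\,a'$, is bijective. Finally, $A$ is called a $(C,T)$-projective left (resp. right) $B$-module if the multiplication map $B\otimes_T A\to A$ (resp. $A\otimes_T B\to A$) has a section which is left $B$-linear and right $C$-colinear, for the coaction $B\otimes_T\varrho^A$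 on $B\otimes_T A$ (resp. right $B$-linear and left $C$-colinear, for the coaction ${}^A\!\varrho\otimes_T B$ on $A\otimes_T B$). If $A$ is a flat left (resp. right) $T$-module, then the following statements are equivalent: (1) there exists a strong $T$-connection in $(A,C,\psi)_R$; (2) $(A\otimes_R C)_\psi$ is a Galois $A$-coring and $A$ is a $(C,T)$-projective left (resp. right) $B$-module. -/

import Mathlib

open MulOpposite TensorProduct

noncomputable section

/-! ## Tensor products over a noncommutative ring

A right `R`-module is a `Module Rᵐᵒᵖ M`; the right action of `r` on `m` is `op r • m`. -/

/-- The tensor product `M ⊗_R N` of a right `R`-module `M` and a left `R`-module `N`: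
the quotient of `M ⊗_ℤ N` by all `(m r) ⊗ n - m ⊗ (r n)`. -/
def BTensor (R : Type*) (M : Type*) (N : Type*) [Ring R] [AddCommGroup M] [AddCommGroup N]
    [Module Rᵐᵒᵖ M] [Module R N] : Type _ :=
  (M ⊗[ℤ] N) ⧸ AddSubgroup.closure
    {x : M ⊗[ℤ] N | ∃ (m : M) (r : R) (n : N), x = (op r • m) ⊗ₜ[ℤ] n - m ⊗ₜ[ℤ] (r • n)}

namespace BTensor

section Basic

variable {R M N P M' N' M'' N'' : Type*} [Ring R] [AddCommGroup M] [AddCommGroup N]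
  [AddCommGroup P] [AddCommGroup M'] [AddCommGroup N'] [AddCommGroup M''] [AddCommGroup N'']
  [Module Rᵐᵒᵖ M] [Module R N] [Module Rᵐᵒᵖ M'] [Module R N'] [Module Rᵐᵒᵖ M''] [Module R N'']

instance : AddCommGroup (BTensor R M N) :=
  inferInstanceAs (AddCommGroup ((M ⊗[ℤ] N) ⧸ AddSubgroup.closure
    {x : M ⊗[ℤ] N | ∃ (m : M) (r : R) (n : N), x = (op r • m) ⊗ₜ[ℤ] n - m ⊗ₜ[ℤ] (r • n)}))

variable (R M N) in
/-- The projection `M ⊗_ℤ N → M ⊗_R N`. -/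
def mk : M ⊗[ℤ] N →+ BTensor R M N := QuotientAddGroup.mk' _

variable (R) in
/-- The pure tensor `m ⊗_R n`. -/
def tmul (m : M) (n : N) : BTensor R M N := mk R M N (m ⊗ₜ[ℤ] n)

theorem add_tmul (m m' : M) (n : N) : tmul R (m + m') n = tmul R m n + tmul R m' n := by
  simp [tmul, TensorProduct.add_tmul]

theorem tmul_add (m : M) (n n' : N) : tmul R m (n + n') = tmul R m n + tmul R m n' := by
  simp [tmul, TensorProduct.tmul_add]

theorem zero_tmul (n : N) : tmul R (0 : M) n = 0 := by simp [tmul]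

theorem tmul_zero (m : M) : tmul R m (0 : N) = 0 := by simp [tmul]

theorem smul_tmul (m : M) (r : R) (n : N) : tmul R (op r • m) n = tmul R m (r • n) := by
  rw [← sub_eq_zero, tmul, tmul, ← map_sub]
  exact (QuotientAddGroup.eq_zero_iff _).2 (AddSubgroup.subset_closure ⟨m, r, n, rfl⟩)

@[elab_as_elim]
theorem induction {p : BTensor R M N → Prop} (x : BTensor R M N) (zero : p 0)
    (tmul : ∀ m n, p (tmul R m n)) (add : ∀ x y, p x → p y → p (x + y)) : p x := by
  obtain ⟨y, rfl⟩ := QuotientAddGroup.mk'_surjective _ x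
  change p (mk R M N y)
  induction y using TensorProduct.induction_on with
  | zero => simpa using zero
  | tmul m n => exact tmul m n
  | add a b ha hb => rw [map_add]; exact add _ _ ha hb

theorem hom_ext {f g : BTensor R M N →+ P} (h : ∀ m n, f (tmul R m n) = g (tmul R m n)) :
    f = g := by
  ext x
  induction x using BTensor.induction with
  | zero => simp
  | tmul m n => exact h m n
  | add x y hx hy => rw [map_add, map_add, hx, hy]

/-- The additive map `M ⊗_R N → P` induced by an `R`-balanced biadditive map `M × N → P`. -/
def lift (f : M →+ N →+ P) (hf : ∀ m (r : R) n, f (op r • m) n = f m (r • n)) :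
    BTensor R M N →+ P :=
  QuotientAddGroup.lift _
    (TensorProduct.liftAddHom f (fun z m n => by
      rw [map_zsmul, AddMonoidHom.zsmul_apply, map_zsmul])) (by
    rw [AddSubgroup.closure_le]
    rintro _ ⟨m, r, n, rfl⟩
    simp [hf])

@[simp] theorem lift_tmul (f : M →+ N →+ P)
    (hf : ∀ m (r : R) n, f (op r • m) n = f m (r • n)) (m : M) (n : N) :
    lift f hf (tmul R m n) = f m n := rfl

/-- Construct a biadditive map from a function. -/
def mkBi (f : M → N → P) (hl : ∀ m m' n, f (m + m') n = f m n + f m' n)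
    (hr : ∀ m n n', f m (n + n') = f m n + f m n') : M →+ N →+ P :=
  AddMonoidHom.mk' (fun m => AddMonoidHom.mk' (f m) (hr m)) (fun m m' => by
    ext n; exact hl m m' n)

/-- `f ⊗_R g` for a right `R`-linear map `f` and a left `R`-linear map `g`. -/
def map (f : M →ₗ[Rᵐᵒᵖ] M') (g : N →ₗ[R] N') : BTensor R M N →+ BTensor R M' N' :=
  lift (mkBi (fun m n => tmul R (f m) (g n)) (fun m m' n => by rw [map_add, add_tmul])
    (fun m n n' => by rw [map_add, tmul_add]))
    (fun m r n => by
      change tmul R (f (op r • m)) (g n) = tmul R (f m) (g (r • n))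
      rw [map_smul, map_smul, smul_tmul])

@[simp] theorem map_tmul (f : M →ₗ[Rᵐᵒᵖ] M') (g : N →ₗ[R] N') (m : M) (n : N) :
    map f g (tmul R m n) = tmul R (f m) (g n) := rfl

theorem map_map (f : M →ₗ[Rᵐᵒᵖ] M') (g : N →ₗ[R] N') (f' : M' →ₗ[Rᵐᵒᵖ] M'')
    (g' : N' →ₗ[R] N'') (x : BTensor R M N) :
    map f' g' (map f g x) = map (f' ∘ₗ f) (g' ∘ₗ g) x := by
  induction x using BTensor.induction with
  | zero => simp
  | tmul m n => simp
  | add x y hx hy => simp only [map_add, hx, hy]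

theorem map_id (x : BTensor R M N) : map LinearMap.id LinearMap.id x = x := by
  induction x using BTensor.induction with
  | zero => simp
  | tmul m n => simp
  | add x y hx hy => simp only [map_add, hx, hy]

end Basic

section Actions

variable {R S M N M' N' : Type*} [Ring R] [Ring S] [AddCommGroup M] [AddCommGroup N]
  [Module Rᵐᵒᵖ M] [Module R N] [AddCommGroup M'] [AddCommGroup N']
  [Module Rᵐᵒᵖ M'] [Module R N']

/-- `M ⊗_R N` is a left `S`-module if `M` is an `S`-`R` bimodule. -/
instance leftModule [Module S M] [SMulCommClass S Rᵐᵒᵖ M] :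
    Module S (BTensor R M N) where
  smul s := map { toFun := fun m => s • m
                  map_add' := smul_add s
                  map_smul' := fun r m => smul_comm s r m } LinearMap.id
  one_smul x := by
    change map _ _ x = x
    convert map_id x using 3
    ext m; simp
  mul_smul a b x := by
    change map _ _ x = map _ _ (map _ _ x)
    rw [map_map]
    congr 2
    ext m; simp [mul_smul]
  smul_zero s := map_zero (map _ _)
  smul_add s := map_add (map _ _)
  add_smul a b x := by
    change map _ _ x = map _ _ x + map _ _ x
    induction x using BTensor.induction with
    | zero => simp
    | tmul m n => simp [add_smul, add_tmul]
    | add x y hx hy => simp only [map_add, hx, hy]; abel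
  zero_smul x := by
    change map _ _ x = 0
    induction x using BTensor.induction with
    | zero => simp
    | tmul m n => simp [zero_tmul]
    | add x y hx hy => simp only [map_add, hx, hy]; abel

/-- `M ⊗_R N` is a right `S`-module if `N` is an `R`-`S` bimodule. -/
instance rightModule [Module Sᵐᵒᵖ N] [SMulCommClass R Sᵐᵒᵖ N] :
    Module Sᵐᵒᵖ (BTensor R M N) where
  smul s := map LinearMap.id { toFun := fun n => s • n
                               map_add' := smul_add s
                               map_smul' := fun r m => (smul_comm r s m).symm }
  one_smul x := by
    change map _ _ x = x
    convert map_id x using 3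
    ext m; simp
  mul_smul a b x := by
    change map _ _ x = map _ _ (map _ _ x)
    rw [map_map]
    congr 2
    ext m; simp [mul_smul]
  smul_zero s := map_zero (map _ _)
  smul_add s := map_add (map _ _)
  add_smul a b x := by
    change map _ _ x = map _ _ x + map _ _ x
    induction x using BTensor.induction with
    | zero => simp
    | tmul m n => simp [add_smul, tmul_add]
    | add x y hx hy => simp only [map_add, hx, hy]; abel
  zero_smul x := by
    change map _ _ x = 0
    induction x using BTensor.induction with
    | zero => simp
    | tmul m n => simp [tmul_zero]
    | add x y hx hy => simp only [map_add, hx, hy]; abel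

@[simp] theorem left_smul_tmul [Module S M] [SMulCommClass S Rᵐᵒᵖ M] (s : S) (m : M) (n : N) :
    s • tmul R m n = tmul R (s • m) n := rfl

@[simp] theorem right_smul_tmul [Module Sᵐᵒᵖ N] [SMulCommClass R Sᵐᵒᵖ N] (s : S) (m : M)
    (n : N) : op s • tmul R m n = tmul R m (op s • n) := rfl

instance bimodule {S' : Type*} [Ring S'] [Module S M] [SMulCommClass S Rᵐᵒᵖ M]
    [Module S'ᵐᵒᵖ N] [SMulCommClass R S'ᵐᵒᵖ N] : SMulCommClass S S'ᵐᵒᵖ (BTensor R M N) where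
  smul_comm s t x := by
    induction t using MulOpposite.rec' with | _ t
    induction x using BTensor.induction with
    | zero => simp
    | tmul m n => simp
    | add x y hx hy => simp only [smul_add, hx, hy]

end Actions

section Assoc

variable {R S M N P : Type*} [Ring R] [Ring S] [AddCommGroup M] [AddCommGroup N]
  [AddCommGroup P] [Module Rᵐᵒᵖ M] [Module R N] [Module Sᵐᵒᵖ N] [SMulCommClass R Sᵐᵒᵖ N]
  [Module S P]

/-- The canonical map `(M ⊗_R N) ⊗_S P → M ⊗_R (N ⊗_S P)`. -/
def assocHom : BTensor S (BTensor R M N) P →+ BTensor R M (BTensor S N P) :=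
  lift (lift
      (mkBi (fun m n => AddMonoidHom.mk' (fun p => tmul R m (tmul S n p))
        (fun p p' => by rw [tmul_add, tmul_add]))
        (fun m m' n => by ext p; simp [add_tmul])
        (fun m n n' => by ext p; simp [add_tmul, tmul_add]))
      (fun m r n => by
        ext p
        change tmul R (op r • m) (tmul S n p) = tmul R m (tmul S (r • n) p)
        rw [smul_tmul, left_smul_tmul]))
    (fun x s p => by
      induction x using BTensor.induction with
      | zero => simp
      | tmul m n =>
        change tmul R m (tmul S (op s • n) p) = tmul R m (tmul S n (s • p))
        rw [smul_tmul]
      | add x y hx hy => simp only [smul_add, map_add, AddMonoidHom.add_apply, hx, hy])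

/-- The canonical map `M ⊗_R (N ⊗_S P) → (M ⊗_R N) ⊗_S P`. -/
def assocInv : BTensor R M (BTensor S N P) →+ BTensor S (BTensor R M N) P :=
  lift (AddMonoidHom.mk' (fun m => lift
      (mkBi (fun n p => tmul S (tmul R m n) p)
        (fun n n' p => by rw [tmul_add, add_tmul]) (fun n p p' => by rw [tmul_add]))
      (fun n s p => by
        change tmul S (tmul R m (op s • n)) p = tmul S (tmul R m n) (s • p)
        rw [← right_smul_tmul, smul_tmul]))
      (fun m m' => by
        apply hom_ext; intro n p
        change tmul S (tmul R (m + m') n) p = tmul S (tmul R m n) p + tmul S (tmul R m' n) p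
        rw [add_tmul, add_tmul]))
    (fun m r x => by
      induction x using BTensor.induction with
      | zero => simp
      | tmul n p =>
        change tmul S (tmul R (op r • m) n) p = tmul S (tmul R m (r • n)) p
        rw [smul_tmul]
      | add x y hx hy => simp only [smul_add, map_add, hx, hy])

variable (R S M N P) in
/-- The associativity isomorphism `(M ⊗_R N) ⊗_S P ≅ M ⊗_R (N ⊗_S P)`. -/
def assoc : BTensor S (BTensor R M N) P ≃+ BTensor R M (BTensor S N P) :=
  AddMonoidHom.toAddEquiv assocHom assocInv
    (by
      apply hom_ext; intro x p
      induction x using BTensor.induction with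
      | zero => simp [zero_tmul]
      | tmul m n => rfl
      | add x y hx hy => rw [add_tmul, map_add, map_add, hx, hy])
    (by
      apply hom_ext; intro m x
      induction x using BTensor.induction with
      | zero => simp [tmul_zero]
      | tmul m n => rfl
      | add x y hx hy => rw [tmul_add, map_add, map_add, hx, hy])

@[simp] theorem assoc_tmul (m : M) (n : N) (p : P) :
    assoc R S M N P (tmul S (tmul R m n) p) = tmul R m (tmul S n p) := rfl

@[simp] theorem assoc_symm_tmul (m : M) (n : N) (p : P) :
    (assoc R S M N P).symm (tmul R m (tmul S n p)) = tmul S (tmul R m n) p := rfl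

end Assoc

section Unit

variable (R M : Type*) [Ring R] [AddCommGroup M]

/-- `R ⊗_R M → M`, `r ⊗ m ↦ r m`. -/
def lid [Module R M] : BTensor R R M →+ M :=
  lift (mkBi (fun r m => r • m) (fun r r' m => add_smul r r' m) (fun r m m' => smul_add r m m'))
    (fun r s m => by
      change (op s • r) • m = r • s • m
      rw [op_smul_eq_mul, mul_smul])

/-- `M ⊗_R R → M`, `m ⊗ r ↦ m r`. -/
def rid [Module Rᵐᵒᵖ M] : BTensor R M R →+ M :=
  lift (mkBi (fun m r => op r • m) (fun m m' r => smul_add _ m m')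
      (fun m r r' => by rw [op_add, add_smul]))
    (fun m s r => by
      change op r • op s • m = op (s • r) • m
      rw [smul_eq_mul, op_mul, mul_smul])

variable {R M}

@[simp] theorem lid_tmul [Module R M] (r : R) (m : M) : lid R M (tmul R r m) = r • m := rfl

@[simp] theorem rid_tmul [Module Rᵐᵒᵖ M] (m : M) (r : R) :
    rid R M (tmul R m r) = op r • m := rfl

end Unit

end BTensor

/-! ## Bimodules, rings over a noncommutative base -/

/-- `R`-`S` bilinear maps. -/
structure BimodHom (R S M N : Type*) [Ring R] [Ring S] [AddCommGroup M] [AddCommGroup N]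
    [Module R M] [Module Sᵐᵒᵖ M] [Module R N] [Module Sᵐᵒᵖ N] extends M →ₗ[R] N where
  map_op_smul' : ∀ (s : S) (m : M), toFun (op s • m) = op s • toFun m

namespace BimodHom

variable {R S M N : Type*} [Ring R] [Ring S] [AddCommGroup M] [AddCommGroup N]
    [Module R M] [Module Sᵐᵒᵖ M] [Module R N] [Module Sᵐᵒᵖ N]

/-- The underlying left linear map. -/
abbrev left (f : BimodHom R S M N) : M →ₗ[R] N := f.toLinearMap

/-- The underlying right linear map. -/
def right (f : BimodHom R S M N) : M →ₗ[Sᵐᵒᵖ] N where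
  toFun := f.toLinearMap
  map_add' := f.toLinearMap.map_add
  map_smul' s m := f.map_op_smul' s.unop m

instance : CoeFun (BimodHom R S M N) (fun _ => M → N) := ⟨fun f => f.toLinearMap⟩

@[simp] theorem right_apply (f : BimodHom R S M N) (m : M) : f.right m = f m := rfl

theorem map_op_smul (f : BimodHom R S M N) (s : S) (m : M) : f (op s • m) = op s • f m :=
  f.map_op_smul' s m

end BimodHom

/-- For a `k`-algebra `R`, the `R`-`R` bimodule `M` is a bimodule over the `k`-algebra `R`, that
is, the two actions of `k` on `M` coincide. -/
class IsBimoduleOver (k R M : Type*) [CommRing k] [Ring R] [Algebra k R] [AddCommGroup M]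
    [Module R M] [Module Rᵐᵒᵖ M] : Prop where
  algebraMap_smul : ∀ (c : k) (m : M), algebraMap k R c • m = op (algebraMap k R c) • m

/-- `A` is an `R`-ring, i.e. a monoid in the category of `R`-`R` bimodules: the multiplication
of the ring `A` is `R`-`R` bilinear and `R`-balanced. The unit map is `r ↦ r • 1`. -/
class IsRRing (R A : Type*) [Ring R] [Ring A] [Module R A] [Module Rᵐᵒᵖ A] : Prop where
  smul_mul : ∀ (r : R) (a b : A), (r • a) * b = r • (a * b)
  mul_op_smul : ∀ (r : R) (a b : A), a * (op r • b) = op r • (a * b)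
  op_smul_mul : ∀ (r : R) (a b : A), (op r • a) * b = a * (r • b)

namespace IsRRing

variable {R A : Type*} [Ring R] [Ring A] [Module R A] [Module Rᵐᵒᵖ A] [IsRRing R A]

theorem op_smul_one (r : R) : op r • (1 : A) = r • (1 : A) := by
  have := op_smul_mul r (1 : A) 1
  rwa [mul_one, one_mul] at this

theorem smul_eq (r : R) (a : A) : r • a = (r • (1 : A)) * a := by
  rw [smul_mul, one_mul]

theorem op_smul_eq (r : R) (a : A) : op r • a = a * (r • (1 : A)) := by
  rw [← op_smul_mul, mul_one]

instance : IsScalarTower R A A := ⟨fun r a b => smul_mul r a b⟩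

instance : SMulCommClass A Rᵐᵒᵖ A := ⟨fun a r b => mul_op_smul r.unop a b⟩

instance : SMulCommClass R Aᵐᵒᵖ A := ⟨fun r a b => (smul_mul r b a.unop).symm⟩

instance : SMulCommClass R Rᵐᵒᵖ A := ⟨fun r s a => by
  induction s using MulOpposite.rec' with | _ s
  rw [op_smul_eq, op_smul_eq, smul_mul]⟩

variable (R A) in
/-- The multiplication `A ⊗_R A → A`. -/
def mul : BimodHom R R (BTensor R A A) A where
  toFun := BTensor.lift (AddMonoidHom.mul) (fun a r b => op_smul_mul r a b)
  map_add' := map_add _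
  map_smul' r x := by
    induction x using BTensor.induction with
    | zero => simp
    | tmul m n => exact smul_mul r m n
    | add x y hx hy => rw [smul_add, map_add, map_add, hx, hy, smul_add]
  map_op_smul' r x := by
    induction x using BTensor.induction with
    | zero => simp
    | tmul m n => exact mul_op_smul r m n
    | add x y hx hy =>
      rw [smul_add]
      exact (map_add _ _ _).trans ((congrArg₂ _ hx hy).trans
        ((smul_add _ _ _).symm.trans (congrArg _ (map_add _ _ _).symm)))

@[simp] theorem mul_tmul (a b : A) : mul R A (BTensor.tmul R a b) = a * b := rfl

end IsRRing

/-! ## Right actions of subalgebras -/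

namespace Subalgebra

variable {k A M X : Type*} [CommRing k] [Ring A] [Algebra k A]

instance opModule [AddCommGroup M] [Module Aᵐᵒᵖ M] (S : Subalgebra k A) : Module (↥S)ᵐᵒᵖ M :=
  Module.compHom M (S.val : S →+* A).op

theorem op_smul_def [AddCommGroup M] [Module Aᵐᵒᵖ M] (S : Subalgebra k A) (s : S) (m : M) :
    op s • m = op (s : A) • m := rfl

instance op_smulCommClass [AddCommGroup M] [Module Aᵐᵒᵖ M] [SMul X M] [SMulCommClass X Aᵐᵒᵖ M]
    (S : Subalgebra k A) : SMulCommClass X (↥S)ᵐᵒᵖ M :=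
  ⟨fun x s m => smul_comm x (op (s.unop : A)) m⟩

end Subalgebra

/-! ## Corings and comodules -/

/-- An `R`-coring structure on the `R`-`R` bimodule `C`. -/
structure Coring (R C : Type*) [Ring R] [AddCommGroup C] [Module R C] [Module Rᵐᵒᵖ C]
    [SMulCommClass R Rᵐᵒᵖ C] where
  /-- The coproduct `C → C ⊗_R C`. -/
  comul : BimodHom R R C (BTensor R C C)
  /-- The counit `C → R`. -/
  counit : BimodHom R R C R
  coassoc : ∀ c : C,
    BTensor.assoc R R C C C (BTensor.map comul.right LinearMap.id (comul c)) =
      BTensor.map LinearMap.id comul.left (comul c)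
  counit_comul : ∀ c : C,
    BTensor.lid R C (BTensor.map counit.right LinearMap.id (comul c)) = c
  comul_counit : ∀ c : C,
    BTensor.rid R C (BTensor.map LinearMap.id counit.left (comul c)) = c

/-- A right comodule structure on the right `R`-module `M`, for an `R`-coring `C`. -/
structure RightComodule {R C : Type*} [Ring R] [AddCommGroup C] [Module R C] [Module Rᵐᵒᵖ C]
    [SMulCommClass R Rᵐᵒᵖ C] (𝒞 : Coring R C) (M : Type*) [AddCommGroup M] [Module Rᵐᵒᵖ M] where
  /-- The coaction `M → M ⊗_R C`. -/
  coact : M →ₗ[Rᵐᵒᵖ] BTensor R M C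
  coassoc : ∀ m : M,
    BTensor.assoc R R M C C (BTensor.map coact LinearMap.id (coact m)) =
      BTensor.map LinearMap.id 𝒞.comul.left (coact m)
  counit : ∀ m : M,
    BTensor.rid R M (BTensor.map LinearMap.id 𝒞.counit.left (coact m)) = m

/-- A left comodule structure on the left `R`-module `M`, for an `R`-coring `C`. -/
structure LeftComodule {R C : Type*} [Ring R] [AddCommGroup C] [Module R C] [Module Rᵐᵒᵖ C]
    [SMulCommClass R Rᵐᵒᵖ C] (𝒞 : Coring R C) (M : Type*) [AddCommGroup M] [Module R M] where
  /-- The coaction `M → C ⊗_R M`. -/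
  coact : M →ₗ[R] BTensor R C M
  coassoc : ∀ m : M,
    BTensor.assoc R R C C M (BTensor.map 𝒞.comul.right LinearMap.id (coact m)) =
      BTensor.map LinearMap.id coact (coact m)
  counit : ∀ m : M,
    BTensor.lid R M (BTensor.map 𝒞.counit.right LinearMap.id (coact m)) = m

/-- Compatibility of a right `R`-linear map with right `C`-coactions. -/
def IsRightColinear {R C M N : Type*} [Ring R] [AddCommGroup C] [Module R C] [Module Rᵐᵒᵖ C]
    [SMulCommClass R Rᵐᵒᵖ C] [AddCommGroup M] [Module Rᵐᵒᵖ M] [AddCommGroup N] [Module Rᵐᵒᵖ N]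
    (ρM : M →ₗ[Rᵐᵒᵖ] BTensor R M C) (ρN : N →ₗ[Rᵐᵒᵖ] BTensor R N C) (f : M →ₗ[Rᵐᵒᵖ] N) : Prop :=
  ∀ m, ρN (f m) = BTensor.map f LinearMap.id (ρM m)

/-- Compatibility of a left `R`-linear map with left `C`-coactions. -/
def IsLeftColinear {R C M N : Type*} [Ring R] [AddCommGroup C] [Module R C] [Module Rᵐᵒᵖ C]
    [SMulCommClass R Rᵐᵒᵖ C] [AddCommGroup M] [Module R M] [AddCommGroup N] [Module R N]
    (lM : M →ₗ[R] BTensor R C M) (lN : N →ₗ[R] BTensor R C N) (f : M →ₗ[R] N) : Prop :=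
  ∀ m, lN (f m) = BTensor.map LinearMap.id f (lM m)

section TensorCoaction

variable {R C T X M : Type*} [Ring R] [AddCommGroup C] [Module R C] [Module Rᵐᵒᵖ C]
  [SMulCommClass R Rᵐᵒᵖ C] [Ring T] [AddCommGroup X] [AddCommGroup M]

/-- The right `C`-coaction `X ⊗_T ρ : X ⊗_T M → X ⊗_T (M ⊗_R C) ≅ (X ⊗_T M) ⊗_R C`, for a left
`T`-linear right `C`-coaction `ρ` on the `T`-`R` bimodule `M`. -/
def rightTensorCoaction (X : Type*) [AddCommGroup X] [Module Tᵐᵒᵖ X] [Module T M] [Module Rᵐᵒᵖ M]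
    [SMulCommClass T Rᵐᵒᵖ M] (ρ : M →ₗ[Rᵐᵒᵖ] BTensor R M C)
    (hρ : ∀ (t : T) (m : M), ρ (t • m) = t • ρ m) :
    BTensor T X M →ₗ[Rᵐᵒᵖ] BTensor R (BTensor T X M) C where
  toFun x := (BTensor.assoc T R X M C).symm (BTensor.map LinearMap.id
    ({ toFun := ρ, map_add' := ρ.map_add, map_smul' := hρ } : M →ₗ[T] BTensor R M C) x)
  map_add' x y := by rw [map_add, map_add]
  map_smul' r x := by
    induction r using MulOpposite.rec' with | _ r
    induction x using BTensor.induction with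
    | zero => simp
    | tmul x m =>
      simp only [BTensor.right_smul_tmul, BTensor.map_tmul, RingHom.id_apply]
      change (BTensor.assoc T R X M C).symm (BTensor.tmul T x (ρ (op r • m))) =
        op r • (BTensor.assoc T R X M C).symm (BTensor.tmul T x (ρ m))
      rw [ρ.map_smul]
      induction ρ m using BTensor.induction with
      | zero => simp [BTensor.tmul_zero]
      | tmul m c => rfl
      | add u v hu hv => rw [smul_add, BTensor.tmul_add, map_add, hu, hv, BTensor.tmul_add,
          map_add, smul_add]
    | add x y hx hy =>
      rw [smul_add, map_add, map_add, hx, hy, map_add, map_add, RingHom.id_apply, smul_add]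

/-- The left `C`-coaction `l ⊗_T Y : M ⊗_T Y → (C ⊗_R M) ⊗_T Y ≅ C ⊗_R (M ⊗_T Y)`, for a right
`T`-linear left `C`-coaction `l` on the `R`-`T` bimodule `M`. -/
def leftTensorCoaction (Y : Type*) [AddCommGroup Y] [Module T Y] [Module Tᵐᵒᵖ M] [Module R M]
    [SMulCommClass R Tᵐᵒᵖ M] (l : M →ₗ[R] BTensor R C M)
    (hl : ∀ (t : T) (m : M), l (op t • m) = op t • l m) :
    BTensor T M Y →ₗ[R] BTensor R C (BTensor T M Y) where
  toFun x := BTensor.assoc R T C M Y (BTensor.map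
    ({ toFun := l, map_add' := l.map_add, map_smul' := fun t m => hl t.unop m } :
      M →ₗ[Tᵐᵒᵖ] BTensor R C M) LinearMap.id x)
  map_add' x y := by rw [map_add, map_add]
  map_smul' r x := by
    induction x using BTensor.induction with
    | zero => simp
    | tmul m y =>
      simp only [BTensor.left_smul_tmul, BTensor.map_tmul, RingHom.id_apply]
      change BTensor.assoc R T C M Y (BTensor.tmul T (l (r • m)) y) =
        r • BTensor.assoc R T C M Y (BTensor.tmul T (l m) y)
      rw [l.map_smul]
      induction l m using BTensor.induction with
      | zero => simp [BTensor.zero_tmul]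
      | tmul m c => rfl
      | add u v hu hv => rw [smul_add, BTensor.add_tmul, map_add, hu, hv, BTensor.add_tmul,
          map_add, smul_add]
    | add x y hx hy =>
      rw [smul_add, map_add, map_add, hx, hy, map_add, map_add, RingHom.id_apply, smul_add]

end TensorCoaction

namespace Coring

variable {A D : Type*} [Ring A] [AddCommGroup D] [Module A D] [Module Aᵐᵒᵖ D]

/-- Grouplike elements of a coring. -/
def IsGrouplike [SMulCommClass A Aᵐᵒᵖ D] (𝒟 : Coring A D) (e : D) : Prop :=
  𝒟.comul e = BTensor.tmul A e e ∧ 𝒟.counit e = 1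

/-- The `k`-subalgebra of coinvariants `{b ∈ A | e b = b e}` of the base algebra `A`, with respect
to the coaction `a ↦ e a` determined by a grouplike element `e`. -/
def coinvariants (k : Type*) [CommRing k] [Algebra k A] [SMulCommClass A Aᵐᵒᵖ D]
    [IsBimoduleOver k A D] (e : D) :
    Subalgebra k A where
  carrier := {b | op b • e = b • e}
  mul_mem' {a b} ha hb := by
    change op (a * b) • e = (a * b) • e
    rw [op_mul, mul_smul, ha, ← smul_comm, hb, mul_smul]
  add_mem' {a b} ha hb := by
    change op (a + b) • e = (a + b) • e
    rw [op_add, add_smul, ha, hb, add_smul]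
  algebraMap_mem' c := (IsBimoduleOver.algebraMap_smul c e).symm

/-- The canonical map `A ⊗_B A → D`, `a ⊗ a' ↦ a e a'`, where `B` are the coinvariants. -/
def can (k : Type*) [CommRing k] [Algebra k A] [SMulCommClass A Aᵐᵒᵖ D]
    [IsBimoduleOver k A D] (e : D) :
    BTensor (coinvariants k e (A := A)) A A →+ D :=
  BTensor.lift
    (BTensor.mkBi (fun a a' => a • op a' • e)
      (fun a b a' => add_smul a b _) (fun a b b' => by rw [op_add, add_smul, smul_add]))
    (fun a b a' => by
      change (a * (b : A)) • op a' • e = a • op ((b : A) * a') • e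
      have hb : op (b : A) • e = (b : A) • e := b.2
      rw [op_mul, mul_smul (op a'), hb, mul_smul a, smul_comm (b : A)])

/-- An `A`-coring with a grouplike element `e` is Galois if the canonical map
`A ⊗_B A → D`, `a ⊗ a' ↦ a e a'`, is bijective. -/
def IsGalois (k : Type*) [CommRing k] [Algebra k A] [SMulCommClass A Aᵐᵒᵖ D]
    [IsBimoduleOver k A D] (𝒟 : Coring A D)
    (e : D) : Prop :=
  𝒟.IsGrouplike e ∧ Function.Bijective (can k e (A := A))

end Coring

/-! ## Entwining structures over `R` -/

section Entwining

variable {R C A : Type*} [Ring R] [AddCommGroup C] [Module R C] [Module Rᵐᵒᵖ C]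
  [SMulCommClass R Rᵐᵒᵖ C] [Ring A] [Module R A] [Module Rᵐᵒᵖ A] [IsRRing R A]

/-- A right entwining structure `(A, C, ψ)_R`, for an `R`-coring `C` and an `R`-ring `A`. -/
structure Entwining (𝒞 : Coring R C) (A : Type*) [Ring A] [Module R A] [Module Rᵐᵒᵖ A]
    [IsRRing R A] where
  /-- The entwining map `ψ : C ⊗_R A → A ⊗_R C`. -/
  ψ : BimodHom R R (BTensor R C A) (BTensor R A C)
  /-- `ψ ∘ (C ⊗ μ) = (μ ⊗ C) ∘ (A ⊗ ψ) ∘ (ψ ⊗ A)`. -/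
  map_mul : ∀ x : BTensor R (BTensor R C A) A,
    ψ (BTensor.map LinearMap.id (IsRRing.mul R A).left (BTensor.assoc R R C A A x)) =
      BTensor.map (IsRRing.mul R A).right LinearMap.id
        ((BTensor.assoc R R A A C).symm
          (BTensor.map LinearMap.id ψ.left
            (BTensor.assoc R R A C A (BTensor.map ψ.right LinearMap.id x))))
  /-- `ψ ∘ (C ⊗ η) = η ⊗ C`. -/
  map_one : ∀ c : C, ψ (BTensor.tmul R c 1) = BTensor.tmul R 1 c
  /-- `(A ⊗ Δ) ∘ ψ = (ψ ⊗ C) ∘ (C ⊗ ψ) ∘ (Δ ⊗ A)`. -/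
  map_comul : ∀ x : BTensor R C A,
    BTensor.map LinearMap.id 𝒞.comul.left (ψ x) =
      BTensor.assoc R R A C C
        (BTensor.map ψ.right LinearMap.id
          ((BTensor.assoc R R C A C).symm
            (BTensor.map LinearMap.id ψ.left
              (BTensor.assoc R R C C A (BTensor.map 𝒞.comul.right LinearMap.id x)))))
  /-- `(A ⊗ ε) ∘ ψ = ε ⊗ A`. -/
  map_counit : ∀ x : BTensor R C A,
    BTensor.rid R A (BTensor.map LinearMap.id 𝒞.counit.left (ψ x)) =
      BTensor.lid R A (BTensor.map 𝒞.counit.right LinearMap.id x)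

theorem BTensor.smul_one_smul (r : R) (x : BTensor R A C) : (r • (1 : A)) • x = r • x := by
  induction x using BTensor.induction with
  | zero => simp
  | tmul a c => rw [left_smul_tmul, left_smul_tmul, IsRRing.smul_eq r a, smul_eq_mul]
  | add x y hx hy => rw [smul_add, hx, hy, smul_add]

namespace Entwining

variable {𝒞 : Coring R C} (E : Entwining 𝒞 A)

/-- Right multiplication `(a ⊗ c) b = a ψ(c ⊗ b)` on `A ⊗_R C`. -/
def rmul (b : A) : BTensor R A C →+ BTensor R A C :=
  BTensor.lift
    (BTensor.mkBi (fun a c => a • E.ψ (BTensor.tmul R c b))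
      (fun a a' c => add_smul a a' _)
      (fun a c c' => by rw [BTensor.add_tmul, map_add, smul_add]))
    (fun a r c => by
      change (op r • a) • E.ψ (BTensor.tmul R c b) = a • E.ψ (BTensor.tmul R (r • c) b)
      rw [IsRRing.op_smul_eq, mul_smul, BTensor.smul_one_smul, ← BTensor.left_smul_tmul,
        _root_.map_smul])

theorem rmul_tmul (b a : A) (c : C) :
    E.rmul b (BTensor.tmul R a c) = a • E.ψ (BTensor.tmul R c b) := rfl

theorem rmul_smul (b a : A) (x : BTensor R A C) : E.rmul b (a • x) = a • E.rmul b x := by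
  induction x using BTensor.induction with
  | zero => simp
  | tmul a' c => rw [BTensor.left_smul_tmul, rmul_tmul, rmul_tmul, smul_eq_mul, mul_smul]
  | add x y hx hy => rw [smul_add, map_add, map_add, hx, hy, smul_add]

theorem map_mul_assoc_symm (a : A) (y : BTensor R A C) :
    BTensor.map (IsRRing.mul R A).right LinearMap.id
      ((BTensor.assoc R R A A C).symm (BTensor.tmul R a y)) = a • y := by
  induction y using BTensor.induction with
  | zero => simp [BTensor.tmul_zero]
  | tmul a' c => simp
  | add x y hx hy => rw [BTensor.tmul_add, map_add, map_add, hx, hy, smul_add]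

theorem rmul_eq (b : A) (x : BTensor R A C) :
    BTensor.map (IsRRing.mul R A).right LinearMap.id
        ((BTensor.assoc R R A A C).symm
          (BTensor.map LinearMap.id E.ψ.left
            (BTensor.assoc R R A C A (BTensor.tmul R x b)))) = E.rmul b x := by
  induction x using BTensor.induction with
  | zero => simp [BTensor.zero_tmul]
  | tmul a c =>
    rw [BTensor.assoc_tmul, BTensor.map_tmul, map_mul_assoc_symm]; rfl
  | add x y hx hy => rw [BTensor.add_tmul, map_add, map_add, map_add, map_add, hx, hy, map_add]

theorem ψ_mul (c : C) (a b : A) :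
    E.ψ (BTensor.tmul R c (a * b)) = E.rmul b (E.ψ (BTensor.tmul R c a)) := by
  have := E.map_mul (BTensor.tmul R (BTensor.tmul R c a) b)
  rw [BTensor.map_tmul] at this
  exact this.trans (E.rmul_eq b _)

theorem ψ_op_smul (b : A) (x : BTensor R C A) : E.ψ (op b • x) = E.rmul b (E.ψ x) := by
  induction x using BTensor.induction with
  | zero => simp
  | tmul c a => rw [BTensor.right_smul_tmul, op_smul_eq_mul, ψ_mul]
  | add x y hx hy => rw [smul_add, map_add, map_add, hx, hy, map_add]

theorem rmul_one (x : BTensor R A C) : E.rmul 1 x = x := by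
  induction x using BTensor.induction with
  | zero => simp
  | tmul a c => simp [rmul_tmul, E.map_one]
  | add x y hx hy => rw [map_add, hx, hy]

theorem rmul_mul (a b : A) (x : BTensor R A C) : E.rmul (a * b) x = E.rmul b (E.rmul a x) := by
  induction x using BTensor.induction with
  | zero => simp
  | tmul a c => rw [rmul_tmul, rmul_tmul, ψ_mul, rmul_smul]
  | add x y hx hy => rw [map_add, map_add, map_add, hx, hy]

theorem rmul_add_left (a b : A) (x : BTensor R A C) :
    E.rmul (a + b) x = E.rmul a x + E.rmul b x := by
  induction x using BTensor.induction with
  | zero => simp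
  | tmul a c => rw [rmul_tmul, rmul_tmul, rmul_tmul, BTensor.tmul_add, map_add, smul_add]
  | add x y hx hy => simp only [map_add, hx, hy]; abel

/-- The underlying `A`-`A` bimodule of the `A`-coring `(A ⊗_R C)_ψ`: the left `A`-module
`A ⊗_R C`, with right `A`-action `(a ⊗ c) b = a ψ(c ⊗ b)`. -/
def Carrier (_ : Entwining 𝒞 A) : Type _ := BTensor R A C

instance : AddCommGroup E.Carrier := inferInstanceAs (AddCommGroup (BTensor R A C))

instance : Module A E.Carrier := inferInstanceAs (Module A (BTensor R A C))

instance : Module Aᵐᵒᵖ E.Carrier where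
  smul b x := E.rmul b.unop x
  one_smul x := E.rmul_one x
  mul_smul a b x := E.rmul_mul b.unop a.unop x
  smul_zero a := map_zero (E.rmul a.unop)
  smul_add a := map_add (E.rmul a.unop)
  add_smul a b x := E.rmul_add_left a.unop b.unop x
  zero_smul x := by
    change E.rmul 0 x = 0
    simpa using E.rmul_add_left 0 0 x

instance : SMulCommClass A Aᵐᵒᵖ E.Carrier :=
  ⟨fun a b x => (E.rmul_smul b.unop a x).symm⟩

/-- The pure tensor `a ⊗ c` in `(A ⊗_R C)_ψ`. -/
def tm (a : A) (c : C) : E.Carrier := BTensor.tmul R a c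

theorem carrier_induction {p : E.Carrier → Prop} (x : E.Carrier) (zero : p 0)
    (tm : ∀ a c, p (E.tm a c)) (add : ∀ x y, p x → p y → p (x + y)) : p x :=
  BTensor.induction x zero tm add

theorem smul_tm (a b : A) (c : C) : a • E.tm b c = E.tm (a * b) c := rfl

theorem tm_smul_one (c : C) (r : R) : op (r • (1 : A)) • E.tm 1 c = E.tm 1 (op r • c) := by
  change (1 : A) • E.ψ (BTensor.tmul R c (r • 1)) = BTensor.tmul R 1 (op r • c)
  rw [one_smul, ← IsRRing.op_smul_one, ← BTensor.right_smul_tmul, BimodHom.map_op_smul,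
    E.map_one, BTensor.right_smul_tmul]

theorem tm_one_smul (c : C) (r : R) : (r • (1 : A)) • E.tm 1 c = E.tm 1 (r • c) := by
  rw [smul_tm, mul_one]
  change BTensor.tmul R (r • (1 : A)) c = BTensor.tmul R 1 (r • c)
  rw [← BTensor.smul_tmul, IsRRing.op_smul_one]

/-- `(A ⊗_R C)_ψ` is a bimodule over the `k`-algebra `A`. -/
instance isBimoduleOver (k : Type*) [CommRing k] [Algebra k R] [Algebra k A] [IsScalarTower k R A]
    [IsBimoduleOver k R C] : IsBimoduleOver k A E.Carrier where
  algebraMap_smul z x := by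
    induction x using E.carrier_induction with
    | zero => simp
    | tm a c =>
      have h : algebraMap k A z = (algebraMap k R z) • (1 : A) := by
        rw [algebraMap_smul, Algebra.algebraMap_eq_smul_one]
      have h1 : E.tm a c = a • E.tm 1 c := by rw [smul_tm, mul_one]
      rw [h1, smul_smul, Algebra.commutes, ← smul_smul, ← smul_comm a, h, tm_one_smul,
        tm_smul_one, IsBimoduleOver.algebraMap_smul z c]
    | add x y hx hy => rw [smul_add, hx, hy, smul_add]

/-- The canonical map `C ⊗_R C → D ⊗_A D`, `c ⊗ c' ↦ (1 ⊗ c) ⊗_A (1 ⊗ c')`,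
for `D = (A ⊗_R C)_ψ`. -/
def pairing : BTensor R C C →+ BTensor A E.Carrier E.Carrier :=
  BTensor.lift
    (BTensor.mkBi (fun c c' => BTensor.tmul A (E.tm 1 c) (E.tm 1 c'))
      (fun c d c' => by
        rw [← BTensor.add_tmul]; congr 1; exact BTensor.tmul_add (R := R) (1 : A) c d)
      (fun c d d' => by
        rw [← BTensor.tmul_add]; congr 1; exact BTensor.tmul_add (R := R) (1 : A) d d'))
    (fun c r c' => by
      change BTensor.tmul A (E.tm 1 (op r • c)) (E.tm 1 c') =
        BTensor.tmul A (E.tm 1 c) (E.tm 1 (r • c'))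
      rw [← tm_smul_one, BTensor.smul_tmul, tm_one_smul])

theorem pairing_tmul (c c' : C) :
    E.pairing (BTensor.tmul R c c') = BTensor.tmul A (E.tm 1 c) (E.tm 1 c') := rfl

theorem pairing_smul (r : R) (x : BTensor R C C) :
    E.pairing (r • x) = (r • (1 : A)) • E.pairing x := by
  induction x using BTensor.induction with
  | zero => simp
  | tmul c c' =>
    rw [BTensor.left_smul_tmul, pairing_tmul, pairing_tmul, BTensor.left_smul_tmul, tm_one_smul]
  | add x y hx hy => rw [smul_add, map_add, map_add, hx, hy, smul_add]

/-- The canonical map `A ⊗_R (C ⊗_R C) → D ⊗_A D`, `a ⊗ (c ⊗ c') ↦ (a ⊗ c) ⊗_A (1 ⊗ c')`,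
for `D = (A ⊗_R C)_ψ`. -/
def pairingA : BTensor R A (BTensor R C C) →+ BTensor A E.Carrier E.Carrier :=
  BTensor.lift
    (BTensor.mkBi (fun a x => a • E.pairing x) (fun a b x => add_smul a b _)
      (fun a x y => by rw [map_add, smul_add]))
    (fun a r x => by
      change (op r • a) • E.pairing x = a • E.pairing (r • x)
      rw [pairing_smul, IsRRing.op_smul_eq, mul_smul])

theorem pairingA_tmul (a : A) (x : BTensor R C C) :
    E.pairingA (BTensor.tmul R a x) = a • E.pairing x := rfl

/-- The coproduct `A ⊗ Δ` as an additive map. -/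
def comulHom : E.Carrier →+ BTensor A E.Carrier E.Carrier :=
  E.pairingA.comp (BTensor.map LinearMap.id 𝒞.comul.left : BTensor R A C →+ _)

theorem comulHom_tm (a : A) (c : C) : E.comulHom (E.tm a c) = a • E.pairing (𝒞.comul c) := rfl

theorem comulHom_smul (a : A) (x : E.Carrier) : E.comulHom (a • x) = a • E.comulHom x := by
  induction x using E.carrier_induction with
  | zero => simp
  | tm b c => rw [smul_tm, comulHom_tm, comulHom_tm, mul_smul]
  | add x y hx hy => rw [smul_add, map_add, map_add, hx, hy, smul_add]

theorem pairingA_assoc (y : BTensor R A C) (c : C) :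
    E.pairingA (BTensor.assoc R R A C C (BTensor.tmul R y c)) =
      BTensor.tmul A (show E.Carrier from y) (E.tm 1 c) := by
  induction y using BTensor.induction with
  | zero => simp only [BTensor.zero_tmul, map_zero]; exact (BTensor.zero_tmul _).symm
  | tmul a c' =>
    rw [BTensor.assoc_tmul, pairingA_tmul, pairing_tmul, BTensor.left_smul_tmul, smul_tm, mul_one]
    rfl
  | add x y hx hy =>
    rw [BTensor.add_tmul, map_add, map_add, hx, hy]
    exact (BTensor.add_tmul _ _ _).symm

theorem pairingA_swap (c : C) (y : BTensor R A C) :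
    E.pairingA (BTensor.assoc R R A C C (BTensor.map E.ψ.right LinearMap.id
      ((BTensor.assoc R R C A C).symm (BTensor.tmul R c y)))) =
      BTensor.tmul A (E.tm 1 c) (show E.Carrier from y) := by
  induction y using BTensor.induction with
  | zero => simp only [BTensor.tmul_zero, map_zero]; exact (BTensor.tmul_zero _).symm
  | tmul a c' =>
    rw [BTensor.assoc_symm_tmul, BTensor.map_tmul, LinearMap.id_apply, pairingA_assoc]
    have h : (show E.Carrier from E.ψ.right (BTensor.tmul R c a)) = op a • E.tm 1 c :=
      (one_smul A (E.ψ (BTensor.tmul R c a))).symm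
    rw [h, BTensor.smul_tmul, smul_tm, mul_one]
    rfl
  | add x y hx hy =>
    rw [BTensor.tmul_add, map_add, map_add, map_add, map_add, hx, hy]
    exact (BTensor.tmul_add _ _ _).symm

theorem pairing_swap (x : BTensor R C C) (b : A) :
    E.pairingA (BTensor.assoc R R A C C (BTensor.map E.ψ.right LinearMap.id
      ((BTensor.assoc R R C A C).symm (BTensor.map LinearMap.id E.ψ.left
        (BTensor.assoc R R C C A (BTensor.tmul R x b)))))) = op b • E.pairing x := by
  induction x using BTensor.induction with
  | zero => simp [BTensor.zero_tmul]
  | tmul c c' =>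
    rw [BTensor.assoc_tmul, BTensor.map_tmul, LinearMap.id_apply, pairingA_swap, pairing_tmul,
      BTensor.right_smul_tmul]
    congr 1
    exact (one_smul A (E.ψ (BTensor.tmul R c' b))).symm
  | add x y hx hy => simp only [BTensor.add_tmul, map_add, smul_add, hx, hy]

theorem comulHom_op_smul (b : A) (x : E.Carrier) :
    E.comulHom (op b • x) = op b • E.comulHom x := by
  induction x using E.carrier_induction with
  | zero => simp
  | tm a c =>
    rw [comulHom_tm]
    change E.comulHom (a • (show E.Carrier from E.ψ (BTensor.tmul R c b))) = _
    rw [comulHom_smul, ← smul_comm, ← pairing_swap]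
    congr 1
    change E.pairingA (BTensor.map LinearMap.id 𝒞.comul.left (E.ψ (BTensor.tmul R c b))) = _
    rw [E.map_comul, BTensor.map_tmul]
    rfl
  | add x y hx hy => rw [smul_add, map_add, map_add, hx, hy, smul_add]

/-- The coproduct `A ⊗ Δ` of `(A ⊗_R C)_ψ`. -/
def comul : BimodHom A A E.Carrier (BTensor A E.Carrier E.Carrier) where
  toFun := E.comulHom
  map_add' := map_add _
  map_smul' := E.comulHom_smul
  map_op_smul' := E.comulHom_op_smul

/-- The counit `A ⊗ ε` as an additive map. -/
def counitHom : E.Carrier →+ A :=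
  (BTensor.rid R A).comp (BTensor.map LinearMap.id 𝒞.counit.left : BTensor R A C →+ _)

theorem counitHom_tm (a : A) (c : C) : E.counitHom (E.tm a c) = op (𝒞.counit c) • a := rfl

theorem counitHom_smul (a : A) (x : E.Carrier) : E.counitHom (a • x) = a * E.counitHom x := by
  induction x using E.carrier_induction with
  | zero => simp
  | tm b c => rw [smul_tm, counitHom_tm, counitHom_tm, IsRRing.mul_op_smul]
  | add x y hx hy => rw [smul_add, map_add, map_add, hx, hy, mul_add]

/-- The counit `A ⊗ ε` of `(A ⊗_R C)_ψ`. -/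
def counit : BimodHom A A E.Carrier A where
  toFun := E.counitHom
  map_add' := map_add _
  map_smul' := E.counitHom_smul
  map_op_smul' b x := by
    change E.counitHom (op b • x) = E.counitHom x * b
    induction x using E.carrier_induction with
    | zero => simp
    | tm a c =>
      change E.counitHom (a • (show E.Carrier from E.ψ (BTensor.tmul R c b))) = _
      rw [counitHom_smul, counitHom_tm]
      change a * BTensor.rid R A (BTensor.map LinearMap.id 𝒞.counit.left
        (E.ψ (BTensor.tmul R c b))) = _
      rw [E.map_counit, IsRRing.op_smul_mul]
      rfl
    | add x y hx hy => rw [smul_add, map_add, map_add, hx, hy, add_mul]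

/-- The additive map `C → (A ⊗_R C)_ψ`, `c ↦ 1 ⊗ c`. -/
def incl : C →+ E.Carrier :=
  AddMonoidHom.mk' (fun c => E.tm 1 c) (fun c d => BTensor.tmul_add (R := R) (1 : A) c d)

theorem tm_eq (a : A) (c : C) : E.tm a c = a • E.tm 1 c := by rw [smul_tm, mul_one]

/-- The canonical map `C ⊗_R (C ⊗_R C) → D ⊗_A (D ⊗_A D)`, for `D = (A ⊗_R C)_ψ`. -/
def triple : BTensor R C (BTensor R C C) →+ BTensor A E.Carrier (BTensor A E.Carrier E.Carrier) :=
  BTensor.lift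
    (BTensor.mkBi (fun c x => BTensor.tmul A (E.tm 1 c) (E.pairing x))
      (fun c d x => by
        rw [← BTensor.add_tmul]; congr 1; exact BTensor.tmul_add (R := R) (1 : A) c d)
      (fun c x y => by rw [map_add, BTensor.tmul_add]))
    (fun c r x => by
      change BTensor.tmul A (E.tm 1 (op r • c)) (E.pairing x) =
        BTensor.tmul A (E.tm 1 c) (E.pairing (r • x))
      rw [← tm_smul_one, BTensor.smul_tmul, pairing_smul])

theorem triple_right (x : BTensor R C C) :
    BTensor.map LinearMap.id E.comul.left (E.pairing x) =
      E.triple (BTensor.map LinearMap.id 𝒞.comul.left x) := by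
  induction x using BTensor.induction with
  | zero => simp
  | tmul c c' =>
    rw [pairing_tmul, BTensor.map_tmul, BTensor.map_tmul]
    change BTensor.tmul A (E.tm 1 c) (E.comulHom (E.tm 1 c')) =
      BTensor.tmul A (E.tm 1 c) (E.pairing (𝒞.comul c'))
    rw [comulHom_tm, one_smul]
  | add x y hx hy => simp only [map_add, hx, hy]

theorem triple_assoc (y : BTensor R C C) (c : C) :
    BTensor.assoc A A E.Carrier E.Carrier E.Carrier (BTensor.tmul A (E.pairing y) (E.tm 1 c)) =
      E.triple (BTensor.assoc R R C C C (BTensor.tmul R y c)) := by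
  induction y using BTensor.induction with
  | zero => simp [BTensor.zero_tmul]
  | tmul c c' => rfl
  | add x y hx hy => simp only [BTensor.add_tmul, map_add, hx, hy]

theorem triple_left (x : BTensor R C C) :
    BTensor.assoc A A E.Carrier E.Carrier E.Carrier
      (BTensor.map E.comul.right LinearMap.id (E.pairing x)) =
      E.triple (BTensor.assoc R R C C C (BTensor.map 𝒞.comul.right LinearMap.id x)) := by
  induction x using BTensor.induction with
  | zero => simp
  | tmul c c' =>
    rw [pairing_tmul, BTensor.map_tmul, BTensor.map_tmul]
    change BTensor.assoc A A E.Carrier E.Carrier E.Carrier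
      (BTensor.tmul A (E.comulHom (E.tm 1 c)) (E.tm 1 c')) = _
    rw [comulHom_tm, one_smul, triple_assoc]
    rfl
  | add x y hx hy => simp only [map_add, hx, hy]

theorem map_left_smul {D X Y : Type*} [AddCommGroup D] [Module A D] [Module Aᵐᵒᵖ D]
    [SMulCommClass A Aᵐᵒᵖ D] [AddCommGroup X] [Module A X] [AddCommGroup Y] [Module A Y]
    (f : X →ₗ[A] Y) (a : A) (x : BTensor A D X) :
    BTensor.map (LinearMap.id : D →ₗ[Aᵐᵒᵖ] D) f (a • x) = a • BTensor.map LinearMap.id f x := by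
  induction x using BTensor.induction with
  | zero => simp
  | tmul d x => rfl
  | add x y hx hy => simp only [map_add, smul_add, hx, hy]

theorem map_right_smul {D X Y : Type*} [AddCommGroup D] [Module A D] [Module Aᵐᵒᵖ D]
    [SMulCommClass A Aᵐᵒᵖ D] [AddCommGroup X] [Module A X] [Module Aᵐᵒᵖ X]
    [SMulCommClass A Aᵐᵒᵖ X] [AddCommGroup Y] [Module A Y]
    (f : BimodHom A A D X) (a : A) (x : BTensor A D Y) :
    BTensor.map f.right (LinearMap.id : Y →ₗ[A] Y) (a • x) =
      a • BTensor.map f.right LinearMap.id x := by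
  induction x using BTensor.induction with
  | zero => simp
  | tmul d x =>
    rw [BTensor.left_smul_tmul, BTensor.map_tmul, BTensor.map_tmul, BTensor.left_smul_tmul,
      BimodHom.right_apply, BimodHom.right_apply, map_smul]
  | add x y hx hy => simp only [map_add, smul_add, hx, hy]

theorem assoc_smul {D X Y : Type*} [AddCommGroup D] [Module A D] [Module Aᵐᵒᵖ D]
    [SMulCommClass A Aᵐᵒᵖ D] [AddCommGroup X] [Module A X] [Module Aᵐᵒᵖ X]
    [SMulCommClass A Aᵐᵒᵖ X] [AddCommGroup Y] [Module A Y] (a : A)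
    (x : BTensor A (BTensor A D X) Y) :
    BTensor.assoc A A D X Y (a • x) = a • BTensor.assoc A A D X Y x := by
  induction x using BTensor.induction with
  | zero => simp
  | tmul u y =>
    induction u using BTensor.induction with
    | zero => simp [BTensor.zero_tmul]
    | tmul d x => rfl
    | add u v hu hv => rw [BTensor.add_tmul, smul_add, map_add, hu, hv, map_add, smul_add]
  | add x y hx hy => simp only [map_add, smul_add, hx, hy]

theorem pairing_counit_left (x : BTensor R C C) :
    BTensor.lid A E.Carrier (BTensor.map E.counit.right LinearMap.id (E.pairing x)) =
      E.incl (BTensor.lid R C (BTensor.map 𝒞.counit.right LinearMap.id x)) := by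
  induction x using BTensor.induction with
  | zero => simp
  | tmul c c' =>
    change (op (𝒞.counit c) • (1 : A)) • E.tm 1 c' = E.tm 1 (𝒞.counit c • c')
    rw [IsRRing.op_smul_one, tm_one_smul]
  | add x y hx hy => simp only [map_add, hx, hy]

theorem pairing_counit_right (x : BTensor R C C) :
    BTensor.rid A E.Carrier (BTensor.map LinearMap.id E.counit.left (E.pairing x)) =
      E.incl (BTensor.rid R C (BTensor.map LinearMap.id 𝒞.counit.left x)) := by
  induction x using BTensor.induction with
  | zero => simp
  | tmul c c' =>
    change op (op (𝒞.counit c') • (1 : A)) • E.tm 1 c = E.tm 1 (op (𝒞.counit c') • c)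
    rw [IsRRing.op_smul_one, tm_smul_one]
  | add x y hx hy => simp only [map_add, hx, hy]

theorem lid_smul {X : Type*} [AddCommGroup X] [Module A X] (a : A) (x : BTensor A A X) :
    BTensor.lid A X (a • x) = a • BTensor.lid A X x := by
  induction x using BTensor.induction with
  | zero => simp
  | tmul b x => exact mul_smul a b x
  | add x y hx hy => simp only [map_add, smul_add, hx, hy]

theorem rid_smul {X : Type*} [AddCommGroup X] [Module A X] [Module Aᵐᵒᵖ X]
    [SMulCommClass A Aᵐᵒᵖ X] (a : A) (x : BTensor A X A) :
    BTensor.rid A X (a • x) = a • BTensor.rid A X x := by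
  induction x using BTensor.induction with
  | zero => simp
  | tmul x b => exact (smul_comm a (op b) x).symm
  | add x y hx hy => simp only [map_add, smul_add, hx, hy]

/-- The `A`-coring `(A ⊗_R C)_ψ` associated with the entwining structure `(A, C, ψ)_R`, with
coproduct `A ⊗ Δ` and counit `A ⊗ ε`. -/
def coring : Coring A E.Carrier where
  comul := E.comul
  counit := E.counit
  coassoc x := by
    induction x using E.carrier_induction with
    | zero => simp
    | tm a c =>
      have h : E.comul (E.tm a c) = a • E.pairing (𝒞.comul c) := rfl
      rw [h, map_right_smul, assoc_smul, map_left_smul, triple_left, triple_right, 𝒞.coassoc]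
    | add x y hx hy => simp only [map_add, hx, hy]
  counit_comul x := by
    induction x using E.carrier_induction with
    | zero => simp
    | tm a c =>
      have h : E.comul (E.tm a c) = a • E.pairing (𝒞.comul c) := rfl
      rw [h, map_right_smul, lid_smul, pairing_counit_left, 𝒞.counit_comul, tm_eq]
      rfl
    | add x y hx hy => simp only [map_add, hx, hy]
  comul_counit x := by
    induction x using E.carrier_induction with
    | zero => simp
    | tm a c =>
      have h : E.comul (E.tm a c) = a • E.pairing (𝒞.comul c) := rfl
      rw [h, map_left_smul, rid_smul, pairing_counit_right, 𝒞.comul_counit, tm_eq]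
      rfl
    | add x y hx hy => simp only [map_add, hx, hy]

/-! ### Entwined extensions -/

/-- The structure making `A` an entwined extension of its coinvariants: the entwining structure is
bijective, and `A`, with the right regular action, is a right entwined module. -/
structure Extension where
  bijective : Function.Bijective E.ψ
  /-- The right `C`-comodule structure `ρ^A` on `A`. -/
  comodule : RightComodule 𝒞 A
  /-- `ρ^A ∘ μ = (μ ⊗ C) ∘ (A ⊗ ψ) ∘ (ρ^A ⊗ A)`. -/
  entwined : ∀ x : BTensor R A A,
    comodule.coact (IsRRing.mul R A x) =
      BTensor.map (IsRRing.mul R A).right LinearMap.id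
        ((BTensor.assoc R R A A C).symm
          (BTensor.map LinearMap.id E.ψ.left
            (BTensor.assoc R R A C A (BTensor.map comodule.coact LinearMap.id x))))

namespace Extension

variable {E} (X : E.Extension)

/-- The right coaction `ρ^A : A → A ⊗_R C`. -/
def ρ : A →ₗ[Rᵐᵒᵖ] BTensor R A C := X.comodule.coact

theorem ρ_mul (a b : A) : X.ρ (a * b) = E.rmul b (X.ρ a) := by
  have := X.entwined (BTensor.tmul R a b)
  rw [BTensor.map_tmul] at this
  exact this.trans (E.rmul_eq b _)

/-- The element `ρ^A(1)` of the `A`-coring `(A ⊗_R C)_ψ`. -/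
def grouplike : E.Carrier := X.ρ 1

theorem ρ_eq (a : A) : (show E.Carrier from X.ρ a) = op a • X.grouplike := by
  have := X.ρ_mul 1 a
  rwa [one_mul] at this

section Coinvariants

variable (k : Type*) [CommRing k] [Algebra k R] [Algebra k A] [IsScalarTower k R A]
  [IsBimoduleOver k R C]

/-- The `k`-subalgebra `B` of coinvariants of `A`, with respect to the grouplike element
`ρ^A(1)` of `(A ⊗_R C)_ψ`; so `B = {b ∈ A | ρ^A(b) = b ρ^A(1)}`. -/
def coinv : Subalgebra k A := Coring.coinvariants k X.grouplike

theorem mem_coinv (b : A) : b ∈ X.coinv k ↔ X.ρ b = b • X.ρ 1 := by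
  have h : X.ρ b = E.rmul b (X.ρ 1) := X.ρ_eq b
  rw [h]
  exact Iff.rfl

theorem ρ_coinv_mul (b : X.coinv k) (a : A) : X.ρ ((b : A) * a) = (b : A) • X.ρ a := by
  rw [X.ρ_mul, (X.mem_coinv k b).1 b.2, E.rmul_smul, ← X.ρ_mul, one_mul]

end Coinvariants

/-- The left coaction `a ↦ ψ⁻¹(a ρ^A(1))` of `C` on `A`. -/
def leftρ : A →ₗ[R] BTensor R C A where
  toFun a := (LinearEquiv.ofBijective E.ψ.left X.bijective).symm (a • X.ρ 1)
  map_add' a b := by rw [add_smul, map_add]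
  map_smul' r a := by
    rw [IsRRing.smul_eq r a, mul_smul, BTensor.smul_one_smul, map_smul, RingHom.id_apply]

theorem ψ_leftρ (a : A) : E.ψ (X.leftρ a) = a • X.ρ 1 :=
  (LinearEquiv.ofBijective E.ψ.left X.bijective).apply_symm_apply _

theorem leftρ_mul_coinv (k : Type*) [CommRing k] [Algebra k R] [Algebra k A]
    [IsScalarTower k R A] [IsBimoduleOver k R C] (a : A) (b : X.coinv k) :
    X.leftρ (a * (b : A)) = op (b : A) • X.leftρ a := by
  apply X.bijective.1
  rw [E.ψ_op_smul, ψ_leftρ, ψ_leftρ, E.rmul_smul, ← X.ρ_mul, one_mul,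
    (X.mem_coinv k b).1 b.2, mul_smul]

theorem rmul_smul_one (r : R) (x : BTensor R A C) : E.rmul (r • (1 : A)) x = op r • x := by
  induction x using BTensor.induction with
  | zero => simp
  | tmul a c =>
    rw [E.rmul_tmul, ← IsRRing.op_smul_one, ← BTensor.right_smul_tmul, BimodHom.map_op_smul,
      E.map_one]
    simp
  | add x y hx hy => rw [map_add, hx, hy, smul_add]

/-- `z ↦ w z`, `u ⊗ d ↦ (w u) ⊗ d`, for `w ∈ (A ⊗_R C)_ψ` and `z ∈ A ⊗_R C`. -/
def act (E : Entwining 𝒞 A) (w : BTensor R A C) :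
    BTensor R A C →+ BTensor R (BTensor R A C) C :=
  BTensor.lift
    (BTensor.mkBi (fun u d => BTensor.tmul R (E.rmul u w) d)
      (fun u v d => by rw [E.rmul_add_left, BTensor.add_tmul])
      (fun u d d' => BTensor.tmul_add _ _ _))
    (fun u r d => by
      change BTensor.tmul R (E.rmul (op r • u) w) d = BTensor.tmul R (E.rmul u w) (r • d)
      rw [IsRRing.op_smul_eq, E.rmul_mul, rmul_smul_one, BTensor.smul_tmul])

theorem act_ρ (a : A) (z : BTensor R A C) :
    BTensor.assoc R R A C C (act E (a • X.ρ 1) z) =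
      a • BTensor.assoc R R A C C (BTensor.map X.ρ LinearMap.id z) := by
  induction z using BTensor.induction with
  | zero => simp
  | tmul u d =>
    change BTensor.assoc R R A C C (BTensor.tmul R (E.rmul u (a • X.ρ 1)) d) =
      a • BTensor.assoc R R A C C (BTensor.tmul R (X.ρ u) d)
    rw [E.rmul_smul, ← X.ρ_mul, one_mul]
    induction X.ρ u using BTensor.induction with
    | zero => simp [BTensor.zero_tmul]
    | tmul v c => rfl
    | add x y hx hy => rw [smul_add, BTensor.add_tmul, map_add, hx, hy, BTensor.add_tmul, map_add,
        smul_add]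
  | add x y hx hy => simp only [map_add, smul_add, hx, hy]

theorem map_ψ_tmul (c : C) (a : A) (z : BTensor R A C) :
    BTensor.map E.ψ.right LinearMap.id
      ((BTensor.assoc R R C A C).symm (BTensor.tmul R c (a • z))) =
      act E (E.ψ (BTensor.tmul R c a)) z := by
  induction z using BTensor.induction with
  | zero => simp [BTensor.tmul_zero]
  | tmul u d =>
    change BTensor.tmul R (E.ψ (BTensor.tmul R c (a * u))) d = _
    rw [E.ψ_mul]
    rfl
  | add x y hx hy => simp only [map_add, smul_add, BTensor.tmul_add, hx, hy]

theorem map_ψ_leftρ (y : BTensor R C A) :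
    BTensor.map E.ψ.right LinearMap.id
      ((BTensor.assoc R R C A C).symm (BTensor.map LinearMap.id E.ψ.left
        (BTensor.map LinearMap.id X.leftρ y))) = act E (E.ψ y) (X.ρ 1) := by
  induction y using BTensor.induction with
  | zero =>
    simp only [map_zero]
    induction X.ρ 1 using BTensor.induction with
    | zero => simp
    | tmul u d =>
      change 0 = BTensor.tmul R (E.rmul u 0) d
      rw [map_zero, BTensor.zero_tmul]
    | add x y hx hy => rw [map_add, ← hx, ← hy, add_zero]
  | tmul c a =>
    rw [BTensor.map_tmul, BTensor.map_tmul, LinearMap.id_apply, LinearMap.id_apply]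
    have h : E.ψ.left (X.leftρ a) = a • X.ρ 1 := X.ψ_leftρ a
    rw [h, map_ψ_tmul]
  | add x y hx hy =>
    simp only [map_add, hx, hy]
    induction X.ρ 1 using BTensor.induction with
    | zero => simp
    | tmul u d =>
      change BTensor.tmul R (E.rmul u _) d + BTensor.tmul R (E.rmul u _) d =
        BTensor.tmul R (E.rmul u _) d
      rw [map_add, BTensor.add_tmul]
    | add x y hx hy => simp only [map_add, ← hx, ← hy]; abel

theorem map_ψ_injective (X : E.Extension) : Function.Injective
    (BTensor.map E.ψ.right (LinearMap.id : C →ₗ[R] C)) := by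
  let e := LinearEquiv.ofBijective E.ψ.right X.bijective
  apply Function.LeftInverse.injective (g := BTensor.map e.symm.toLinearMap LinearMap.id)
  intro x
  have h : e.symm.toLinearMap ∘ₗ E.ψ.right = LinearMap.id :=
    LinearMap.ext fun y => e.symm_apply_apply y
  rw [BTensor.map_map, h]
  exact BTensor.map_id x

theorem map_ψ_injective' (X : E.Extension) : Function.Injective
    (BTensor.map (LinearMap.id : C →ₗ[Rᵐᵒᵖ] C) E.ψ.left) := by
  let e := LinearEquiv.ofBijective E.ψ.left X.bijective
  apply Function.LeftInverse.injective (g := BTensor.map LinearMap.id e.symm.toLinearMap)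
  intro x
  have h : e.symm.toLinearMap ∘ₗ E.ψ.left = LinearMap.id :=
    LinearMap.ext fun y => e.symm_apply_apply y
  rw [BTensor.map_map, h]
  exact BTensor.map_id x

theorem map_smul_left {Y Z : Type*} [AddCommGroup Y] [Module R Y] [AddCommGroup Z] [Module R Z]
    (f : Y →ₗ[R] Z) (a : A) (x : BTensor R A Y) :
    BTensor.map (LinearMap.id : A →ₗ[Rᵐᵒᵖ] A) f (a • x) = a • BTensor.map LinearMap.id f x := by
  induction x using BTensor.induction with
  | zero => simp
  | tmul d x => rfl
  | add x y hx hy => simp only [map_add, smul_add, hx, hy]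

/-- The left `C`-comodule structure on `A` given by the coaction `a ↦ ψ⁻¹(a ρ^A(1))`. -/
def leftComodule : LeftComodule 𝒞 A where
  coact := X.leftρ
  coassoc a := by
    apply X.map_ψ_injective'
    apply (BTensor.assoc R R C A C).symm.injective
    apply X.map_ψ_injective
    apply (BTensor.assoc R R A C C).injective
    rw [map_ψ_leftρ, ← E.map_comul, ψ_leftρ, act_ρ, map_smul_left]
    exact congrArg (a • ·) (X.comodule.coassoc 1).symm
  counit a := by
    rw [← E.map_counit, ψ_leftρ, map_smul_left]
    have h : ∀ x : BTensor R A R, BTensor.rid R A (a • x) = a * BTensor.rid R A x := by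
      intro x
      induction x using BTensor.induction with
      | zero => simp
      | tmul b r => exact (IsRRing.mul_op_smul r a b).symm
      | add x y hx hy => rw [smul_add, map_add, map_add, hx, hy, mul_add]
    rw [h]
    exact (congrArg (a * ·) (X.comodule.counit 1)).trans (mul_one a)

/-! ### Strong connections -/

section StrongConnection

variable (k : Type*) [CommRing k] [Algebra k R] [Algebra k A] [IsScalarTower k R A]
  [IsBimoduleOver k R C]

theorem ρ_smul (T : Subalgebra k (X.coinv k)) (t : T) (a : A) : X.ρ (t • a) = t • X.ρ a := by
  have h : t • X.ρ a = ((t : X.coinv k) : A) • X.ρ a := by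
    induction X.ρ a using BTensor.induction with
    | zero => simp
    | tmul a c => rfl
    | add x y hx hy => rw [smul_add, smul_add, hx, hy]
  rw [h]
  exact X.ρ_coinv_mul k t a

theorem leftρ_op_smul (T : Subalgebra k (X.coinv k)) (t : T) (a : A) :
    X.leftρ (op t • a) = op t • X.leftρ a := by
  have h : op t • X.leftρ a = op ((t : X.coinv k) : A) • X.leftρ a := by
    induction X.leftρ a using BTensor.induction with
    | zero => simp
    | tmul c a => rfl
    | add x y hx hy => rw [smul_add, smul_add, hx, hy]
  rw [h]
  exact X.leftρ_mul_coinv k a t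

variable {k}

/-- The lifted canonical map `A ⊗_T A → A ⊗_R C`, `a ⊗ a' ↦ a ρ^A(a')`. -/
def canLift (T : Subalgebra k (X.coinv k)) : BTensor T A A →+ BTensor R A C :=
  BTensor.lift
    (BTensor.mkBi (fun a a' => a • X.ρ a') (fun a b a' => add_smul a b _)
      (fun a b b' => by rw [map_add, smul_add]))
    (fun a t a' => by
      change (a * ((t : X.coinv k) : A)) • X.ρ a' = a • X.ρ (((t : X.coinv k) : A) * a')
      rw [X.ρ_coinv_mul, mul_smul])

/-- `ℓ : C → A ⊗_T A` is a strong `T`-connection: it is right `C`-colinear for the coaction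
`A ⊗_T ρ^A`, left `C`-colinear for the coaction `(a ↦ ψ⁻¹(a ρ^A(1))) ⊗_T A`, and
`canLift (ℓ c) = 1 ⊗ c` for all `c`. -/
structure IsStrongConnection (T : Subalgebra k (X.coinv k))
    (ℓ : BimodHom R R C (BTensor T A A)) : Prop where
  right_colinear : IsRightColinear 𝒞.comul.right
    (rightTensorCoaction A X.comodule.coact (X.ρ_smul k T)) ℓ.right
  left_colinear : IsLeftColinear 𝒞.comul.left
    (leftTensorCoaction A X.leftComodule.coact (X.leftρ_op_smul k T)) ℓ.left
  canLift_eq : ∀ c : C, X.canLift T (ℓ c) = BTensor.tmul R 1 c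

end StrongConnection

end Extension

end Entwining

end Entwining

/-! ## Equivariant projectivity and flatness -/

section Projectivity

variable {R C : Type*} [Ring R] [AddCommGroup C] [Module R C] [Module Rᵐᵒᵖ C]
  [SMulCommClass R Rᵐᵒᵖ C] {𝒞 : Coring R C}

/-- `M` is a `(C, T)`-projective left `B`-module: `M` is a left `B`-module and right `C`-comodule
with left `B`-linear coaction, `B` is a right `T`-module and `M` is a `T`-`R` bimodule such that
the `C`-coaction is left `T`-linear, the left `B`-action is `T`-balanced, and there is a left
`B`-linear, right `C`-colinear section of `B ⊗_T M → M`. -/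
def IsEquivariantlyProjectiveLeft (B T : Type*) {M : Type*} [Ring B] [Ring T] [AddCommGroup M]
    [Module B M] [Module T M] [Module Rᵐᵒᵖ M] [SMulCommClass B Rᵐᵒᵖ M] [SMulCommClass T Rᵐᵒᵖ M]
    [Module Tᵐᵒᵖ B] [SMulCommClass B Tᵐᵒᵖ B] (ρ : RightComodule 𝒞 M) : Prop :=
  (∀ (b : B) (m : M), ρ.coact (b • m) = b • ρ.coact m) ∧
  ∃ (hT : ∀ (t : T) (m : M), ρ.coact (t • m) = t • ρ.coact m)
    (hbal : ∀ (b : B) (t : T) (m : M), (op t • b) • m = b • t • m)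
    (σ : BimodHom B R M (BTensor T B M)),
    IsRightColinear ρ.coact (rightTensorCoaction B ρ.coact hT) σ.right ∧
    ∀ m : M, BTensor.lift
      (BTensor.mkBi (fun (b : B) (m : M) => b • m) (fun b b' m => add_smul b b' m)
        (fun b m m' => smul_add b m m')) hbal (σ m) = m

/-- `M` is a `(C, T)`-projective right `B`-module: `M` is a right `B`-module and left `C`-comodule
with right `B`-linear coaction, `B` is a left `T`-module and `M` is an `R`-`T` bimodule such that
the `C`-coaction is right `T`-linear, the right `B`-action is `T`-balanced, and there is a right
`B`-linear, left `C`-colinear section of `M ⊗_T B → M`. -/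
def IsEquivariantlyProjectiveRight (B T : Type*) {M : Type*} [Ring B] [Ring T] [AddCommGroup M]
    [Module Bᵐᵒᵖ M] [Module Tᵐᵒᵖ M] [Module R M] [SMulCommClass R Bᵐᵒᵖ M] [SMulCommClass R Tᵐᵒᵖ M]
    [Module T B] [SMulCommClass T Bᵐᵒᵖ B] (l : LeftComodule 𝒞 M) : Prop :=
  (∀ (b : B) (m : M), l.coact (op b • m) = op b • l.coact m) ∧
  ∃ (hT : ∀ (t : T) (m : M), l.coact (op t • m) = op t • l.coact m)
    (hbal : ∀ (m : M) (t : T) (b : B), op b • op t • m = op (t • b) • m)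
    (σ : BimodHom R B M (BTensor T M B)),
    IsLeftColinear l.coact (leftTensorCoaction B l.coact hT) σ.left ∧
    ∀ m : M, BTensor.lift
      (BTensor.mkBi (fun (m : M) (b : B) => op b • m) (fun m m' b => smul_add _ m m')
        (fun m b b' => by rw [op_add, add_smul])) hbal (σ m) = m

end Projectivity

universe u v w

/-- Flat left modules over a ring `T`, i.e. `- ⊗_T M` preserves injectivity of maps of right
`T`-modules. The test modules live in an arbitrary fixed universe `w`, which should contain that
of `T` (the notion is then independent of `w`). -/
def IsFlatLeft (T : Type u) (M : Type v) [Ring T] [AddCommGroup M] [Module T M] : Prop :=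
  ∀ (N N' : Type w) [AddCommGroup N] [AddCommGroup N'] [Module Tᵐᵒᵖ N] [Module Tᵐᵒᵖ N']
    (f : N →ₗ[Tᵐᵒᵖ] N'), Function.Injective f →
      Function.Injective (BTensor.map f (LinearMap.id : M →ₗ[T] M))

/-- Flat right modules over a ring `T`, i.e. `M ⊗_T -` preserves injectivity of maps of left
`T`-modules. The test modules live in an arbitrary fixed universe `w`, which should contain that
of `T` (the notion is then independent of `w`). -/
def IsFlatRight (T : Type u) (M : Type v) [Ring T] [AddCommGroup M] [Module Tᵐᵒᵖ M] : Prop :=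
  ∀ (N N' : Type w) [AddCommGroup N] [AddCommGroup N'] [Module T N] [Module T N']
    (f : N →ₗ[T] N'), Function.Injective f →
      Function.Injective (BTensor.map (LinearMap.id : M →ₗ[Tᵐᵒᵖ] M) f)

end

universe uk uR uC uA

/-! ## Exactness and flatness -/

namespace BTensor

section Exact

variable {T K N N' M M' : Type*} [Ring T] [AddCommGroup K] [AddCommGroup N] [AddCommGroup N']
  [AddCommGroup M] [AddCommGroup M']

/-! Write `e = ρ(1)`, `D = (A ⊗_R C)_ψ`, and `can : A ⊗_B A → D`, `a ⊗ a' ↦ a e a' = a ρ(a')`; let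
`canLift : A ⊗_T A → D` be the same formula over `T`. The left-module case is described; the other
is its mirror image, with `C ⊗_R A` in place of `A ⊗_R C`, the passage between the two being the
bijection `ψ`.

From (2) to (1): when `can` is bijective it carries the coactions of `A ⊗_B A` to those of `A ⊗_R C`
and, through `ψ`, of `C ⊗_R A`. Hence the translation map `τ(c) = can⁻¹(1 ⊗ c)` is colinear on both
sides. An equivariant section `σ : A → B ⊗_T A` extends to `θ : A ⊗_B A → A ⊗_T A`, `a ⊗ a' ↦ a
σ(a')`, again colinear on both sides, with `canLift ∘ θ = can` because `σ` splits the
multiplication. So `θ ∘ τ` is a strong connection (`exists_isStrongConnection`).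

From (1) to (2): set `L(a ⊗ c) = a ℓ(c)` (`extLeft`), which splits `canLift`; this already makes
`can` surjective. The candidate section is `σ(a) = L(ρ(a)) = a₀ ℓ(a₁)`, a priori in `A ⊗_T A`. Left
colinearity of `ℓ` and coassociativity of `ρ` show that `ρ` and `u ↦ u e`, applied to the first
factor, agree on `σ(a)` (`extLeft_ρ_coinvariant`). As `B` is the kernel of `u ↦ ρ(u) - u e`,
flatness of `A` identifies `B ⊗_T A` with the kernel of the map tensored with `A`, so `σ(a)` lies in
`B ⊗_T A`. It is a section because `canLift (σ(a)) = ρ(a)` and `ρ` is injective. It also inverts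
`can`: the image of `L(a ρ(a')) = a σ(a')` in `A ⊗_B A` is `a ⊗ a'`.

The delicate point is colinearity of `σ`. It is clear after mapping to `(A ⊗_T A) ⊗_R C`, but `C` is
not assumed flat over `R`, so `(B ⊗_T A) ⊗_R C` need not obviously embed there. It does, because `ℓ`
makes `A ⊗_R C` a retract of `A ⊗_T A` as a left `T`-module: the map in question is then a retract
of `B ⊗_T A ⊗_T A → A ⊗_T A ⊗_T A`, which is injective by flatness applied twice
(`map_injective_of_retract`). -/

theorem map_injective_of_leftInverse [Module Tᵐᵒᵖ N] [Module Tᵐᵒᵖ N'] [Module T M] [Module T M']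
    {f : N →ₗ[Tᵐᵒᵖ] N'} {g : M →ₗ[T] M'} {f' : N' →ₗ[Tᵐᵒᵖ] N} {g' : M' →ₗ[T] M}
    (hf : ∀ x, f' (f x) = x) (hg : ∀ x, g' (g x) = x) : Function.Injective (map f g) := by
  apply Function.LeftInverse.injective (g := map f' g')
  intro x
  have h1 : f' ∘ₗ f = LinearMap.id := LinearMap.ext hf
  have h2 : g' ∘ₗ g = LinearMap.id := LinearMap.ext hg
  rw [map_map, h1, h2, map_id]

theorem sub_tmul [Module Tᵐᵒᵖ N] [Module T M] (n n' : N) (m : M) :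
    tmul T (n - n') m = tmul T n m - tmul T n' m := by
  rw [eq_sub_iff_add_eq, ← add_tmul, sub_add_cancel]

theorem tmul_sub [Module Tᵐᵒᵖ M] [Module T N] (m : M) (n n' : N) :
    tmul T m (n - n') = tmul T m n - tmul T m n' := by
  rw [eq_sub_iff_add_eq, ← tmul_add, sub_add_cancel]

theorem map_sub_left [Module Tᵐᵒᵖ N] [Module Tᵐᵒᵖ N'] [Module T M] (f g : N →ₗ[Tᵐᵒᵖ] N')
    (x : BTensor T N M) : map (f - g) (LinearMap.id : M →ₗ[T] M) x =
      map f LinearMap.id x - map g LinearMap.id x := by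
  induction x using BTensor.induction with
  | zero => simp only [map_zero, sub_zero]
  | tmul n m => simp only [map_tmul, LinearMap.sub_apply, sub_tmul]
  | add x y hx hy => simp only [map_add, hx, hy]; abel

theorem map_sub_right [Module Tᵐᵒᵖ M] [Module T N] [Module T N'] (f g : N →ₗ[T] N')
    (x : BTensor T M N) : map (LinearMap.id : M →ₗ[Tᵐᵒᵖ] M) (f - g) x =
      map LinearMap.id f x - map LinearMap.id g x := by
  induction x using BTensor.induction with
  | zero => simp only [map_zero, sub_zero]
  | tmul n m => simp only [map_tmul, LinearMap.sub_apply, tmul_sub]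
  | add x y hx hy => simp only [map_add, hx, hy]; abel

/-- Right exactness of `- ⊗_T M`. -/
theorem mem_range_map_of_surjective [Module Tᵐᵒᵖ K] [Module Tᵐᵒᵖ N] [Module Tᵐᵒᵖ N'] [Module T M]
    (i : K →ₗ[Tᵐᵒᵖ] N) (p : N →ₗ[Tᵐᵒᵖ] N') (hp : Function.Surjective p)
    (hex : ∀ n, p n = 0 → ∃ y, i y = n) {x : BTensor T N M}
    (hx : map p (LinearMap.id : M →ₗ[T] M) x = 0) :
    ∃ y, map i (LinearMap.id : M →ₗ[T] M) y = x := by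
  let I := (map i (LinearMap.id : M →ₗ[T] M)).range
  have key : ∀ n n' (m : M), p n = p n' →
      (QuotientAddGroup.mk' I) (tmul T n m) = QuotientAddGroup.mk' I (tmul T n' m) := by
    intro n n' m h
    obtain ⟨y, hy⟩ := hex (n - n') (by rw [map_sub, h, sub_self])
    rw [← sub_eq_zero, ← map_sub]
    refine (QuotientAddGroup.eq_zero_iff _).2 ⟨tmul T y m, ?_⟩
    rw [map_tmul, hy, LinearMap.id_apply, sub_tmul]
  -- A merely set-theoretic section of `p` is enough to invert the map from the cokernel of `i ⊗ M`
  -- to `N' ⊗ M`: by `key` the class of `s n ⊗ m` modulo `I` does not depend on the chosen preimage,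
  -- so it is additive and balanced in `n`.
  let s := Function.surjInv hp
  have hs : ∀ n, p (s n) = n := Function.surjInv_eq hp
  let g : BTensor T N' M →+ BTensor T N M ⧸ I := lift
    (mkBi (fun n m => QuotientAddGroup.mk' I (tmul T (s n) m))
      (fun n n' m => by
        rw [← map_add, ← add_tmul]
        exact key _ _ _ (by rw [map_add, hs, hs, hs]))
      (fun n m m' => by rw [tmul_add, map_add]))
    (fun n t m => by
      change QuotientAddGroup.mk' I (tmul T (s (op t • n)) m) =
        QuotientAddGroup.mk' I (tmul T (s n) (t • m))
      rw [← smul_tmul]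
      exact key _ _ _ (by rw [map_smul, hs, hs]))
  have hg : ∀ z, g (map p LinearMap.id z) = QuotientAddGroup.mk' I z := by
    intro z
    induction z using BTensor.induction with
    | zero => simp
    | tmul n m => exact key _ _ _ (hs _)
    | add x y hx hy => simp only [map_add, hx, hy]
  have h0 := hg x
  rw [hx, map_zero] at h0
  exact (QuotientAddGroup.eq_zero_iff _).1 h0.symm

/-- Right exactness of `M ⊗_T -`. -/
theorem mem_range_map_of_surjective' [Module T K] [Module T N] [Module T N'] [Module Tᵐᵒᵖ M]
    (i : K →ₗ[T] N) (p : N →ₗ[T] N') (hp : Function.Surjective p)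
    (hex : ∀ n, p n = 0 → ∃ y, i y = n) {x : BTensor T M N}
    (hx : map (LinearMap.id : M →ₗ[Tᵐᵒᵖ] M) p x = 0) :
    ∃ y, map (LinearMap.id : M →ₗ[Tᵐᵒᵖ] M) i y = x := by
  let I := (map (LinearMap.id : M →ₗ[Tᵐᵒᵖ] M) i).range
  have key : ∀ n n' (m : M), p n = p n' →
      (QuotientAddGroup.mk' I) (tmul T m n) = QuotientAddGroup.mk' I (tmul T m n') := by
    intro n n' m h
    obtain ⟨y, hy⟩ := hex (n - n') (by rw [map_sub, h, sub_self])
    rw [← sub_eq_zero, ← map_sub]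
    refine (QuotientAddGroup.eq_zero_iff _).2 ⟨tmul T m y, ?_⟩
    rw [map_tmul, hy, LinearMap.id_apply, tmul_sub]
  let s := Function.surjInv hp
  have hs : ∀ n, p (s n) = n := Function.surjInv_eq hp
  let g : BTensor T M N' →+ BTensor T M N ⧸ I := lift
    (mkBi (fun m n => QuotientAddGroup.mk' I (tmul T m (s n)))
      (fun m m' n => by rw [add_tmul, map_add])
      (fun m n n' => by
        rw [← map_add, ← tmul_add]
        exact key _ _ _ (by rw [map_add, hs, hs, hs])))
    (fun m t n => by
      change QuotientAddGroup.mk' I (tmul T (op t • m) (s n)) =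
        QuotientAddGroup.mk' I (tmul T m (s (t • n)))
      rw [smul_tmul]
      exact key _ _ _ (by rw [map_smul, hs, hs]))
  have hg : ∀ z, g (map LinearMap.id p z) = QuotientAddGroup.mk' I z := by
    intro z
    induction z using BTensor.induction with
    | zero => simp
    | tmul m n => exact key _ _ _ (hs _)
    | add x y hx hy => simp only [map_add, hx, hy]
  have h0 := hg x
  rw [hx, map_zero] at h0
  exact (QuotientAddGroup.eq_zero_iff _).1 h0.symm

end Exact

/-! ### Injectivity inherited by retracts of tensor products -/

section Retract

variable {R T Y Y' M C P Q : Type*} [Ring R] [Ring T] [AddCommGroup Y] [AddCommGroup Y']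
  [AddCommGroup M] [AddCommGroup C] [AddCommGroup P] [AddCommGroup Q]

/-- If `M ⊗_R C` is a retract of `P ⊗_T Q`, then `(i ⊗_T M) ⊗_R C` is injective as soon as
`(i ⊗_T P) ⊗_T Q` is. -/
theorem map_injective_of_retract [Module Tᵐᵒᵖ Y] [Module Tᵐᵒᵖ Y'] [Module T M] [Module Rᵐᵒᵖ M]
    [SMulCommClass T Rᵐᵒᵖ M] [Module R C] [Module T P] [Module Tᵐᵒᵖ P] [SMulCommClass T Tᵐᵒᵖ P]
    [Module T Q] {i : Y →ₗ[Tᵐᵒᵖ] Y'}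
    {s : BTensor R M C →ₗ[T] BTensor T P Q} {r : BTensor T P Q →ₗ[T] BTensor R M C}
    (hrs : ∀ x, r (s x) = x) {iM : BTensor T Y M →ₗ[Rᵐᵒᵖ] BTensor T Y' M}
    (hM : ∀ y m, iM (tmul T y m) = tmul T (i y) m)
    {iP : BTensor T Y P →ₗ[Tᵐᵒᵖ] BTensor T Y' P}
    (hP : ∀ y p, iP (tmul T y p) = tmul T (i y) p)
    (hinj : Function.Injective (map iP (LinearMap.id : Q →ₗ[T] Q))) :
    Function.Injective (map iM (LinearMap.id : C →ₗ[R] C)) := by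
  have h1 : ∀ y (x : BTensor T P Q), map iP LinearMap.id ((assoc T T Y P Q).symm (tmul T y x)) =
      (assoc T T Y' P Q).symm (tmul T (i y) x) := by
    intro y x
    induction x using BTensor.induction with
    | zero => simp only [tmul_zero, map_zero]
    | tmul p q => simp only [assoc_symm_tmul, map_tmul, hP, LinearMap.id_apply]
    | add x y hx hy => simp only [map_add, tmul_add, hx, hy]
  -- After reassociating, `Y ⊗ s` sends `(Y ⊗_T M) ⊗_R C` to `(Y ⊗_T P) ⊗_T Q`, naturally in `Y`;
  -- the square for `i` reduces injectivity of `iM ⊗ C` to that of `iP ⊗ Q`.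
  have hsq : ∀ ξ, map iP LinearMap.id ((assoc T T Y P Q).symm (map LinearMap.id s
      (assoc T R Y M C ξ))) = (assoc T T Y' P Q).symm (map LinearMap.id s
        (assoc T R Y' M C (map iM LinearMap.id ξ))) := by
    intro ξ
    induction ξ using BTensor.induction with
    | zero => simp only [map_zero]
    | tmul y c =>
      induction y using BTensor.induction with
      | zero => simp only [map_zero, zero_tmul]
      | tmul y m => simp only [assoc_tmul, map_tmul, hM, LinearMap.id_apply, h1]
      | add x y hx hy => simp only [add_tmul, map_add, hx, hy]
    | add x y hx hy => simp only [map_add, hx, hy]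
  -- Tensoring with `Y` need not preserve injectivity of `s`; the retraction `r` is what keeps `Y ⊗
  -- s` injective.
  have hs := map_injective_of_leftInverse (f := (LinearMap.id : Y →ₗ[Tᵐᵒᵖ] Y)) (g := s)
    (f' := LinearMap.id) (g' := r) (fun _ => rfl) hrs
  intro ξ ξ' h
  apply (assoc T R Y M C).injective
  apply hs
  apply (assoc T T Y P Q).symm.injective
  apply hinj
  rw [hsq, hsq, h]

/-- If `C ⊗_R M` is a retract of `P ⊗_T Q`, then `C ⊗_R (M ⊗_T i)` is injective as soon as
`P ⊗_T (Q ⊗_T i)` is. -/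
theorem map_injective_of_retract' [Module T Y] [Module T Y'] [Module R M] [Module Tᵐᵒᵖ M]
    [SMulCommClass R Tᵐᵒᵖ M] [Module Rᵐᵒᵖ C] [Module Tᵐᵒᵖ P] [Module T Q] [Module Tᵐᵒᵖ Q]
    [SMulCommClass T Tᵐᵒᵖ Q] {i : Y →ₗ[T] Y'}
    {s : BTensor R C M →ₗ[Tᵐᵒᵖ] BTensor T P Q} {r : BTensor T P Q →ₗ[Tᵐᵒᵖ] BTensor R C M}
    (hrs : ∀ x, r (s x) = x) {iM : BTensor T M Y →ₗ[R] BTensor T M Y'}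
    (hM : ∀ m y, iM (tmul T m y) = tmul T m (i y))
    {iQ : BTensor T Q Y →ₗ[T] BTensor T Q Y'}
    (hQ : ∀ q y, iQ (tmul T q y) = tmul T q (i y))
    (hinj : Function.Injective (map (LinearMap.id : P →ₗ[Tᵐᵒᵖ] P) iQ)) :
    Function.Injective (map (LinearMap.id : C →ₗ[Rᵐᵒᵖ] C) iM) := by
  have h1 : ∀ y (x : BTensor T P Q), map LinearMap.id iQ (assoc T T P Q Y (tmul T x y)) =
      assoc T T P Q Y' (tmul T x (i y)) := by
    intro y x
    induction x using BTensor.induction with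
    | zero => simp only [zero_tmul, map_zero]
    | tmul p q => simp only [assoc_tmul, map_tmul, hQ, LinearMap.id_apply]
    | add x y hx hy => simp only [map_add, add_tmul, hx, hy]
  have hsq : ∀ ξ, map LinearMap.id iQ (assoc T T P Q Y (map s LinearMap.id
      ((assoc R T C M Y).symm ξ))) = assoc T T P Q Y' (map s LinearMap.id
        ((assoc R T C M Y').symm (map LinearMap.id iM ξ))) := by
    intro ξ
    induction ξ using BTensor.induction with
    | zero => simp only [map_zero]
    | tmul c y =>
      induction y using BTensor.induction with
      | zero => simp only [map_zero, tmul_zero]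
      | tmul m y => simp only [assoc_symm_tmul, map_tmul, hM, LinearMap.id_apply, h1]
      | add x y hx hy => simp only [tmul_add, map_add, hx, hy]
    | add x y hx hy => simp only [map_add, hx, hy]
  have hs := map_injective_of_leftInverse (f := s) (g := (LinearMap.id : Y →ₗ[T] Y))
    (f' := r) (g' := LinearMap.id) hrs (fun _ => rfl)
  intro ξ ξ' h
  apply (assoc R T C M Y).symm.injective
  apply hs
  apply (assoc T T P Q Y).injective
  apply hinj
  rw [hsq, hsq, h]

end Retract

end BTensor

namespace BimodHom

variable {R S M N : Type*} [Ring R] [Ring S] [AddCommGroup M] [AddCommGroup N]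
  [Module R M] [Module Sᵐᵒᵖ M] [Module R N] [Module Sᵐᵒᵖ N]

/-- A bilinear map from an additive map. -/
def ofAddHom (f : M →+ N) (hl : ∀ (r : R) m, f (r • m) = r • f m)
    (hr : ∀ (s : S) m, f (op s • m) = op s • f m) : BimodHom R S M N where
  toFun := f
  map_add' := map_add f
  map_smul' := hl
  map_op_smul' := hr

end BimodHom

/-! ### Flatness: change of universe and preservation of kernels -/

section Flat

universe a b c d

variable {T : Type c} {M : Type d} [Ring T] [AddCommGroup M]

namespace IsFlatLeft

variable [Module T M]

/-- Test modules live in `max a b`, so the smaller source `N` is replaced by its `ULift`; the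
comparison isomorphism stays surjective after tensoring, which is all that cancellation on the right
requires. -/
theorem map_injective (h : IsFlatLeft.{c, d, max a b} T M) {N : Type a} {N' : Type (max a b)}
    [AddCommGroup N] [AddCommGroup N'] [Module Tᵐᵒᵖ N] [Module Tᵐᵒᵖ N'] (f : N →ₗ[Tᵐᵒᵖ] N')
    (hf : Function.Injective f) :
    Function.Injective (BTensor.map f (LinearMap.id : M →ₗ[T] M)) := by
  let d : ULift.{b} N ≃ₗ[Tᵐᵒᵖ] N := ULift.moduleEquiv
  have h1 := h _ _ (f ∘ₗ d.toLinearMap) (hf.comp d.injective)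
  apply Function.Injective.of_comp_right (g := BTensor.map d.toLinearMap LinearMap.id)
  · convert h1 using 1
    ext x
    exact BTensor.map_map _ _ _ _ x
  · intro x
    refine ⟨BTensor.map d.symm.toLinearMap LinearMap.id x, ?_⟩
    have h2 : d.toLinearMap ∘ₗ d.symm.toLinearMap = LinearMap.id :=
      LinearMap.ext d.apply_symm_apply
    rw [BTensor.map_map, h2]
    exact BTensor.map_id x

theorem map_injective_small (h : IsFlatLeft.{c, d, max a b} T M) {N N' : Type a}
    [AddCommGroup N] [AddCommGroup N'] [Module Tᵐᵒᵖ N] [Module Tᵐᵒᵖ N'] (f : N →ₗ[Tᵐᵒᵖ] N')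
    (hf : Function.Injective f) :
    Function.Injective (BTensor.map f (LinearMap.id : M →ₗ[T] M)) := by
  let d : ULift.{b} N' ≃ₗ[Tᵐᵒᵖ] N' := ULift.moduleEquiv
  have h1 := h.map_injective (d.symm.toLinearMap ∘ₗ f) (d.symm.injective.comp hf)
  apply Function.Injective.of_comp (f := BTensor.map d.symm.toLinearMap LinearMap.id)
  convert h1 using 1
  ext x
  exact BTensor.map_map _ _ _ _ x

/-- Factor `f` through `N / ker f`. Flatness handles the injection `N / ker f → N'`, and right
exactness handles the quotient map; together they say that tensoring with `M` preserves kernels. -/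
theorem mem_range_map (h : IsFlatLeft.{c, d, max a b} T M) {K N : Type a} {N' : Type (max a b)}
    [AddCommGroup K] [AddCommGroup N] [AddCommGroup N'] [Module Tᵐᵒᵖ K] [Module Tᵐᵒᵖ N]
    [Module Tᵐᵒᵖ N'] (i : K →ₗ[Tᵐᵒᵖ] N) (f : N →ₗ[Tᵐᵒᵖ] N')
    (hex : ∀ n, f n = 0 → ∃ y, i y = n) {x : BTensor T N M}
    (hx : BTensor.map f (LinearMap.id : M →ₗ[T] M) x = 0) :
    ∃ y, BTensor.map i (LinearMap.id : M →ₗ[T] M) y = x := by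
  refine BTensor.mem_range_map_of_surjective i (LinearMap.ker f).mkQ
    (Submodule.mkQ_surjective _) (fun n hn => hex n ((Submodule.Quotient.mk_eq_zero _).1 hn)) ?_
  apply h.map_injective ((LinearMap.ker f).liftQ f le_rfl)
    (LinearMap.ker_eq_bot.1 (Submodule.ker_liftQ_eq_bot _ _ _ le_rfl))
  rw [BTensor.map_map, Submodule.liftQ_mkQ, map_zero]
  exact hx

end IsFlatLeft

namespace IsFlatRight

variable [Module Tᵐᵒᵖ M]

theorem map_injective (h : IsFlatRight.{c, d, max a b} T M) {N : Type a} {N' : Type (max a b)}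
    [AddCommGroup N] [AddCommGroup N'] [Module T N] [Module T N'] (f : N →ₗ[T] N')
    (hf : Function.Injective f) :
    Function.Injective (BTensor.map (LinearMap.id : M →ₗ[Tᵐᵒᵖ] M) f) := by
  let d : ULift.{b} N ≃ₗ[T] N := ULift.moduleEquiv
  have h1 := h _ _ (f ∘ₗ d.toLinearMap) (hf.comp d.injective)
  apply Function.Injective.of_comp_right (g := BTensor.map LinearMap.id d.toLinearMap)
  · convert h1 using 1
    ext x
    exact BTensor.map_map _ _ _ _ x
  · intro x
    refine ⟨BTensor.map LinearMap.id d.symm.toLinearMap x, ?_⟩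
    have h2 : d.toLinearMap ∘ₗ d.symm.toLinearMap = LinearMap.id :=
      LinearMap.ext d.apply_symm_apply
    rw [BTensor.map_map, h2]
    exact BTensor.map_id x

theorem map_injective_small (h : IsFlatRight.{c, d, max a b} T M) {N N' : Type a}
    [AddCommGroup N] [AddCommGroup N'] [Module T N] [Module T N'] (f : N →ₗ[T] N')
    (hf : Function.Injective f) :
    Function.Injective (BTensor.map (LinearMap.id : M →ₗ[Tᵐᵒᵖ] M) f) := by
  let d : ULift.{b} N' ≃ₗ[T] N' := ULift.moduleEquiv
  have h1 := h.map_injective (d.symm.toLinearMap ∘ₗ f) (d.symm.injective.comp hf)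
  apply Function.Injective.of_comp (f := BTensor.map LinearMap.id d.symm.toLinearMap)
  convert h1 using 1
  ext x
  exact BTensor.map_map _ _ _ _ x

theorem mem_range_map (h : IsFlatRight.{c, d, max a b} T M) {K N : Type a} {N' : Type (max a b)}
    [AddCommGroup K] [AddCommGroup N] [AddCommGroup N'] [Module T K] [Module T N]
    [Module T N'] (i : K →ₗ[T] N) (f : N →ₗ[T] N')
    (hex : ∀ n, f n = 0 → ∃ y, i y = n) {x : BTensor T M N}
    (hx : BTensor.map (LinearMap.id : M →ₗ[Tᵐᵒᵖ] M) f x = 0) :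
    ∃ y, BTensor.map (LinearMap.id : M →ₗ[Tᵐᵒᵖ] M) i y = x := by
  refine BTensor.mem_range_map_of_surjective' i (LinearMap.ker f).mkQ
    (Submodule.mkQ_surjective _) (fun n hn => hex n ((Submodule.Quotient.mk_eq_zero _).1 hn)) ?_
  apply h.map_injective ((LinearMap.ker f).liftQ f le_rfl)
    (LinearMap.ker_eq_bot.1 (Submodule.ker_liftQ_eq_bot _ _ _ le_rfl))
  rw [BTensor.map_map, Submodule.liftQ_mkQ, map_zero]
  exact hx

end IsFlatRight

end Flat

noncomputable section

namespace Entwining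

theorem assoc_smul_tmul {R C A : Type*} [Ring R] [AddCommGroup C] [Module R C] [Module Rᵐᵒᵖ C]
    [SMulCommClass R Rᵐᵒᵖ C] [Ring A] [Module R A] [Module Rᵐᵒᵖ A] [IsRRing R A]
    (a : A) (x : BTensor R A C) (c : C) :
    BTensor.assoc R R A C C (BTensor.tmul R (a • x) c) =
      a • BTensor.assoc R R A C C (BTensor.tmul R x c) := by
  induction x using BTensor.induction with
  | zero => simp [BTensor.zero_tmul]
  | tmul u d => rfl
  | add x y hx hy => simp only [map_add, smul_add, BTensor.add_tmul, hx, hy]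

namespace Extension

variable {k R C A : Type*} [CommRing k] [Ring R] [Algebra k R] [AddCommGroup C] [Module R C]
  [Module Rᵐᵒᵖ C] [SMulCommClass R Rᵐᵒᵖ C] [IsBimoduleOver k R C] {𝒞 : Coring R C} [Ring A]
  [Algebra k A] [Module R A] [Module Rᵐᵒᵖ A] [IsRRing R A] [IsScalarTower k R A]
  {E : Entwining 𝒞 A} (X : E.Extension)

/-! ## Colinearity of the canonical map -/

section Canonical

theorem ρ_coinv_smul (b : X.coinv k) (a : A) : X.ρ (b • a) = b • X.ρ a := by
  -- The action of `B` on `A ⊗_R C` is induced from the `B`-module `A`, while `ρ_coinv_mul` uses the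
  -- action of `A`; they agree on pure tensors.
  have h : b • X.ρ a = (b : A) • X.ρ a := by
    induction X.ρ a using BTensor.induction with
    | zero => simp
    | tmul a c => rfl
    | add x y hx hy => rw [smul_add, smul_add, hx, hy]
  rw [h]
  exact X.ρ_coinv_mul k b a

theorem leftρ_op_coinv_smul (b : X.coinv k) (a : A) :
    X.leftρ (op b • a) = op b • X.leftρ a := by
  have h : op b • X.leftρ a = op (b : A) • X.leftρ a := by
    induction X.leftρ a using BTensor.induction with
    | zero => simp
    | tmul c a => rfl
    | add x y hx hy => rw [smul_add, smul_add, hx, hy]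
  rw [h]
  exact X.leftρ_mul_coinv k a b

theorem rmul_ρ_one (a : A) : E.rmul a (X.ρ 1) = X.ρ a := by rw [← X.ρ_mul, one_mul]

/-- Right multiplication by `b` on `(A ⊗_R C)_ψ` as a left `R`-linear map. -/
def rmulLin (E : Entwining 𝒞 A) (b : A) : BTensor R A C →ₗ[R] BTensor R A C where
  toFun := E.rmul b
  map_add' := map_add _
  map_smul' r x := by
    rw [← BTensor.smul_one_smul, E.rmul_smul, BTensor.smul_one_smul, RingHom.id_apply]

variable (k) in
/-- The canonical map `A ⊗_B A → A ⊗_R C`, `a ⊗ a' ↦ a ρ^A(a')`, as a bimodule map. -/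
def canBimod : BimodHom R R (BTensor (X.coinv k) A A) (BTensor R A C) where
  toFun := BTensor.lift
    (BTensor.mkBi (fun a a' => a • X.ρ a') (fun a b a' => add_smul a b _)
      (fun a b b' => by rw [map_add, smul_add]))
    (fun a b a' => by
      change (a * (b : A)) • X.ρ a' = a • X.ρ ((b : A) * a')
      rw [X.ρ_coinv_mul, mul_smul])
  map_add' := map_add _
  map_smul' r x := by
    induction x using BTensor.induction with
    | zero => simp
    | tmul a a' =>
      change (r • a) • X.ρ a' = r • a • X.ρ a'
      rw [IsRRing.smul_eq, mul_smul, BTensor.smul_one_smul]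
    | add x y hx hy =>
      simp only [smul_add, map_add, RingHom.id_apply] at hx hy ⊢
      rw [hx, hy]
  map_op_smul' r x := by
    induction x using BTensor.induction with
    | zero => simp
    | tmul a a' =>
      change a • X.ρ (op r • a') = op r • a • X.ρ a'
      rw [X.ρ.map_smul, smul_comm]
    | add x y hx hy =>
      rw [smul_add]
      exact (map_add _ _ _).trans ((congrArg₂ _ hx hy).trans
        ((smul_add _ _ _).symm.trans (congrArg _ (map_add _ _ _).symm)))

theorem canBimod_tmul (a a' : A) :
    X.canBimod k (BTensor.tmul (X.coinv k) a a') = a • X.ρ a' := rfl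

/-- The two canonical maps `a e a'` and `a ρ(a')` coincide because `ρ(a') = e a'` in `(A ⊗_R C)_ψ`.
-/
theorem can_bijective_iff : Function.Bijective (Coring.can k X.grouplike (A := A)) ↔
    Function.Bijective (X.canBimod k).left := by
  have h : Coring.can k X.grouplike (A := A) = (X.canBimod k).left.toAddMonoidHom := by
    apply BTensor.hom_ext
    intro a a'
    exact congrArg (a • ·) (X.rmul_ρ_one a')
  rw [h]
  exact Iff.rfl

variable (k) in
/-- The map `A ⊗_B A → C ⊗_R A`, `a ⊗ a' ↦ ψ⁻¹(a ρ^A(1)) a'`. -/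
def leftCan : BTensor (X.coinv k) A A →+ BTensor R C A :=
  BTensor.lift
    (BTensor.mkBi (fun a a' => op a' • X.leftρ a) (fun a b a' => by rw [map_add, smul_add])
      (fun a b b' => by rw [op_add, add_smul]))
    (fun a b a' => by
      change op a' • X.leftρ (a * (b : A)) = op ((b : A) * a') • X.leftρ a
      rw [X.leftρ_mul_coinv, op_mul, mul_smul])

theorem leftCan_tmul (a a' : A) :
    X.leftCan k (BTensor.tmul (X.coinv k) a a') = op a' • X.leftρ a := rfl

/-- Since `ψ` turns `leftρ a` into `a ρ(1)` and right multiplication on `C ⊗_R A` into that of `(A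
⊗_R C)_ψ`, the map `leftCan` is `ψ⁻¹` after the canonical map. It is the form of the canonical map
suited to left coactions. -/
theorem ψ_leftCan (x : BTensor (X.coinv k) A A) : E.ψ (X.leftCan k x) = X.canBimod k x := by
  induction x using BTensor.induction with
  | zero => simp
  | tmul a a' =>
    rw [leftCan_tmul, E.ψ_op_smul, ψ_leftρ, E.rmul_smul, rmul_ρ_one]
    rfl
  | add x y hx hy => simp only [map_add, hx, hy]

/-- On `a ⊗ a'` this is coassociativity of `ρ` at `a'`, multiplied on the left by `a`. -/
theorem canBimod_right_colinear (x : BTensor (X.coinv k) A A) :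
    BTensor.assoc R R A C C (BTensor.map (X.canBimod k).right LinearMap.id
      (rightTensorCoaction A X.comodule.coact X.ρ_coinv_smul x)) =
      BTensor.map LinearMap.id 𝒞.comul.left (X.canBimod k x) := by
  induction x using BTensor.induction with
  | zero => simp
  | tmul a a' =>
    rw [canBimod_tmul, map_smul_left]
    refine Eq.trans ?_ (congrArg (a • ·) (X.comodule.coassoc a'))
    change BTensor.assoc R R A C C (BTensor.map (X.canBimod k).right LinearMap.id
      ((BTensor.assoc (X.coinv k) R A A C).symm (BTensor.tmul (X.coinv k) a (X.ρ a')))) =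
      a • BTensor.assoc R R A C C (BTensor.map X.ρ LinearMap.id (X.ρ a'))
    induction X.ρ a' using BTensor.induction with
    | zero => simp [BTensor.tmul_zero]
    | tmul u c =>
      rw [BTensor.assoc_symm_tmul, BTensor.map_tmul, BTensor.map_tmul, BimodHom.right_apply,
        canBimod_tmul]
      exact assoc_smul_tmul a (X.ρ u) c
    | add x y hx hy => simp only [map_add, smul_add, BTensor.tmul_add, hx, hy]
  | add x y hx hy => simp only [map_add, hx, hy]

/-- The natural left coaction on the target is `Δ ⊗ A` on `C ⊗_R A`, so `leftCan` appears on one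
side. On `a ⊗ a'` the identity is coassociativity of the left coaction at `a`, multiplied on the
right by `a'`. -/
theorem canBimod_left_colinear (x : BTensor (X.coinv k) A A) :
    BTensor.map LinearMap.id (X.canBimod k).left
      (leftTensorCoaction A X.leftComodule.coact X.leftρ_op_coinv_smul x) =
      BTensor.map LinearMap.id E.ψ.left
        (BTensor.assoc R R C C A (BTensor.map 𝒞.comul.right LinearMap.id (X.leftCan k x))) := by
  induction x using BTensor.induction with
  | zero => simp
  | tmul a a' =>
    -- `h1`, `h2` and `h3` show that on both sides `a'` enters only through right multiplication on
    -- the last factor, which leaves an identity about `leftρ a` alone.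
    have h1 : ∀ y : BTensor R C A, BTensor.map LinearMap.id (X.canBimod k).left
        (BTensor.assoc R (X.coinv k) C A A (BTensor.tmul (X.coinv k) y a')) =
        BTensor.map LinearMap.id (rmulLin E a') (BTensor.map LinearMap.id E.ψ.left
          (BTensor.map LinearMap.id X.leftρ y)) := by
      intro y
      induction y using BTensor.induction with
      | zero => simp [BTensor.zero_tmul]
      | tmul c u =>
        simp only [BTensor.assoc_tmul, BTensor.map_tmul]
        congr 1
        change u • X.ρ a' = E.rmul a' (E.ψ (X.leftρ u))
        rw [ψ_leftρ, E.rmul_smul, rmul_ρ_one]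
      | add x y hx hy => simp only [map_add, BTensor.add_tmul, hx, hy]
    have h2 : ∀ w : BTensor R C C, ∀ u : A,
        BTensor.map LinearMap.id E.ψ.left
          (BTensor.assoc R R C C A (BTensor.tmul R w (u * a'))) =
        BTensor.map LinearMap.id (rmulLin E a') (BTensor.map LinearMap.id E.ψ.left
          (BTensor.assoc R R C C A (BTensor.tmul R w u))) := by
      intro w u
      induction w using BTensor.induction with
      | zero => simp [BTensor.zero_tmul]
      | tmul c d =>
        simp only [BTensor.assoc_tmul, BTensor.map_tmul]
        congr 1
        exact E.ψ_mul d u a'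
      | add x y hx hy => simp only [map_add, BTensor.add_tmul, hx, hy]
    have h3 : ∀ y : BTensor R C A, BTensor.map LinearMap.id E.ψ.left
        (BTensor.assoc R R C C A (BTensor.map 𝒞.comul.right LinearMap.id (op a' • y))) =
        BTensor.map LinearMap.id (rmulLin E a') (BTensor.map LinearMap.id E.ψ.left
          (BTensor.assoc R R C C A (BTensor.map 𝒞.comul.right LinearMap.id y))) := by
      intro y
      induction y using BTensor.induction with
      | zero => simp
      | tmul c u => exact h2 (𝒞.comul c) u
      | add x y hx hy => simp only [map_add, smul_add, hx, hy]
    rw [leftCan_tmul, h3]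
    refine (h1 (X.leftρ a)).trans (congrArg _ (congrArg _ ?_))
    exact (X.leftComodule.coassoc a).symm
  | add x y hx hy => simp only [map_add, hx, hy]

end Canonical

/-! ## Strong connections from colinear sections -/

section OfSection

variable (T : Subalgebra k (X.coinv k))

variable {X} in
/-- The canonical map as an additive equivalence. -/
def canEquiv (h : Function.Bijective (X.canBimod k).left) :
    BTensor (X.coinv k) A A ≃+ BTensor R A C :=
  AddEquiv.ofBijective (X.canBimod k).left h

variable {X} in
/-- The translation map `C → A ⊗_B A`, `c ↦ can⁻¹(1 ⊗ c)`. -/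
def translation (h : Function.Bijective (X.canBimod k).left) :
    BimodHom R R C (BTensor (X.coinv k) A A) where
  toFun c := (canEquiv h).symm (BTensor.tmul R 1 c)
  map_add' c d := by rw [BTensor.tmul_add, map_add]
  map_smul' r c := by
    rw [AddEquiv.symm_apply_eq, ← BTensor.smul_tmul, IsRRing.op_smul_one,
      ← BTensor.left_smul_tmul, RingHom.id_apply]
    refine Eq.trans ?_ (map_smul (X.canBimod k).left r _).symm
    exact congrArg (r • ·) ((canEquiv h).apply_symm_apply _).symm
  map_op_smul' r c := by
    rw [AddEquiv.symm_apply_eq, ← BTensor.right_smul_tmul]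
    refine Eq.trans ?_ ((X.canBimod k).map_op_smul r _).symm
    exact congrArg (op r • ·) ((canEquiv h).apply_symm_apply _).symm

/-! ### Bicolinearity of the translation map -/

section Translation

variable {X} (h : Function.Bijective (X.canBimod k).left)

theorem canBimod_translation (c : C) : X.canBimod k (translation h c) = BTensor.tmul R 1 c :=
  (canEquiv h).apply_symm_apply _

theorem leftCan_translation (c : C) : X.leftCan k (translation h c) = BTensor.tmul R c 1 := by
  apply X.bijective.1
  rw [ψ_leftCan, canBimod_translation, E.map_one]

/-- The canonical map is a right `R`-linear isomorphism, so the identity may be checked after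
applying it. The translation map then becomes `c ↦ 1 ⊗ c`, and both sides are `1 ⊗ Δ(c)`. -/
theorem translation_right_colinear : IsRightColinear 𝒞.comul.right
    (rightTensorCoaction A X.comodule.coact X.ρ_coinv_smul) (translation h).right := by
  intro c
  let e := LinearEquiv.ofBijective (X.canBimod k).right h
  apply BTensor.map_injective_of_leftInverse (f := (X.canBimod k).right)
    (g := (LinearMap.id : C →ₗ[R] C)) (f' := e.symm.toLinearMap) (g' := LinearMap.id)
    e.symm_apply_apply (fun _ => rfl)
  apply (BTensor.assoc R R A C C).injective
  refine (X.canBimod_right_colinear (translation h c)).trans ?_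
  rw [canBimod_translation, BTensor.map_tmul]
  change BTensor.tmul R 1 (𝒞.comul c) = BTensor.assoc R R A C C
    (BTensor.map (X.canBimod k).right LinearMap.id
      (BTensor.map (translation h).right LinearMap.id (𝒞.comul c)))
  induction 𝒞.comul c using BTensor.induction with
  | zero => simp [BTensor.tmul_zero]
  | tmul c d =>
    rw [BTensor.map_tmul, BTensor.map_tmul, BimodHom.right_apply, BimodHom.right_apply,
      canBimod_translation]
    rfl
  | add x y hx hy => simp only [map_add, BTensor.tmul_add, hx, hy]

/-- Again checked after the canonical map, now in the second factor: by `ψ(c ⊗ 1) = 1 ⊗ c`, both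
sides become `c₁ ⊗ (1 ⊗ c₂)`. -/
theorem translation_left_colinear : IsLeftColinear 𝒞.comul.left
    (leftTensorCoaction A X.leftComodule.coact X.leftρ_op_coinv_smul) (translation h).left := by
  intro c
  let e := LinearEquiv.ofBijective (X.canBimod k).left h
  apply BTensor.map_injective_of_leftInverse (f := (LinearMap.id : C →ₗ[Rᵐᵒᵖ] C))
    (g := (X.canBimod k).left) (f' := LinearMap.id) (g' := e.symm.toLinearMap)
    (fun _ => rfl) e.symm_apply_apply
  refine (X.canBimod_left_colinear (translation h c)).trans ?_
  rw [leftCan_translation, BTensor.map_tmul]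
  change BTensor.map LinearMap.id E.ψ.left
    (BTensor.assoc R R C C A (BTensor.tmul R (𝒞.comul c) 1)) =
    BTensor.map LinearMap.id (X.canBimod k).left
      (BTensor.map LinearMap.id (translation h).left (𝒞.comul c))
  induction 𝒞.comul c using BTensor.induction with
  | zero => simp [BTensor.zero_tmul]
  | tmul c d =>
    rw [BTensor.map_tmul, BTensor.map_tmul, canBimod_translation, BTensor.assoc_tmul,
      BTensor.map_tmul, E.map_one]
    rfl
  | add x y hx hy => simp only [map_add, BTensor.add_tmul, hx, hy]

/-- A bicolinear map `θ : A ⊗_B A → A ⊗_T A` over `A ⊗_R C` gives the strong connection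
`c ↦ θ(can⁻¹(1 ⊗ c))`. -/
theorem exists_isStrongConnection (h : Function.Bijective (X.canBimod k).left)
    (θ : BimodHom R R (BTensor (X.coinv k) A A) (BTensor T A A))
    (hr : IsRightColinear (rightTensorCoaction A X.comodule.coact X.ρ_coinv_smul)
      (rightTensorCoaction A X.comodule.coact (X.ρ_smul k T)) θ.right)
    (hl : IsLeftColinear (leftTensorCoaction A X.leftComodule.coact X.leftρ_op_coinv_smul)
      (leftTensorCoaction A X.leftComodule.coact (X.leftρ_op_smul k T)) θ.left)
    (hcan : ∀ x, X.canLift T (θ x) = X.canBimod k x) :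
    ∃ ℓ : BimodHom R R C (BTensor T A A), X.IsStrongConnection T ℓ := by
  refine ⟨{ θ.left ∘ₗ (translation h).left with
    map_op_smul' := fun r c => ?_ }, ?_, ?_, ?_⟩
  · exact (congrArg θ.left ((translation h).map_op_smul r c)).trans (θ.map_op_smul r _)
  · intro c
    refine (hr (translation h c)).trans ?_
    refine (congrArg _ (translation_right_colinear h c)).trans ?_
    exact BTensor.map_map _ _ _ _ _
  · intro c
    refine (hl (translation h c)).trans ?_
    refine (congrArg _ (translation_left_colinear h c)).trans ?_
    exact BTensor.map_map _ _ _ _ _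
  · intro c
    exact (hcan (translation h c)).trans (canBimod_translation h c)

end Translation

end OfSection

/-! ## Comparison of `B ⊗_T A` and `A ⊗_T B` with `A ⊗_T A` -/

section Inclusion

variable (T : Subalgebra k (X.coinv k))

/-- The inclusion `B → A` as a right `T`-linear map. -/
def coinvRight : X.coinv k →ₗ[(↥T)ᵐᵒᵖ] A where
  toFun b := b
  map_add' _ _ := rfl
  map_smul' _ _ := rfl

/-- The inclusion `B → A` as a left `T`-linear map. -/
def coinvLeft : X.coinv k →ₗ[T] A where
  toFun b := b
  map_add' _ _ := rfl
  map_smul' _ _ := rfl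

/-- The canonical map `B ⊗_T A → A ⊗_T A`. -/
def inclLeft : BTensor T (X.coinv k) A →+ BTensor T A A :=
  BTensor.map (X.coinvRight T) LinearMap.id

/-- The canonical map `A ⊗_T B → A ⊗_T A`. -/
def inclRight : BTensor T A (X.coinv k) →+ BTensor T A A :=
  BTensor.map LinearMap.id (X.coinvLeft T)

theorem inclRight_tmul (a : A) (b : X.coinv k) :
    X.inclRight T (BTensor.tmul T a b) = BTensor.tmul T a (b : A) := rfl

theorem inclLeft_smul (b : X.coinv k) (x : BTensor T (X.coinv k) A) :
    X.inclLeft T (b • x) = (b : A) • X.inclLeft T x := by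
  induction x using BTensor.induction with
  | zero => simp
  | tmul b' a => rfl
  | add x y hx hy => simp only [map_add, smul_add, hx, hy]

instance tensorCoinvModule : Module (↥(X.coinv k))ᵐᵒᵖ (BTensor T A (X.coinv k)) :=
  BTensor.rightModule

theorem inclRight_op_smul (b : X.coinv k) (x : BTensor T A (X.coinv k)) :
    X.inclRight T (op b • x) = op (b : A) • X.inclRight T x := by
  induction x using BTensor.induction with
  | zero => simp
  | tmul a b' => rfl
  | add x y hx hy => simp only [map_add, smul_add, hx, hy]

theorem inclLeft_op_smul (r : R) (x : BTensor T (X.coinv k) A) :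
    X.inclLeft T (op r • x) = op r • X.inclLeft T x := by
  induction x using BTensor.induction with
  | zero => simp
  | tmul b' a => rfl
  | add x y hx hy => simp only [map_add, smul_add, hx, hy]

theorem inclRight_smul (r : R) (x : BTensor T A (X.coinv k)) :
    X.inclRight T (r • x) = r • X.inclRight T x := by
  induction x using BTensor.induction with
  | zero => simp
  | tmul a b' => rfl
  | add x y hx hy => simp only [map_add, smul_add, hx, hy]

variable {X T}

theorem tensor_smul_assoc (r : R) (a : A) (x : BTensor T A A) : (r • a) • x = r • a • x := by
  induction x using BTensor.induction with
  | zero => simp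
  | tmul u v =>
    simp only [BTensor.left_smul_tmul, smul_eq_mul, IsRRing.smul_mul]
  | add x y hx hy => simp only [smul_add, hx, hy]

theorem tensor_op_smul_assoc (r : R) (a : A) (x : BTensor T A A) :
    op (op r • a) • x = op r • op a • x := by
  induction x using BTensor.induction with
  | zero => simp
  | tmul u v =>
    simp only [BTensor.right_smul_tmul, op_smul_eq_mul, IsRRing.mul_op_smul]
  | add x y hx hy => simp only [smul_add, hx, hy]

/-- This makes `a ⊗ c ↦ a ℓ(c)` balanced over `R` in `extLeft`; the next lemma does the same for
`extRight`. -/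
theorem tensor_op_smul_smul (r : R) (a : A) (x : BTensor T A A) :
    (op r • a) • x = a • r • x := by
  induction x using BTensor.induction with
  | zero => simp
  | tmul u v =>
    simp only [BTensor.left_smul_tmul, smul_eq_mul, IsRRing.op_smul_mul]
  | add x y hx hy => simp only [smul_add, hx, hy]

theorem tensor_op_smul_op_smul (r : R) (a : A) (x : BTensor T A A) :
    op a • op r • x = op (r • a) • x := by
  induction x using BTensor.induction with
  | zero => simp
  | tmul u v =>
    simp only [BTensor.right_smul_tmul, op_smul_eq_mul, IsRRing.op_smul_mul]
  | add x y hx hy => simp only [smul_add, hx, hy]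

theorem canLift_tmul (a a' : A) : X.canLift T (BTensor.tmul T a a') = a • X.ρ a' := rfl

theorem canLift_smul (a : A) (x : BTensor T A A) : X.canLift T (a • x) = a • X.canLift T x := by
  induction x using BTensor.induction with
  | zero => simp
  | tmul u v => rw [BTensor.left_smul_tmul, canLift_tmul, canLift_tmul, smul_eq_mul, mul_smul]
  | add x y hx hy => simp only [map_add, smul_add, hx, hy]

theorem canLift_op_smul (a : A) (x : BTensor T A A) :
    X.canLift T (op a • x) = E.rmul a (X.canLift T x) := by
  induction x using BTensor.induction with
  | zero => simp
  | tmul u v =>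
    rw [BTensor.right_smul_tmul, canLift_tmul, canLift_tmul, op_smul_eq_mul, X.ρ_mul, E.rmul_smul]
  | add x y hx hy => simp only [map_add, smul_add, hx, hy]

end Inclusion

/-! ## Strong connections from equivariant projectivity -/

section OfProjective

variable {T : Subalgebra k (X.coinv k)}

/-- The additive map underlying `extendLeft`. -/
def extendLeftHom (σ : BimodHom (X.coinv k) R A (BTensor T (X.coinv k) A)) :
    BTensor (X.coinv k) A A →+ BTensor T A A :=
  BTensor.lift
    (BTensor.mkBi (fun a a' => a • X.inclLeft T (σ a')) (fun a b a' => add_smul a b _)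
      (fun a b b' => by rw [map_add, map_add, smul_add]))
    (fun a b a' => by
      change (a * (b : A)) • X.inclLeft T (σ a') = a • X.inclLeft T (σ (b • a'))
      rw [map_smul, inclLeft_smul, mul_smul])

theorem extendLeftHom_tmul (σ : BimodHom (X.coinv k) R A (BTensor T (X.coinv k) A)) (a a' : A) :
    X.extendLeftHom σ (BTensor.tmul (X.coinv k) a a') = a • X.inclLeft T (σ a') :=
  BTensor.lift_tmul _ _ a a'

/-- The map `A ⊗_B A → A ⊗_T A`, `a ⊗ a' ↦ a σ(a')`, for a left `B`-linear map
`σ : A → B ⊗_T A`. -/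
def extendLeft (σ : BimodHom (X.coinv k) R A (BTensor T (X.coinv k) A)) :
    BimodHom R R (BTensor (X.coinv k) A A) (BTensor T A A) :=
  BimodHom.ofAddHom (X.extendLeftHom σ)
    (fun r x => by
      induction x using BTensor.induction with
      | zero => simp only [smul_zero, map_zero]
      | tmul a a' =>
        rw [BTensor.left_smul_tmul, extendLeftHom_tmul, extendLeftHom_tmul]
        exact tensor_smul_assoc r a (X.inclLeft T (σ a'))
      | add x y hx hy => simp only [smul_add, map_add, hx, hy])
    (fun r x => by
      induction x using BTensor.induction with
      | zero => simp only [smul_zero, map_zero]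
      | tmul a a' =>
        rw [BTensor.right_smul_tmul, extendLeftHom_tmul, extendLeftHom_tmul, σ.map_op_smul, inclLeft_op_smul]
        exact smul_comm a (op r) (X.inclLeft T (σ a'))
      | add x y hx hy => simp only [smul_add, map_add, hx, hy])

theorem extendLeft_tmul (σ : BimodHom (X.coinv k) R A (BTensor T (X.coinv k) A)) (a a' : A) :
    X.extendLeft σ (BTensor.tmul (X.coinv k) a a') = a • X.inclLeft T (σ a') :=
  X.extendLeftHom_tmul σ a a'

/-- The additive map underlying `extendRight`. -/
def extendRightHom (σ : BimodHom R (X.coinv k) A (BTensor T A (X.coinv k))) :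
    BTensor (X.coinv k) A A →+ BTensor T A A :=
  BTensor.lift
    (BTensor.mkBi (fun a a' => op a' • X.inclRight T (σ a))
      (fun a b a' => by rw [map_add, map_add, smul_add])
      (fun a b b' => by rw [op_add, add_smul]))
    (fun a b a' => by
      change op a' • X.inclRight T (σ (op b • a)) = op ((b : A) * a') • X.inclRight T (σ a)
      rw [σ.map_op_smul, inclRight_op_smul, op_mul, mul_smul])

theorem extendRightHom_tmul (σ : BimodHom R (X.coinv k) A (BTensor T A (X.coinv k)))
    (a a' : A) :
    X.extendRightHom σ (BTensor.tmul (X.coinv k) a a') = op a' • X.inclRight T (σ a) :=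
  BTensor.lift_tmul _ _ a a'

/-- The map `A ⊗_B A → A ⊗_T A`, `a ⊗ a' ↦ σ(a) a'`, for a right `B`-linear map
`σ : A → A ⊗_T B`. -/
def extendRight (σ : BimodHom R (X.coinv k) A (BTensor T A (X.coinv k))) :
    BimodHom R R (BTensor (X.coinv k) A A) (BTensor T A A) :=
  BimodHom.ofAddHom (X.extendRightHom σ)
    (fun r x => by
      induction x using BTensor.induction with
      | zero => simp only [smul_zero, map_zero]
      | tmul a a' =>
        rw [BTensor.left_smul_tmul, extendRightHom_tmul, extendRightHom_tmul, map_smul, inclRight_smul]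
        exact (smul_comm r (op a') (X.inclRight T (σ a))).symm
      | add x y hx hy => simp only [smul_add, map_add, hx, hy])
    (fun r x => by
      induction x using BTensor.induction with
      | zero => simp only [smul_zero, map_zero]
      | tmul a a' =>
        rw [BTensor.right_smul_tmul, extendRightHom_tmul, extendRightHom_tmul]
        exact tensor_op_smul_assoc r a' (X.inclRight T (σ a))
      | add x y hx hy => simp only [smul_add, map_add, hx, hy])

theorem extendRight_tmul (σ : BimodHom R (X.coinv k) A (BTensor T A (X.coinv k))) (a a' : A) :
    X.extendRight σ (BTensor.tmul (X.coinv k) a a') = op a' • X.inclRight T (σ a) :=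
  X.extendRightHom_tmul σ a a'

/-- `a • - ` on the image of `B ⊗_T A`, as a right `R`-linear map. -/
def smulInclLeft (T : Subalgebra k (X.coinv k)) (a : A) :
    BTensor T (X.coinv k) A →ₗ[Rᵐᵒᵖ] BTensor T A A where
  toFun y := a • X.inclLeft T y
  map_add' x y := by rw [map_add, smul_add]
  map_smul' r y := by
    exact (congrArg (a • ·) (X.inclLeft_op_smul T r.unop y)).trans
      (smul_comm a r (X.inclLeft T y))

/-- `- • a` on the image of `A ⊗_T B`, as a left `R`-linear map. -/
def opSmulInclRight (T : Subalgebra k (X.coinv k)) (a : A) :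
    BTensor T A (X.coinv k) →ₗ[R] BTensor T A A where
  toFun y := op a • X.inclRight T y
  map_add' x y := by rw [map_add, smul_add]
  map_smul' r y := by
    exact (congrArg (op a • ·) (X.inclRight_smul T r y)).trans
      (smul_comm r (op a) (X.inclRight T y)).symm

variable {X} in
/-- `a ↦ a • x` as a left `R`-linear map. -/
def smulTensor (x : BTensor T A A) : A →ₗ[R] BTensor T A A where
  toFun a := a • x
  map_add' a b := add_smul a b x
  map_smul' r a := tensor_smul_assoc r a x

variable {X} in
/-- `a ↦ x • a` as a right `R`-linear map. -/
def opSmulTensor (x : BTensor T A A) : A →ₗ[Rᵐᵒᵖ] BTensor T A A where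
  toFun a := op a • x
  map_add' a b := by rw [op_add, add_smul]
  map_smul' r a := tensor_op_smul_assoc r.unop a x

/-- The coaction sees only the second tensor factor, and multiplication by `a` only the first. -/
theorem rightCoaction_smulInclLeft (a : A) (y : BTensor T (X.coinv k) A) :
    rightTensorCoaction A X.comodule.coact (X.ρ_smul k T) (X.smulInclLeft T a y) =
      BTensor.map (X.smulInclLeft T a) LinearMap.id
        (rightTensorCoaction (X.coinv k) X.comodule.coact (X.ρ_smul k T) y) := by
  induction y using BTensor.induction with
  | zero => simp
  | tmul b x =>
    change (BTensor.assoc T R A A C).symm (BTensor.tmul T (a * (b : A)) (X.ρ x)) =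
      BTensor.map (X.smulInclLeft T a) LinearMap.id
        ((BTensor.assoc T R (X.coinv k) A C).symm (BTensor.tmul T b (X.ρ x)))
    induction X.ρ x using BTensor.induction with
    | zero => simp [BTensor.tmul_zero]
    | tmul u c => rfl
    | add x y hx hy => simp only [map_add, BTensor.tmul_add, hx, hy]
  | add x y hx hy => simp only [map_add, hx, hy]

theorem leftCoaction_opSmulInclRight (a : A) (y : BTensor T A (X.coinv k)) :
    leftTensorCoaction A X.leftComodule.coact (X.leftρ_op_smul k T) (X.opSmulInclRight T a y) =
      BTensor.map LinearMap.id (X.opSmulInclRight T a)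
        (leftTensorCoaction (X.coinv k) X.leftComodule.coact (X.leftρ_op_smul k T) y) := by
  induction y using BTensor.induction with
  | zero => simp
  | tmul x b =>
    change BTensor.assoc R T C A A (BTensor.tmul T (X.leftρ x) ((b : A) * a)) =
      BTensor.map LinearMap.id (X.opSmulInclRight T a)
        (BTensor.assoc R T C A (X.coinv k) (BTensor.tmul T (X.leftρ x) b))
    induction X.leftρ x using BTensor.induction with
    | zero => simp [BTensor.zero_tmul]
    | tmul c u => rfl
    | add x y hx hy => simp only [map_add, BTensor.add_tmul, hx, hy]
  | add x y hx hy => simp only [map_add, hx, hy]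

/-- Coinvariance of the first factor of `y` is what matters: for `b` in `B` the left coaction of `a
b` is that of `a` times `b`, so the coaction never reaches `y`. -/
theorem leftCoaction_smulInclLeft (a : A) (y : BTensor T (X.coinv k) A) :
    leftTensorCoaction A X.leftComodule.coact (X.leftρ_op_smul k T) (a • X.inclLeft T y) =
      BTensor.map LinearMap.id (smulTensor (X.inclLeft T y)) (X.leftρ a) := by
  induction y using BTensor.induction with
  | zero =>
    simp only [map_zero, smul_zero]
    induction X.leftρ a using BTensor.induction with
    | zero => simp
    | tmul c u => exact (BTensor.tmul_zero c).symm.trans (congrArg _ (smul_zero u).symm)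
    | add x y hx hy => rw [map_add, ← hx, ← hy, add_zero]
  | tmul b x =>
    change BTensor.assoc R T C A A (BTensor.tmul T (X.leftρ (a * (b : A))) x) = _
    rw [X.leftρ_mul_coinv]
    induction X.leftρ a using BTensor.induction with
    | zero => simp [BTensor.zero_tmul]
    | tmul c u => rfl
    | add x y hx hy => simp only [map_add, smul_add, BTensor.add_tmul, hx, hy]
  | add x y hx hy =>
    simp only [map_add, smul_add, hx, hy]
    induction X.leftρ a using BTensor.induction with
    | zero => simp
    | tmul c u =>
      simp only [BTensor.map_tmul]
      exact (BTensor.tmul_add c _ _).symm.trans (congrArg _ (smul_add u _ _).symm)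
    | add x y hx hy => simp only [map_add, ← hx, ← hy]; abel

/-- Mirror image: `ρ(b a) = b ρ(a)` for `b` in `B`, so the coaction passes over the second factor of
`y`. -/
theorem rightCoaction_opSmulInclRight (a : A) (y : BTensor T A (X.coinv k)) :
    rightTensorCoaction A X.comodule.coact (X.ρ_smul k T) (op a • X.inclRight T y) =
      BTensor.map (opSmulTensor (X.inclRight T y)) LinearMap.id (X.ρ a) := by
  induction y using BTensor.induction with
  | zero =>
    simp only [map_zero, smul_zero]
    induction X.ρ a using BTensor.induction with
    | zero => simp
    | tmul u c =>
      exact (BTensor.zero_tmul c).symm.trans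
        (congrArg (BTensor.tmul R · c) (smul_zero (op u)).symm)
    | add x y hx hy => rw [map_add, ← hx, ← hy, add_zero]
  | tmul x b =>
    change (BTensor.assoc T R A A C).symm (BTensor.tmul T x (X.ρ ((b : A) * a))) = _
    rw [X.ρ_coinv_mul]
    induction X.ρ a using BTensor.induction with
    | zero => simp [BTensor.tmul_zero]
    | tmul u c => rfl
    | add x y hx hy => simp only [map_add, smul_add, BTensor.tmul_add, hx, hy]
  | add x y hx hy =>
    simp only [map_add, smul_add, hx, hy]
    induction X.ρ a using BTensor.induction with
    | zero => simp
    | tmul u c =>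
      simp only [BTensor.map_tmul]
      exact (BTensor.add_tmul _ _ c).symm.trans
        (congrArg (BTensor.tmul R · c) (smul_add (op u) _ _).symm)
    | add x y hx hy => simp only [map_add, ← hx, ← hy]; abel

/-- By coinvariance `b ρ(x) = ρ(b x)`. Together with injectivity of `ρ`, this lets `canLift` detect
whether an element of `B ⊗_T A` multiplies to a given element. -/
theorem canLift_inclLeft
    (hbal : ∀ (b : X.coinv k) (t : T) (m : A), (op t • b) • m = b • t • m)
    (y : BTensor T (X.coinv k) A) : X.canLift T (X.inclLeft T y) =
      X.ρ (BTensor.lift (BTensor.mkBi (fun (b : X.coinv k) (m : A) => b • m)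
        (fun b b' m => add_smul b b' m) (fun b m m' => smul_add b m m')) hbal y) := by
  induction y using BTensor.induction with
  | zero => simp
  | tmul b x => exact (X.ρ_coinv_mul k b x).symm
  | add x y hx hy => simp only [map_add, hx, hy]

/-- Here `x ρ(b) = x b ρ(1)`, again by coinvariance. -/
theorem canLift_inclRight
    (hbal : ∀ (m : A) (t : T) (b : X.coinv k), op b • op t • m = op (t • b) • m)
    (y : BTensor T A (X.coinv k)) : X.canLift T (X.inclRight T y) =
      (BTensor.lift (BTensor.mkBi (fun (m : A) (b : X.coinv k) => op b • m)
        (fun m m' b => smul_add _ m m') (fun m b b' => by rw [op_add, add_smul])) hbal y) •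
        X.ρ 1 := by
  induction y using BTensor.induction with
  | zero => simp
  | tmul x b =>
    rw [inclRight_tmul, canLift_tmul, (X.mem_coinv k b).1 b.2]
    exact (mul_smul x (b : A) (X.ρ 1)).symm
  | add x y hx hy => simp only [map_add, add_smul, hx, hy]

/-- Take `θ(a ⊗ a') = a σ(a')`. Its right colinearity is that of `σ`, its left colinearity holds
because `σ` takes values in `B ⊗_T A`, and it lies over the canonical map because `σ` splits the
multiplication. -/
theorem exists_isStrongConnection_of_projectiveLeft
    (h : Function.Bijective (X.canBimod k).left)
    (hp : IsEquivariantlyProjectiveLeft (X.coinv k) T X.comodule) :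
    ∃ ℓ : BimodHom R R C (BTensor T A A), X.IsStrongConnection T ℓ := by
  obtain ⟨-, hT, hbal, σ, hσ, hsec⟩ := hp
  refine exists_isStrongConnection T h (X.extendLeft σ) ?_ ?_ ?_
  · intro x
    induction x using BTensor.induction with
    | zero => simp
    | tmul a a' =>
      rw [BimodHom.right_apply, extendLeft_tmul]
      refine (X.rightCoaction_smulInclLeft a (σ a')).trans ?_
      refine (congrArg _ (hσ a')).trans ?_
      change BTensor.map (X.smulInclLeft T a) LinearMap.id
          (BTensor.map σ.right LinearMap.id (X.ρ a')) =
        BTensor.map (X.extendLeft σ).right LinearMap.id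
          ((BTensor.assoc (X.coinv k) R A A C).symm (BTensor.tmul (X.coinv k) a (X.ρ a')))
      induction X.ρ a' using BTensor.induction with
      | zero => simp [BTensor.tmul_zero]
      | tmul u c =>
        rw [BTensor.assoc_symm_tmul, BTensor.map_tmul, BTensor.map_tmul, BTensor.map_tmul,
          BimodHom.right_apply, BimodHom.right_apply, extendLeft_tmul]
        rfl
      | add x y hx hy => simp only [map_add, BTensor.tmul_add, hx, hy]
    | add x y hx hy => simp only [map_add, hx, hy]
  · intro x
    induction x using BTensor.induction with
    | zero => simp
    | tmul a a' =>
      rw [extendLeft_tmul]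
      refine (X.leftCoaction_smulInclLeft a (σ a')).trans ?_
      change BTensor.map LinearMap.id (smulTensor (X.inclLeft T (σ a'))) (X.leftρ a) =
        BTensor.map LinearMap.id (X.extendLeft σ).left
          (BTensor.assoc R (X.coinv k) C A A (BTensor.tmul (X.coinv k) (X.leftρ a) a'))
      induction X.leftρ a using BTensor.induction with
      | zero => simp [BTensor.zero_tmul]
      | tmul c u =>
        rw [BTensor.assoc_tmul, BTensor.map_tmul, BTensor.map_tmul, extendLeft_tmul]
        rfl
      | add x y hx hy => simp only [map_add, BTensor.add_tmul, hx, hy]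
    | add x y hx hy => simp only [map_add, hx, hy]
  · intro x
    induction x using BTensor.induction with
    | zero => simp
    | tmul a a' => rw [extendLeft_tmul, canLift_smul, X.canLift_inclLeft hbal, hsec]; rfl
    | add x y hx hy => simp only [map_add, hx, hy]

/-- With `θ(a ⊗ a') = σ(a) a'` the roles are exchanged: left colinearity comes from `σ`, right
colinearity from coinvariance of the second factor. -/
theorem exists_isStrongConnection_of_projectiveRight
    (h : Function.Bijective (X.canBimod k).left)
    (hp : IsEquivariantlyProjectiveRight (X.coinv k) T X.leftComodule) :
    ∃ ℓ : BimodHom R R C (BTensor T A A), X.IsStrongConnection T ℓ := by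
  obtain ⟨-, hT, hbal, σ, hσ, hsec⟩ := hp
  refine exists_isStrongConnection T h (X.extendRight σ) ?_ ?_ ?_
  · intro x
    induction x using BTensor.induction with
    | zero => simp
    | tmul a a' =>
      rw [BimodHom.right_apply, extendRight_tmul]
      refine (X.rightCoaction_opSmulInclRight a' (σ a)).trans ?_
      change BTensor.map (opSmulTensor (X.inclRight T (σ a))) LinearMap.id (X.ρ a') =
        BTensor.map (X.extendRight σ).right LinearMap.id
          ((BTensor.assoc (X.coinv k) R A A C).symm (BTensor.tmul (X.coinv k) a (X.ρ a')))
      induction X.ρ a' using BTensor.induction with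
      | zero => simp [BTensor.tmul_zero]
      | tmul u c =>
        rw [BTensor.assoc_symm_tmul, BTensor.map_tmul, BTensor.map_tmul,
          BimodHom.right_apply, extendRight_tmul]
        rfl
      | add x y hx hy => simp only [map_add, BTensor.tmul_add, hx, hy]
    | add x y hx hy => simp only [map_add, hx, hy]
  · intro x
    induction x using BTensor.induction with
    | zero => simp
    | tmul a a' =>
      rw [extendRight_tmul]
      refine (X.leftCoaction_opSmulInclRight a' (σ a)).trans ?_
      refine (congrArg _ (hσ a)).trans ?_
      change BTensor.map LinearMap.id (X.opSmulInclRight T a')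
          (BTensor.map LinearMap.id σ.left (X.leftρ a)) =
        BTensor.map LinearMap.id (X.extendRight σ).left
          (BTensor.assoc R (X.coinv k) C A A (BTensor.tmul (X.coinv k) (X.leftρ a) a'))
      induction X.leftρ a using BTensor.induction with
      | zero => simp [BTensor.zero_tmul]
      | tmul c u =>
        rw [BTensor.assoc_tmul, BTensor.map_tmul, BTensor.map_tmul, BTensor.map_tmul,
          extendRight_tmul]
        rfl
      | add x y hx hy => simp only [map_add, BTensor.add_tmul, hx, hy]
    | add x y hx hy => simp only [map_add, hx, hy]
  · intro x
    induction x using BTensor.induction with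
    | zero => simp
    | tmul a a' =>
      rw [extendRight_tmul, canLift_op_smul, X.canLift_inclRight hbal, hsec, E.rmul_smul, rmul_ρ_one]; rfl
    | add x y hx hy => simp only [map_add, hx, hy]

end OfProjective

/-! ## Extensions of a strong connection to `A ⊗_R C` and `C ⊗_R A` -/

section Extend

variable {T : Subalgebra k (X.coinv k)}

instance tensorOpModule (Y : Type*) [AddCommGroup Y] [Module (↥T)ᵐᵒᵖ Y] :
    Module (↥T)ᵐᵒᵖ (BTensor T Y A) :=
  BTensor.rightModule

instance corTensorOpModule : Module (↥T)ᵐᵒᵖ (BTensor R C A) :=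
  BTensor.rightModule

section Maps

variable {X} (ℓ : BimodHom R R C (BTensor T A A))

/-- `A ⊗_R C → A ⊗_T A`, `a ⊗ c ↦ a ℓ(c)`. -/
def extLeft : BTensor R A C →+ BTensor T A A :=
  BTensor.lift
    (BTensor.mkBi (fun a c => a • ℓ c) (fun a b c => add_smul a b _)
      (fun a c d => by rw [map_add, smul_add]))
    (fun a r c => by
      change (op r • a) • ℓ c = a • ℓ (r • c)
      rw [tensor_op_smul_smul, map_smul])

theorem extLeft_tmul (a : A) (c : C) : extLeft ℓ (BTensor.tmul R a c) = a • ℓ c := rfl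

theorem extLeft_smul (a : A) (z : BTensor R A C) : extLeft ℓ (a • z) = a • extLeft ℓ z := by
  induction z using BTensor.induction with
  | zero => simp only [smul_zero, map_zero]
  | tmul u c => exact mul_smul a u (ℓ c)
  | add x y hx hy => simp only [map_add, smul_add, hx, hy]

/-- `C ⊗_R A → A ⊗_T A`, `c ⊗ a ↦ ℓ(c) a`. -/
def extRight : BTensor R C A →+ BTensor T A A :=
  BTensor.lift
    (BTensor.mkBi (fun c a => op a • ℓ c) (fun c d a => by rw [map_add, smul_add])
      (fun c a b => by rw [op_add, add_smul]))
    (fun c r a => by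
      change op a • ℓ (op r • c) = op (r • a) • ℓ c
      rw [ℓ.map_op_smul, tensor_op_smul_op_smul])

theorem extRight_tmul (c : C) (a : A) : extRight ℓ (BTensor.tmul R c a) = op a • ℓ c := rfl

theorem extRight_op_smul (a : A) (z : BTensor R C A) :
    extRight ℓ (op a • z) = op a • extRight ℓ z := by
  induction z using BTensor.induction with
  | zero => simp only [smul_zero, map_zero]
  | tmul c u =>
    change op (u * a) • ℓ c = op a • op u • ℓ c
    rw [op_mul, mul_smul]
  | add x y hx hy => simp only [map_add, smul_add, hx, hy]

/-- `extLeft` as a right `R`-linear map. -/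
def extLeftOp : BTensor R A C →ₗ[Rᵐᵒᵖ] BTensor T A A where
  toFun := extLeft ℓ
  map_add' := map_add _
  map_smul' r z := by
    induction z using BTensor.induction with
    | zero => simp only [smul_zero, map_zero]
    | tmul a c =>
      exact (congrArg (a • ·) (ℓ.map_op_smul r.unop c)).trans (smul_comm a r (ℓ c))
    | add x y hx hy => simp only [map_add, smul_add, hx, hy]

/-- `extRight` as a left `R`-linear map. -/
def extRightLin : BTensor R C A →ₗ[R] BTensor T A A where
  toFun := extRight ℓ
  map_add' := map_add _
  map_smul' r z := by
    induction z using BTensor.induction with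
    | zero => simp only [smul_zero, map_zero]
    | tmul c a =>
      exact (congrArg (op a • ·) (map_smul ℓ.left r c)).trans (smul_comm r (op a) (ℓ c)).symm
    | add x y hx hy => simp only [map_add, smul_add, hx, hy]

/-- `extLeft` as a left `T`-linear map. -/
def extLeftBase : BTensor R A C →ₗ[T] BTensor T A A where
  toFun := extLeft ℓ
  map_add' := map_add _
  map_smul' t z := by
    induction z using BTensor.induction with
    | zero => simp only [smul_zero, map_zero]
    | tmul a c =>
      refine (mul_smul ((t : X.coinv k) : A) a (ℓ c)).trans ?_
      change ((t : X.coinv k) : A) • a • ℓ c = t • a • ℓ c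
      induction a • ℓ c using BTensor.induction with
      | zero => simp only [smul_zero]
      | tmul u v => rfl
      | add x y hx hy => rw [smul_add, smul_add, hx, hy]
    | add x y hx hy => simp only [map_add, smul_add, hx, hy]

/-- `extRight` as a right `T`-linear map. -/
def extRightBase : BTensor R C A →ₗ[(↥T)ᵐᵒᵖ] BTensor T A A where
  toFun := extRight ℓ
  map_add' := map_add _
  map_smul' t z := by
    induction z using BTensor.induction with
    | zero => simp only [smul_zero, map_zero]
    | tmul c a =>
      change op (a * ((t.unop : X.coinv k) : A)) • ℓ c = t • op a • ℓ c
      rw [op_mul, mul_smul]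
      induction op a • ℓ c using BTensor.induction with
      | zero => simp only [smul_zero]
      | tmul u v => rfl
      | add x y hx hy => rw [smul_add, smul_add, hx, hy]
    | add x y hx hy => simp only [map_add, smul_add, hx, hy]

end Maps

variable (T) in
/-- `canLift` as a left `T`-linear map. -/
def canLiftBase : BTensor T A A →ₗ[T] BTensor R A C where
  toFun := X.canLift T
  map_add' := map_add _
  map_smul' t z := by
    induction z using BTensor.induction with
    | zero => simp only [smul_zero, map_zero]
    | tmul a a' =>
      refine (mul_smul ((t : X.coinv k) : A) a (X.ρ a')).trans ?_
      change ((t : X.coinv k) : A) • a • X.ρ a' = t • a • X.ρ a'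
      induction a • X.ρ a' using BTensor.induction with
      | zero => simp only [smul_zero]
      | tmul u v => rfl
      | add x y hx hy => rw [smul_add, smul_add, hx, hy]
    | add x y hx hy => simp only [map_add, smul_add, hx, hy]

variable (T) in
/-- The map `A ⊗_T A → C ⊗_R A`, `a ⊗ a' ↦ ψ⁻¹(a ρ^A(1)) a'`, as a right `T`-linear map. -/
def leftCanBase : BTensor T A A →ₗ[(↥T)ᵐᵒᵖ] BTensor R C A where
  toFun := BTensor.lift
    (BTensor.mkBi (fun a a' => op a' • X.leftρ a) (fun a b a' => by rw [map_add, smul_add])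
      (fun a b b' => by rw [op_add, add_smul]))
    (fun a t a' => by
      change op a' • X.leftρ (a * ((t : X.coinv k) : A)) =
        op (((t : X.coinv k) : A) * a') • X.leftρ a
      rw [X.leftρ_mul_coinv, op_mul, mul_smul])
  map_add' := map_add _
  map_smul' t z := by
    induction z using BTensor.induction with
    | zero => simp only [smul_zero, map_zero]
    | tmul a a' =>
      change op (a' * ((t.unop : X.coinv k) : A)) • X.leftρ a = t • op a' • X.leftρ a
      rw [op_mul, mul_smul]
      induction op a' • X.leftρ a using BTensor.induction with
      | zero => simp only [smul_zero]
      | tmul u v => rfl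
      | add x y hx hy => rw [smul_add, smul_add, hx, hy]
    | add x y hx hy => simp only [map_add, smul_add, hx, hy]

theorem ψ_leftCanBase (x : BTensor T A A) : E.ψ (X.leftCanBase T x) = X.canLift T x := by
  induction x using BTensor.induction with
  | zero => simp only [map_zero]
  | tmul a a' =>
    change E.ψ (op a' • X.leftρ a) = a • X.ρ a'
    rw [E.ψ_op_smul, ψ_leftρ, E.rmul_smul, rmul_ρ_one]
  | add x y hx hy => simp only [map_add, hx, hy]

variable {X} {ℓ : BimodHom R R C (BTensor T A A)}

/-- By left `A`-linearity it suffices that `ℓ(c)` lifts `1 ⊗ c`. Besides surjectivity of the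
canonical map, this exhibits `A ⊗_R C` as a retract of `A ⊗_T A`. -/
theorem canLift_extLeft (hℓ : X.IsStrongConnection T ℓ) (z : BTensor R A C) :
    X.canLift T (extLeft ℓ z) = z := by
  induction z using BTensor.induction with
  | zero => simp only [map_zero]
  | tmul a c =>
    rw [extLeft_tmul, canLift_smul, hℓ.canLift_eq, BTensor.left_smul_tmul, smul_eq_mul, mul_one]
  | add x y hx hy => simp only [map_add, hx, hy]

/-- By right `A`-linearity, `ℓ(c) a` lies over `(1 ⊗ c) a = ψ(c ⊗ a)`. -/
theorem canLift_extRight (hℓ : X.IsStrongConnection T ℓ) (z : BTensor R C A) :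
    X.canLift T (extRight ℓ z) = E.ψ z := by
  induction z using BTensor.induction with
  | zero => simp only [map_zero]
  | tmul c a => rw [extRight_tmul, canLift_op_smul, hℓ.canLift_eq, E.rmul_tmul, one_smul]
  | add x y hx hy => simp only [map_add, hx, hy]

/-- Applying the injective map `ψ` reduces this to `canLift_extRight`. Thus `C ⊗_R A` is a retract
of `A ⊗_T A` as a right `T`-module. -/
theorem leftCanBase_extRight (hℓ : X.IsStrongConnection T ℓ) (z : BTensor R C A) :
    X.leftCanBase T (extRight ℓ z) = z := by
  apply X.bijective.1
  rw [ψ_leftCanBase, canLift_extRight hℓ]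

/-! ### Colinearity of the extensions -/

theorem rightCoaction_smul (a : A) (x : BTensor T A A) :
    rightTensorCoaction A X.comodule.coact (X.ρ_smul k T) (a • x) =
      a • rightTensorCoaction A X.comodule.coact (X.ρ_smul k T) x := by
  induction x using BTensor.induction with
  | zero => simp only [smul_zero, map_zero]
  | tmul u v =>
    change (BTensor.assoc T R A A C).symm (BTensor.tmul T (a * u) (X.ρ v)) =
      a • (BTensor.assoc T R A A C).symm (BTensor.tmul T u (X.ρ v))
    induction X.ρ v using BTensor.induction with
    | zero => simp only [BTensor.tmul_zero, smul_zero, map_zero]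
    | tmul w c => rfl
    | add x y hx hy => simp only [map_add, smul_add, BTensor.tmul_add, hx, hy]
  | add x y hx hy => simp only [map_add, smul_add, hx, hy]

theorem leftCoaction_op_smul (a : A) (x : BTensor T A A) :
    leftTensorCoaction A X.leftComodule.coact (X.leftρ_op_smul k T) (op a • x) =
      op a • leftTensorCoaction A X.leftComodule.coact (X.leftρ_op_smul k T) x := by
  induction x using BTensor.induction with
  | zero => simp only [smul_zero, map_zero]
  | tmul u v =>
    change BTensor.assoc R T C A A (BTensor.tmul T (X.leftρ u) (v * a)) =
      op a • BTensor.assoc R T C A A (BTensor.tmul T (X.leftρ u) v)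
    induction X.leftρ u using BTensor.induction with
    | zero => simp only [BTensor.zero_tmul, smul_zero, map_zero]
    | tmul c w => rfl
    | add x y hx hy => simp only [map_add, smul_add, BTensor.add_tmul, hx, hy]
  | add x y hx hy => simp only [map_add, smul_add, hx, hy]

/-- Right colinearity of `ℓ` extended by left `A`-linearity, `A ⊗_R C` carrying the coaction `A ⊗
Δ`. -/
theorem rightCoaction_extLeft (hℓ : X.IsStrongConnection T ℓ) (z : BTensor R A C) :
    rightTensorCoaction A X.comodule.coact (X.ρ_smul k T) (extLeft ℓ z) =
      BTensor.map (extLeftOp ℓ) LinearMap.id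
        ((BTensor.assoc R R A C C).symm (BTensor.map LinearMap.id 𝒞.comul.left z)) := by
  induction z using BTensor.induction with
  | zero => simp only [map_zero]
  | tmul a c =>
    rw [extLeft_tmul, rightCoaction_smul]
    refine (congrArg (a • ·) (hℓ.right_colinear c)).trans ?_
    change a • BTensor.map ℓ.right LinearMap.id (𝒞.comul c) =
      BTensor.map (extLeftOp ℓ) LinearMap.id
        ((BTensor.assoc R R A C C).symm (BTensor.tmul R a (𝒞.comul c)))
    induction 𝒞.comul c using BTensor.induction with
    | zero => simp only [BTensor.tmul_zero, smul_zero, map_zero]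
    | tmul w c => rfl
    | add x y hx hy => simp only [map_add, smul_add, BTensor.tmul_add, hx, hy]
  | add x y hx hy => simp only [map_add, hx, hy]

/-- Left colinearity of `ℓ` extended by right `A`-linearity, `C ⊗_R A` carrying the coaction `Δ ⊗
A`. -/
theorem leftCoaction_extRight (hℓ : X.IsStrongConnection T ℓ) (z : BTensor R C A) :
    leftTensorCoaction A X.leftComodule.coact (X.leftρ_op_smul k T) (extRight ℓ z) =
      BTensor.map LinearMap.id (extRightLin ℓ)
        (BTensor.assoc R R C C A (BTensor.map 𝒞.comul.right LinearMap.id z)) := by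
  induction z using BTensor.induction with
  | zero => simp only [map_zero]
  | tmul c a =>
    rw [extRight_tmul, leftCoaction_op_smul]
    refine (congrArg (op a • ·) (hℓ.left_colinear c)).trans ?_
    change op a • BTensor.map LinearMap.id ℓ.left (𝒞.comul c) =
      BTensor.map LinearMap.id (extRightLin ℓ)
        (BTensor.assoc R R C C A (BTensor.tmul R (𝒞.comul c) a))
    induction 𝒞.comul c using BTensor.induction with
    | zero => simp only [BTensor.zero_tmul, smul_zero, map_zero]
    | tmul c w => rfl
    | add x y hx hy => simp only [map_add, smul_add, BTensor.add_tmul, hx, hy]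
  | add x y hx hy => simp only [map_add, hx, hy]

end Extend

/-! ## Coinvariance of the canonical sections -/

section Kernel

variable (T : Subalgebra k (X.coinv k))

/-- `ρ^A` as a right `T`-linear map to `(A ⊗_R C)_ψ`. -/
def ρRight : A →ₗ[(↥T)ᵐᵒᵖ] E.Carrier where
  toFun := X.ρ
  map_add' := map_add _
  map_smul' t a := X.ρ_mul a ((t.unop : X.coinv k) : A)

/-- `a ↦ a ρ^A(1)` as a right `T`-linear map to `(A ⊗_R C)_ψ`. -/
def unitRight : A →ₗ[(↥T)ᵐᵒᵖ] E.Carrier where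
  toFun a := a • X.grouplike
  map_add' a b := add_smul a b X.grouplike
  map_smul' t a := by
    -- Since `T` acts on the right of the target by the entwined action, linearity requires `e t = t
    -- e`, which is the coinvariance of `t`.
    have h : op ((t.unop : X.coinv k) : A) • X.grouplike =
      ((t.unop : X.coinv k) : A) • X.grouplike := t.unop.1.2
    change (a * ((t.unop : X.coinv k) : A)) • X.grouplike =
      op ((t.unop : X.coinv k) : A) • a • X.grouplike
    rw [mul_smul, ← h, smul_comm]

/-- `ρ^A` as a left `T`-linear map to `(A ⊗_R C)_ψ`. -/
def ρLeft : A →ₗ[T] E.Carrier where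
  toFun := X.ρ
  map_add' := map_add _
  map_smul' t a := X.ρ_coinv_mul k (t : X.coinv k) a

/-- `a ↦ a ρ^A(1)` as a left `T`-linear map to `(A ⊗_R C)_ψ`. -/
def unitLeft : A →ₗ[T] E.Carrier where
  toFun a := a • X.grouplike
  map_add' a b := add_smul a b X.grouplike
  map_smul' t a := mul_smul ((t : X.coinv k) : A) a X.grouplike

variable {X}

/-- `u ⊗ v ↦ w u ⊗ v`. -/
def mulFst (w : E.Carrier) : BTensor T A A →+ BTensor T E.Carrier A :=
  BTensor.map
    ({ toFun := fun u => op u • w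
       map_add' := fun u v => by rw [op_add, add_smul]
       map_smul' := fun t u => mul_smul (op ((t.unop : X.coinv k) : A)) (op u) w } :
      A →ₗ[(↥T)ᵐᵒᵖ] E.Carrier) LinearMap.id

/-- `u ⊗ v ↦ u ⊗ v w`. -/
def mulSnd (w : E.Carrier) : BTensor T A A →+ BTensor T A E.Carrier :=
  BTensor.map LinearMap.id
    ({ toFun := fun u => u • w
       map_add' := fun u v => add_smul u v w
       map_smul' := fun t u => mul_smul ((t : X.coinv k) : A) u w } :
      A →ₗ[T] E.Carrier)

variable {T}

theorem mulFst_tmul (w : E.Carrier) (u v : A) :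
    mulFst T w (BTensor.tmul T u v) = BTensor.tmul T (op u • w) v := rfl

theorem mulSnd_tmul (w : E.Carrier) (u v : A) :
    mulSnd T w (BTensor.tmul T u v) = BTensor.tmul T u (v • w) := rfl

theorem mulFst_add (w w' : E.Carrier) (x : BTensor T A A) :
    mulFst T (w + w') x = mulFst T w x + mulFst T w' x := by
  induction x using BTensor.induction with
  | zero => simp only [map_zero, add_zero]
  | tmul u v => rw [mulFst_tmul, mulFst_tmul, mulFst_tmul, smul_add, BTensor.add_tmul]
  | add x y hx hy => simp only [map_add, hx, hy]; abel

theorem mulSnd_add (w w' : E.Carrier) (x : BTensor T A A) :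
    mulSnd T (w + w') x = mulSnd T w x + mulSnd T w' x := by
  induction x using BTensor.induction with
  | zero => simp only [map_zero, add_zero]
  | tmul u v => rw [mulSnd_tmul, mulSnd_tmul, mulSnd_tmul, smul_add, BTensor.tmul_add]
  | add x y hx hy => simp only [map_add, hx, hy]; abel

theorem mulFst_op_smul (w : BTensor R A C) (r : R) (x : BTensor T A A) :
    mulFst T (show E.Carrier from op r • w) x = mulFst T (show E.Carrier from w) (r • x) := by
  induction x using BTensor.induction with
  | zero => simp only [smul_zero, map_zero]
  | tmul u v =>
    rw [BTensor.left_smul_tmul, mulFst_tmul, mulFst_tmul]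
    congr 1
    change E.rmul u (op r • w) = E.rmul (r • u) w
    rw [← rmul_smul_one, ← E.rmul_mul, IsRRing.smul_mul, one_mul]
  | add x y hx hy => simp only [map_add, smul_add, hx, hy]

theorem mulSnd_smul (w : BTensor R A C) (r : R) (x : BTensor T A A) :
    mulSnd T (show E.Carrier from r • w) x = mulSnd T (show E.Carrier from w) (op r • x) := by
  induction x using BTensor.induction with
  | zero => simp only [smul_zero, map_zero]
  | tmul u v =>
    rw [BTensor.right_smul_tmul, mulSnd_tmul, mulSnd_tmul]
    congr 1
    change v • r • w = (op r • v) • w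
    rw [IsRRing.op_smul_eq, mul_smul, BTensor.smul_one_smul]
  | add x y hx hy => simp only [map_add, smul_add, hx, hy]

variable (ℓ : BimodHom R R C (BTensor T A A))

/-- `w ⊗ c ↦ w ℓ(c)`. -/
def carrierMul : BTensor R (BTensor R A C) C →+ BTensor T E.Carrier A :=
  BTensor.lift
    (BTensor.mkBi (fun w c => mulFst T (show E.Carrier from w) (ℓ c))
      (fun w w' c => mulFst_add _ _ _) (fun w c d => by rw [map_add, map_add]))
    (fun w r c => by
      change mulFst T (show E.Carrier from op r • w) (ℓ c) =
        mulFst T (show E.Carrier from w) (ℓ (r • c))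
      exact (mulFst_op_smul w r (ℓ c)).trans (congrArg _ (map_smul ℓ.left r c).symm))

/-- `c ⊗ y ↦ ℓ(c) ψ(y)`. -/
def mulCarrier : BTensor R C (BTensor R C A) →+ BTensor T A E.Carrier :=
  BTensor.lift
    (BTensor.mkBi (fun c y => mulSnd T (show E.Carrier from E.ψ y) (ℓ c))
      (fun c d y => by rw [map_add, map_add])
      (fun c y y' => by rw [map_add]; exact mulSnd_add _ _ _))
    (fun c r y => by
      change mulSnd T (show E.Carrier from E.ψ y) (ℓ (op r • c)) =
        mulSnd T (show E.Carrier from E.ψ (r • y)) (ℓ c)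
      rw [ℓ.map_op_smul]
      refine (mulSnd_smul (E.ψ y) r (ℓ c)).symm.trans ?_
      exact congrArg (fun w => mulSnd T w (ℓ c)) (map_smul E.ψ.left r y).symm)

variable (T) in
/-- `c ⊗ (u ⊗ v) ↦ ψ(c ⊗ u) ⊗ v`. -/
def swapFst : BTensor R C (BTensor T A A) →+ BTensor T E.Carrier A :=
  BTensor.lift
    (BTensor.mkBi (fun c x => mulFst T (E.tm 1 c) x)
      (fun c d x => by
        refine Eq.trans ?_ (mulFst_add _ _ _)
        exact congrArg (fun w => mulFst T w x) (BTensor.tmul_add (R := R) (1 : A) c d))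
      (fun c x y => map_add _ _ _))
    (fun c r x => mulFst_op_smul (BTensor.tmul R 1 c) r x)

variable (T) in
/-- `(u ⊗ v) ⊗ c ↦ u ⊗ (v ⊗ c)`. -/
def swapSnd : BTensor R (BTensor T A A) C →+ BTensor T A E.Carrier :=
  BTensor.lift
    (BTensor.mkBi (fun x c => mulSnd T (E.tm 1 c) x) (fun x y c => map_add _ _ _)
      (fun x c d => by
        refine Eq.trans ?_ (mulSnd_add _ _ _)
        exact congrArg (fun w => mulSnd T w x) (BTensor.tmul_add (R := R) (1 : A) c d)))
    (fun x r c => by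
      change mulSnd T (E.tm 1 c) (op r • x) = mulSnd T (E.tm 1 (r • c)) x
      rw [← E.tm_one_smul]
      refine (mulSnd_smul (BTensor.tmul R 1 c) r x).symm.trans ?_
      exact congrArg (fun w => mulSnd T w x) (BTensor.smul_one_smul r _).symm)

theorem map_ρRight_smul (a : A) (x : BTensor T A A) :
    BTensor.map (X.ρRight T) LinearMap.id (a • x) =
      mulFst T (show E.Carrier from X.ρ a) x := by
  induction x using BTensor.induction with
  | zero => simp only [smul_zero, map_zero]
  | tmul u v => exact congrArg (BTensor.tmul T · v) (X.ρ_mul a u)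
  | add x y hx hy => simp only [map_add, smul_add, hx, hy]

theorem map_ρLeft_op_smul (a : A) (x : BTensor T A A) :
    BTensor.map LinearMap.id (X.ρLeft T) (op a • x) =
      op a • BTensor.map LinearMap.id (X.ρLeft T) x := by
  induction x using BTensor.induction with
  | zero => simp only [smul_zero, map_zero]
  | tmul u v => exact congrArg (BTensor.tmul T u) (X.ρ_mul v a)
  | add x y hx hy => simp only [map_add, smul_add, hx, hy]

theorem map_unitRight_smul (a : A) (x : BTensor T A A) :
    BTensor.map (X.unitRight T) LinearMap.id (a • x) =
      a • BTensor.map (X.unitRight T) LinearMap.id x := by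
  induction x using BTensor.induction with
  | zero => simp only [smul_zero, map_zero]
  | tmul u v => exact congrArg (BTensor.tmul T · v) (mul_smul a u X.grouplike)
  | add x y hx hy => simp only [map_add, smul_add, hx, hy]

theorem map_unitLeft_op_smul (a : A) (x : BTensor T A A) :
    BTensor.map LinearMap.id (X.unitLeft T) (op a • x) = mulSnd T (a • X.grouplike) x := by
  induction x using BTensor.induction with
  | zero => simp only [smul_zero, map_zero]
  | tmul u v => exact congrArg (BTensor.tmul T u) (mul_smul v a X.grouplike)
  | add x y hx hy => simp only [map_add, smul_add, hx, hy]

/-- As `ψ(leftρ u) = u ρ(1)`, the left coaction followed by `ψ` is `u ↦ u ρ(1)` on the first factor.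
This is how left colinearity of `ℓ` becomes a statement about `unitRight`. -/
theorem swapFst_leftCoaction (x : BTensor T A A) :
    swapFst T (leftTensorCoaction A X.leftComodule.coact (X.leftρ_op_smul k T) x) =
      BTensor.map (X.unitRight T) LinearMap.id x := by
  induction x using BTensor.induction with
  | zero => simp only [map_zero]
  | tmul u v =>
    have h : ∀ y : BTensor R C A, swapFst T (BTensor.assoc R T C A A (BTensor.tmul T y v)) =
        BTensor.tmul T (show E.Carrier from E.ψ y) v := by
      intro y
      induction y using BTensor.induction with
      | zero =>
        simp only [BTensor.zero_tmul, map_zero]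
        exact (BTensor.zero_tmul v).symm
      | tmul c w => exact congrArg (BTensor.tmul T · v) (one_smul A (E.ψ (BTensor.tmul R c w)))
      | add x y hx hy =>
        simp only [BTensor.add_tmul, map_add, hx, hy]
        exact (BTensor.add_tmul _ _ v).symm
    exact (h (X.leftρ u)).trans (congrArg (BTensor.tmul T · v) (X.ψ_leftρ u))
  | add x y hx hy => simp only [map_add, hx, hy]

/-- Only a reassociation, by `w ⊗ c = w (1 ⊗ c)`; it turns right colinearity of `ℓ` into a statement
about `ρLeft`. -/
theorem swapSnd_rightCoaction (x : BTensor T A A) :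
    swapSnd T (rightTensorCoaction A X.comodule.coact (X.ρ_smul k T) x) =
      BTensor.map LinearMap.id (X.ρLeft T) x := by
  induction x using BTensor.induction with
  | zero => simp only [map_zero]
  | tmul u v =>
    have h : ∀ y : BTensor R A C,
        swapSnd T ((BTensor.assoc T R A A C).symm (BTensor.tmul T u y)) =
        BTensor.tmul T u (show E.Carrier from y) := by
      intro y
      induction y using BTensor.induction with
      | zero =>
        simp only [BTensor.tmul_zero, map_zero]
        exact (BTensor.tmul_zero u).symm
      | tmul w c => exact congrArg (BTensor.tmul T u) (E.tm_eq w c).symm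
      | add x y hx hy =>
        simp only [BTensor.tmul_add, map_add, hx, hy]
        exact (BTensor.tmul_add u _ _).symm
    exact h (X.ρ v)
  | add x y hx hy => simp only [map_add, hx, hy]

variable {ℓ}

/-- From `ρ(a u) = ρ(a) u` alone: on `a ⊗ c` both sides are `ρ(a) ℓ(c)`. -/
theorem map_ρRight_extLeft (z : BTensor R A C) :
    BTensor.map (X.ρRight T) LinearMap.id (extLeft ℓ z) =
      carrierMul ℓ (BTensor.map X.ρ LinearMap.id z) := by
  induction z using BTensor.induction with
  | zero => simp only [map_zero]
  | tmul a c => exact map_ρRight_smul a (ℓ c)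
  | add x y hx hy => simp only [map_add, hx, hy]

/-- On `c ⊗ a` both sides are `ℓ(c) a ρ(1)`, written through `a ρ(1) = ψ(leftρ a)`. -/
theorem map_unitLeft_extRight (z : BTensor R C A) :
    BTensor.map LinearMap.id (X.unitLeft T) (extRight ℓ z) =
      mulCarrier ℓ (BTensor.map LinearMap.id X.leftρ z) := by
  induction z using BTensor.induction with
  | zero => simp only [map_zero]
  | tmul c a =>
    refine (map_unitLeft_op_smul a (ℓ c)).trans ?_
    exact congrArg (fun w => mulSnd T w (ℓ c)) (X.ψ_leftρ a).symm
  | add x y hx hy => simp only [map_add, hx, hy]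

theorem mulFst_tm (a : A) (c : C) (x : BTensor T A A) :
    mulFst T (E.tm a c) x = a • mulFst T (E.tm 1 c) x := by
  induction x using BTensor.induction with
  | zero => simp only [smul_zero, map_zero]
  | tmul u v =>
    rw [mulFst_tmul, mulFst_tmul, BTensor.left_smul_tmul, smul_comm, ← E.tm_eq]
  | add x y hx hy => simp only [map_add, smul_add, hx, hy]

theorem mulSnd_ψ (a : A) (c : C) (x : BTensor T A A) :
    mulSnd T (show E.Carrier from E.ψ (BTensor.tmul R c a)) x = op a • mulSnd T (E.tm 1 c) x := by
  induction x using BTensor.induction with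
  | zero => simp only [smul_zero, map_zero]
  | tmul u v =>
    rw [mulSnd_tmul, mulSnd_tmul, BTensor.right_smul_tmul]
    refine congrArg (BTensor.tmul T u) ?_
    rw [← smul_comm v (op a)]
    exact congrArg (v • ·) (one_smul A (show E.Carrier from E.ψ (BTensor.tmul R c a))).symm
  | add x y hx hy => simp only [map_add, smul_add, hx, hy]

/-- Left colinearity of `ℓ` turns `a ℓ(c)`, with `ρ(1)` inserted after its first factor, into `(a ⊗
c₁) ℓ(c₂)`. -/
theorem map_unitRight_extLeft (hℓ : X.IsStrongConnection T ℓ) (z : BTensor R A C) :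
    BTensor.map (X.unitRight T) LinearMap.id (extLeft ℓ z) =
      carrierMul ℓ ((BTensor.assoc R R A C C).symm (BTensor.map LinearMap.id 𝒞.comul.left z)) := by
  induction z using BTensor.induction with
  | zero => simp only [map_zero]
  | tmul a c =>
    rw [extLeft_tmul, map_unitRight_smul, ← swapFst_leftCoaction]
    refine (congrArg (fun w => a • swapFst T w) (hℓ.left_colinear c)).trans ?_
    change a • swapFst T (BTensor.map LinearMap.id ℓ.left (𝒞.comul c)) =
      carrierMul ℓ ((BTensor.assoc R R A C C).symm (BTensor.tmul R a (𝒞.comul c)))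
    induction 𝒞.comul c using BTensor.induction with
    | zero => simp only [map_zero, BTensor.tmul_zero, smul_zero]
    | tmul c d => exact (mulFst_tm a c (ℓ d)).symm
    | add x y hx hy => simp only [map_add, BTensor.tmul_add, smul_add, hx, hy]
  | add x y hx hy => simp only [map_add, hx, hy]

/-- Right colinearity of `ℓ` turns `ℓ(c) a`, with `ρ` applied to its second factor, into `ℓ(c₁) ψ(c₂
⊗ a)`. -/
theorem map_ρLeft_extRight (hℓ : X.IsStrongConnection T ℓ) (z : BTensor R C A) :
    BTensor.map LinearMap.id (X.ρLeft T) (extRight ℓ z) =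
      mulCarrier ℓ (BTensor.assoc R R C C A (BTensor.map 𝒞.comul.right LinearMap.id z)) := by
  induction z using BTensor.induction with
  | zero => simp only [map_zero]
  | tmul c a =>
    rw [extRight_tmul, map_ρLeft_op_smul, ← swapSnd_rightCoaction]
    refine (congrArg (fun w => op a • swapSnd T w) (hℓ.right_colinear c)).trans ?_
    change op a • swapSnd T (BTensor.map ℓ.right LinearMap.id (𝒞.comul c)) =
      mulCarrier ℓ (BTensor.assoc R R C C A (BTensor.tmul R (𝒞.comul c) a))
    induction 𝒞.comul c using BTensor.induction with
    | zero => simp only [map_zero, BTensor.zero_tmul, smul_zero]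
    | tmul c d => exact (mulSnd_ψ a d (ℓ c)).symm
    | add x y hx hy => simp only [map_add, BTensor.add_tmul, smul_add, hx, hy]
  | add x y hx hy => simp only [map_add, hx, hy]

/-- Both sides are `carrierMul ℓ` of an iterated coaction of `a`, one through `ρ ⊗ C` and one
through `A ⊗ Δ`; coassociativity of `ρ` identifies them. This places `a₀ ℓ(a₁)` in the kernel that
flatness identifies with `B ⊗_T A`. -/
theorem extLeft_ρ_coinvariant (hℓ : X.IsStrongConnection T ℓ) (a : A) :
    BTensor.map (X.ρRight T) LinearMap.id (extLeft ℓ (X.ρ a)) =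
      BTensor.map (X.unitRight T) LinearMap.id (extLeft ℓ (X.ρ a)) := by
  rw [map_ρRight_extLeft, map_unitRight_extLeft hℓ]
  congr 1
  rw [AddEquiv.eq_symm_apply]
  exact X.comodule.coassoc a

/-- The same argument with coassociativity of the left coaction and `mulCarrier ℓ`. -/
theorem extRight_leftρ_coinvariant (hℓ : X.IsStrongConnection T ℓ) (a : A) :
    BTensor.map LinearMap.id (X.ρLeft T) (extRight ℓ (X.leftρ a)) =
      BTensor.map LinearMap.id (X.unitLeft T) (extRight ℓ (X.leftρ a)) := by
  rw [map_unitLeft_extRight, map_ρLeft_extRight hℓ]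
  exact congrArg _ (X.leftComodule.coassoc a)

end Kernel

/-! ## The Galois property -/

/-- Coassociativity and counitality of `ρ` at `1`. Because `ρ(u) = e u`, the factor `u` slides
across `⊗_A`, and the iterated coaction of `1` becomes `e ⊗_A e`. -/
theorem isGrouplike_grouplike : E.coring.IsGrouplike X.grouplike := by
  constructor
  · change E.pairingA (BTensor.map LinearMap.id 𝒞.comul.left (X.ρ 1)) = _
    have h0 : BTensor.assoc R R A C C (BTensor.map X.ρ LinearMap.id (X.ρ 1)) =
      BTensor.map LinearMap.id 𝒞.comul.left (X.ρ 1) := X.comodule.coassoc 1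
    rw [← h0]
    have h : ∀ z : BTensor R A C,
        E.pairingA (BTensor.assoc R R A C C (BTensor.map X.ρ LinearMap.id z)) =
          BTensor.tmul A X.grouplike (show E.Carrier from z) := by
      intro z
      induction z using BTensor.induction with
      | zero => simp only [map_zero]; exact (BTensor.tmul_zero _).symm
      | tmul u c =>
        rw [BTensor.map_tmul, LinearMap.id_apply, E.pairingA_assoc, X.ρ_eq, BTensor.smul_tmul]
        exact congrArg (BTensor.tmul A X.grouplike) (E.tm_eq u c).symm
      | add x y hx hy =>
        simp only [map_add, hx, hy]
        exact (BTensor.tmul_add X.grouplike _ _).symm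
    exact h (X.ρ 1)
  · exact X.comodule.counit 1

theorem ρ_injective : Function.Injective X.ρ := by
  intro a b h
  rw [← X.comodule.counit a, ← X.comodule.counit b]
  exact congrArg (fun z => BTensor.rid R A (BTensor.map LinearMap.id 𝒞.counit.left z)) h

theorem smul_ρ_one_injective : Function.Injective (fun a : A => a • X.ρ 1) := by
  have h : ∀ a : A, E.counitHom (a • X.grouplike) = a := by
    intro a
    rw [E.counitHom_smul]
    exact (congrArg (a * ·) (X.comodule.counit 1)).trans (mul_one a)
  intro a b hab
  rw [← h a, ← h b]
  exact congrArg E.counitHom hab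

/-! ### From a strong connection to an equivariant section and the Galois property -/

section Projective

variable {T : Subalgebra k (X.coinv k)}

theorem op_smul_coinv_smul (b : X.coinv k) (t : T) (m : A) : (op t • b) • m = b • t • m :=
  mul_assoc (b : A) ((t : X.coinv k) : A) m

theorem op_coinv_smul_op_smul (m : A) (t : T) (b : X.coinv k) :
    op b • op t • m = op (t • b) • m :=
  mul_assoc m ((t : X.coinv k) : A) (b : A)

variable (T) in
/-- The projection `A ⊗_T A → A ⊗_B A`. -/
def tensorProj : BTensor T A A →+ BTensor (X.coinv k) A A :=
  BTensor.lift
    (BTensor.mkBi (fun a a' => BTensor.tmul (X.coinv k) a a')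
      (fun a b a' => BTensor.add_tmul a b a') (fun a b b' => BTensor.tmul_add a b b'))
    (fun a t a' => BTensor.smul_tmul a (t : X.coinv k) a')

theorem tensorProj_tmul (a a' : A) :
    X.tensorProj T (BTensor.tmul T a a') = BTensor.tmul (X.coinv k) a a' :=
  BTensor.lift_tmul _ _ a a'

theorem canBimod_tensorProj (x : BTensor T A A) :
    X.canBimod k (X.tensorProj T x) = X.canLift T x := by
  induction x using BTensor.induction with
  | zero => simp only [map_zero]
  | tmul a a' => rw [tensorProj_tmul, canBimod_tmul, canLift_tmul]
  | add x y hx hy => simp only [map_add, hx, hy]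

variable (T) in
/-- The multiplication map `B ⊗_T A → A`. -/
def coinvMulLeft : BTensor T (X.coinv k) A →+ A :=
  BTensor.lift (BTensor.mkBi (fun (b : X.coinv k) (m : A) => b • m)
    (fun b b' m => add_smul b b' m) (fun b m m' => smul_add b m m')) X.op_smul_coinv_smul

variable (T) in
/-- The multiplication map `A ⊗_T B → A`. -/
def coinvMulRight : BTensor T A (X.coinv k) →+ A :=
  BTensor.lift (BTensor.mkBi (fun (m : A) (b : X.coinv k) => op b • m)
    (fun m m' b => smul_add _ m m') (fun m b b' => by rw [op_add, add_smul]))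
    X.op_coinv_smul_op_smul

/-- Over `B` the coinvariant factor slides to the right, so `a σ(a')` collapses to `a ⊗ a'` as soon
as `σ` splits the multiplication. -/
theorem tensorProj_smul_inclLeft (a : A) (y : BTensor T (X.coinv k) A) :
    X.tensorProj T (a • X.inclLeft T y) =
      BTensor.tmul (X.coinv k) a (X.coinvMulLeft T y) := by
  induction y using BTensor.induction with
  | zero => simp only [map_zero, smul_zero, BTensor.tmul_zero]
  | tmul b u => exact BTensor.smul_tmul a b u
  | add x y hx hy => simp only [map_add, smul_add, BTensor.tmul_add, hx, hy]

theorem tensorProj_op_smul_inclRight (a : A) (y : BTensor T A (X.coinv k)) :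
    X.tensorProj T (op a • X.inclRight T y) =
      BTensor.tmul (X.coinv k) (X.coinvMulRight T y) a := by
  induction y using BTensor.induction with
  | zero => simp only [map_zero, smul_zero, BTensor.zero_tmul]
  | tmul u b => exact (BTensor.smul_tmul u b a).symm
  | add x y hx hy => simp only [map_add, smul_add, BTensor.add_tmul, hx, hy]

variable (T) in
/-- The map `B ⊗_T A → A ⊗_T A` as a right `T`-linear map. -/
def inclLeftBase : BTensor T (X.coinv k) A →ₗ[(↥T)ᵐᵒᵖ] BTensor T A A where
  toFun := X.inclLeft T
  map_add' := map_add _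
  map_smul' t z := by
    induction z using BTensor.induction with
    | zero => simp only [smul_zero, map_zero]
    | tmul b a => rfl
    | add x y hx hy => simp only [map_add, smul_add, hx, hy]

variable (T) in
/-- The map `A ⊗_T B → A ⊗_T A` as a left `T`-linear map. -/
def inclRightBase : BTensor T A (X.coinv k) →ₗ[T] BTensor T A A where
  toFun := X.inclRight T
  map_add' := map_add _
  map_smul' t z := by
    induction z using BTensor.induction with
    | zero => simp only [smul_zero, map_zero]
    | tmul b a => rfl
    | add x y hx hy => simp only [map_add, smul_add, hx, hy]

variable {X} {ℓ : BimodHom R R C (BTensor T A A)}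

/-- Flatness of `C` over `R` is not available; instead `A ⊗_R C` is a left `T`-module retract of `A
⊗_T A` by `extLeft` and `canLift`. The factor `1` only presents the inclusion of `B ⊗_T A` as an
`R`-linear map. -/
theorem map_smulInclLeft_injective (hℓ : X.IsStrongConnection T ℓ)
    (hinj : Function.Injective (BTensor.map (X.inclLeftBase T) (LinearMap.id : A →ₗ[T] A))) :
    Function.Injective (BTensor.map (X.smulInclLeft T (1 : A)) (LinearMap.id : C →ₗ[R] C)) :=
  BTensor.map_injective_of_retract (i := X.coinvRight T) (s := extLeftBase ℓ)
    (r := X.canLiftBase T) (canLift_extLeft hℓ)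
    (fun b m => congrArg (BTensor.tmul T · m) (one_mul (b : A))) (fun _ _ => rfl) hinj

theorem map_opSmulInclRight_injective (hℓ : X.IsStrongConnection T ℓ)
    (hinj : Function.Injective
      (BTensor.map (LinearMap.id : A →ₗ[(↥T)ᵐᵒᵖ] A) (X.inclRightBase T))) :
    Function.Injective
      (BTensor.map (LinearMap.id : C →ₗ[Rᵐᵒᵖ] C) (X.opSmulInclRight T (1 : A))) :=
  BTensor.map_injective_of_retract' (i := X.coinvLeft T) (s := extRightBase ℓ)
    (r := X.leftCanBase T) (leftCanBase_extRight hℓ)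
    (fun m b => congrArg (BTensor.tmul T m) (mul_one (b : A))) (fun _ _ => rfl) hinj

theorem canBimod_surjective (hℓ : X.IsStrongConnection T ℓ) :
    Function.Surjective (X.canBimod k).left := fun z =>
  ⟨X.tensorProj T (extLeft ℓ z), (X.canBimod_tensorProj _).trans (canLift_extLeft hℓ z)⟩

/-! ### Sections given by a strong connection -/

/-- Exactness gives a preimage of `a₀ ℓ(a₁)` in `B ⊗_T A`. By injectivity this preimage is unique,
hence depends linearly on `a`. -/
theorem exists_sectionLeft (hℓ : X.IsStrongConnection T ℓ)
    (hinj : Function.Injective (X.inclLeft T))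
    (hker : ∀ x, BTensor.map (X.ρRight T) LinearMap.id x =
      BTensor.map (X.unitRight T) LinearMap.id x → ∃ y, X.inclLeft T y = x) :
    ∃ σ : BimodHom (X.coinv k) R A (BTensor T (X.coinv k) A),
      ∀ a, X.inclLeft T (σ a) = extLeft ℓ (X.ρ a) := by
  choose s hs using fun a => hker _ (extLeft_ρ_coinvariant hℓ a)
  refine ⟨BimodHom.ofAddHom
    (AddMonoidHom.mk' s (fun a b => hinj (by rw [map_add, hs, hs, hs, map_add, map_add])))
    (fun b a => hinj ?_) (fun r a => hinj ?_), hs⟩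
  · change X.inclLeft T (s ((b : A) * a)) = X.inclLeft T (b • s a)
    rw [inclLeft_smul, hs, hs, X.ρ_coinv_mul, extLeft_smul]
  · change X.inclLeft T (s (op r • a)) = X.inclLeft T (op r • s a)
    rw [inclLeft_op_smul, hs, hs, X.ρ.map_smul]
    exact (extLeftOp ℓ).map_smul (op r) (X.ρ a)

/-- Likewise for `ℓ(a₋₁) a₀`, whose second factor is coinvariant. -/
theorem exists_sectionRight (hℓ : X.IsStrongConnection T ℓ)
    (hinj : Function.Injective (X.inclRight T))
    (hker : ∀ x, BTensor.map LinearMap.id (X.ρLeft T) x =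
      BTensor.map LinearMap.id (X.unitLeft T) x → ∃ y, X.inclRight T y = x) :
    ∃ σ : BimodHom R (X.coinv k) A (BTensor T A (X.coinv k)),
      ∀ a, X.inclRight T (σ a) = extRight ℓ (X.leftρ a) := by
  choose s hs using fun a => hker _ (extRight_leftρ_coinvariant hℓ a)
  refine ⟨BimodHom.ofAddHom
    (AddMonoidHom.mk' s (fun a b => hinj (by rw [map_add, hs, hs, hs, map_add, map_add])))
    (fun r a => hinj ?_) (fun b a => hinj ?_), hs⟩
  · change X.inclRight T (s (r • a)) = X.inclRight T (r • s a)
    rw [inclRight_smul, hs, hs, X.leftρ.map_smul]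
    exact (extRightLin ℓ).map_smul r (X.leftρ a)
  · change X.inclRight T (s (a * (b : A))) = X.inclRight T (op b • s a)
    rw [inclRight_op_smul, hs, hs, X.leftρ_mul_coinv, extRight_op_smul]

section SectionLeft

variable {σ : BimodHom (X.coinv k) R A (BTensor T (X.coinv k) A)}

/-- Compare images under the injective `ρ`: on `B ⊗_T A`, `ρ` of the product is `canLift`, and
`extLeft ℓ` splits `canLift`. -/
theorem coinvMulLeft_section (hℓ : X.IsStrongConnection T ℓ)
    (hσ : ∀ a, X.inclLeft T (σ a) = extLeft ℓ (X.ρ a)) (a : A) :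
    X.coinvMulLeft T (σ a) = a := by
  apply X.ρ_injective
  refine (X.canLift_inclLeft X.op_smul_coinv_smul (σ a)).symm.trans ?_
  rw [hσ, canLift_extLeft hℓ]

/-- The map `extLeft ℓ` followed by the projection to `A ⊗_B A` is a left inverse: `a ρ(a') ↦ a
σ(a') ↦ a ⊗ a'`. -/
theorem canBimod_injective_of_sectionLeft (hℓ : X.IsStrongConnection T ℓ)
    (hσ : ∀ a, X.inclLeft T (σ a) = extLeft ℓ (X.ρ a)) :
    Function.Injective (X.canBimod k).left := by
  have h : ∀ x, X.tensorProj T (extLeft ℓ (X.canBimod k x)) = x := by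
    intro x
    induction x using BTensor.induction with
    | zero => simp only [map_zero]
    | tmul a a' =>
      rw [canBimod_tmul, extLeft_smul, ← hσ, tensorProj_smul_inclLeft,
        coinvMulLeft_section hℓ hσ]
    | add x y hx hy => simp only [map_add, hx, hy]
  intro x y hxy
  rw [← h x, ← h y]
  exact congrArg (fun z => X.tensorProj T (extLeft ℓ z)) hxy

/-- After embedding in `(A ⊗_T A) ⊗_R C`, the map `σ` becomes `extLeft ℓ ∘ ρ`, a composite of
colinear maps; `h3` is the coassociativity of `ρ` that makes the two coactions match. -/
theorem sectionLeft_colinear (hℓ : X.IsStrongConnection T ℓ)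
    (hσ : ∀ a, X.inclLeft T (σ a) = extLeft ℓ (X.ρ a))
    (hinj : Function.Injective (BTensor.map (X.inclLeftBase T) (LinearMap.id : A →ₗ[T] A))) :
    IsRightColinear X.comodule.coact
      (rightTensorCoaction (X.coinv k) X.comodule.coact (X.ρ_smul k T)) σ.right := by
  have h1 : ∀ a, X.smulInclLeft T 1 (σ.right a) = extLeftOp ℓ (X.ρ a) :=
    fun a => (one_smul A _).trans (hσ a)
  intro a
  apply map_smulInclLeft_injective hℓ hinj
  refine (X.rightCoaction_smulInclLeft 1 (σ.right a)).symm.trans ?_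
  have h2 : (X.smulInclLeft T 1) ∘ₗ σ.right = extLeftOp ℓ ∘ₗ X.ρ := LinearMap.ext h1
  have h3 : (BTensor.assoc R R A C C).symm (BTensor.map LinearMap.id 𝒞.comul.left (X.ρ a)) =
      BTensor.map X.ρ LinearMap.id (X.ρ a) := by
    rw [AddEquiv.symm_apply_eq]
    exact (X.comodule.coassoc a).symm
  rw [h1]
  refine (rightCoaction_extLeft hℓ (X.ρ a)).trans ?_
  rw [h3, BTensor.map_map, BTensor.map_map, h2]
  rfl

end SectionLeft

section SectionRight

variable {σ : BimodHom R (X.coinv k) A (BTensor T A (X.coinv k))}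

theorem coinvMulRight_section (hℓ : X.IsStrongConnection T ℓ)
    (hσ : ∀ a, X.inclRight T (σ a) = extRight ℓ (X.leftρ a)) (a : A) :
    X.coinvMulRight T (σ a) = a := by
  apply X.smul_ρ_one_injective
  refine (X.canLift_inclRight X.op_coinv_smul_op_smul (σ a)).symm.trans ?_
  rw [hσ, canLift_extRight hℓ, ψ_leftρ]

/-- Here the left inverse starts from `C ⊗_R A`: `ψ⁻¹(a ρ(1)) a' ↦ σ(a) a' ↦ a ⊗ a'`. Injectivity of
`leftCan` then passes to the canonical map through `ψ`. -/
theorem canBimod_injective_of_sectionRight (hℓ : X.IsStrongConnection T ℓ)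
    (hσ : ∀ a, X.inclRight T (σ a) = extRight ℓ (X.leftρ a)) :
    Function.Injective (X.canBimod k).left := by
  have h : ∀ x, X.tensorProj T (extRight ℓ (X.leftCan k x)) = x := by
    intro x
    induction x using BTensor.induction with
    | zero => simp only [map_zero]
    | tmul a a' =>
      rw [leftCan_tmul, extRight_op_smul, ← hσ, tensorProj_op_smul_inclRight,
        coinvMulRight_section hℓ hσ]
    | add x y hx hy => simp only [map_add, hx, hy]
  intro x y hxy
  rw [← h x, ← h y]
  have h' : X.leftCan k x = X.leftCan k y := by
    apply X.bijective.1
    rw [ψ_leftCan, ψ_leftCan]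
    exact hxy
  rw [h']

/-- After embedding in `C ⊗_R (A ⊗_T A)`, the map `σ` becomes `extRight ℓ` after the left coaction
of `A`, and both of these are colinear. -/
theorem sectionRight_colinear (hℓ : X.IsStrongConnection T ℓ)
    (hσ : ∀ a, X.inclRight T (σ a) = extRight ℓ (X.leftρ a))
    (hinj : Function.Injective
      (BTensor.map (LinearMap.id : A →ₗ[(↥T)ᵐᵒᵖ] A) (X.inclRightBase T))) :
    IsLeftColinear X.leftComodule.coact
      (leftTensorCoaction (X.coinv k) X.leftComodule.coact (X.leftρ_op_smul k T)) σ.left := by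
  have h1 : ∀ a, X.opSmulInclRight T 1 (σ.left a) = extRightLin ℓ (X.leftρ a) :=
    fun a => (one_smul Aᵐᵒᵖ _).trans (hσ a)
  intro a
  apply map_opSmulInclRight_injective hℓ hinj
  refine (X.leftCoaction_opSmulInclRight 1 (σ.left a)).symm.trans ?_
  have h2 : (X.opSmulInclRight T 1) ∘ₗ σ.left = extRightLin ℓ ∘ₗ X.leftρ := LinearMap.ext h1
  have h3 : BTensor.assoc R R C C A (BTensor.map 𝒞.comul.right LinearMap.id (X.leftρ a)) =
      BTensor.map LinearMap.id X.leftρ (X.leftρ a) := X.leftComodule.coassoc a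
  rw [h1]
  refine (leftCoaction_extRight hℓ (X.leftρ a)).trans ?_
  rw [h3, BTensor.map_map, BTensor.map_map, h2]
  rfl

end SectionRight

theorem isGalois_of_injective (hℓ : X.IsStrongConnection T ℓ)
    (h : Function.Injective (X.canBimod k).left) : E.coring.IsGalois k X.grouplike :=
  ⟨X.isGrouplike_grouplike, X.can_bijective_iff.2 ⟨h, canBimod_surjective hℓ⟩⟩

theorem galois_and_projectiveLeft (hℓ : X.IsStrongConnection T ℓ)
    (hinj : Function.Injective (X.inclLeft T))
    (hker : ∀ x, BTensor.map (X.ρRight T) LinearMap.id x =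
      BTensor.map (X.unitRight T) LinearMap.id x → ∃ y, X.inclLeft T y = x)
    (hinj' : Function.Injective (BTensor.map (X.inclLeftBase T) (LinearMap.id : A →ₗ[T] A))) :
    E.coring.IsGalois k X.grouplike ∧
      IsEquivariantlyProjectiveLeft (X.coinv k) T X.comodule := by
  obtain ⟨σ, hσ⟩ := exists_sectionLeft hℓ hinj hker
  exact ⟨isGalois_of_injective hℓ (canBimod_injective_of_sectionLeft hℓ hσ),
    X.ρ_coinv_smul, X.ρ_smul k T, X.op_smul_coinv_smul, σ, sectionLeft_colinear hℓ hσ hinj',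
    coinvMulLeft_section hℓ hσ⟩

theorem galois_and_projectiveRight (hℓ : X.IsStrongConnection T ℓ)
    (hinj : Function.Injective (X.inclRight T))
    (hker : ∀ x, BTensor.map LinearMap.id (X.ρLeft T) x =
      BTensor.map LinearMap.id (X.unitLeft T) x → ∃ y, X.inclRight T y = x)
    (hinj' : Function.Injective
      (BTensor.map (LinearMap.id : A →ₗ[(↥T)ᵐᵒᵖ] A) (X.inclRightBase T))) :
    E.coring.IsGalois k X.grouplike ∧
      IsEquivariantlyProjectiveRight (X.coinv k) T X.leftComodule := by
  obtain ⟨σ, hσ⟩ := exists_sectionRight hℓ hinj hker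
  exact ⟨isGalois_of_injective hℓ (canBimod_injective_of_sectionRight hℓ hσ),
    X.leftρ_op_coinv_smul, X.leftρ_op_smul k T, X.op_coinv_smul_op_smul, σ,
    sectionRight_colinear hℓ hσ hinj', coinvMulRight_section hℓ hσ⟩

end Projective

end Extension

end Entwining

end

/-! ### The two equivalences -/

theorem corollary3
    {k : Type uk} [CommRing k]
    {R : Type uR} [Ring R] [Algebra k R]
    {C : Type uC} [AddCommGroup C] [Module R C] [Module Rᵐᵒᵖ C] [SMulCommClass R Rᵐᵒᵖ C]
    [IsBimoduleOver k R C] (𝒞 : Coring R C)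
    {A : Type uA} [Ring A] [Algebra k A] [Module R A] [Module Rᵐᵒᵖ A] [IsRRing R A]
    [IsScalarTower k R A]
    (E : Entwining 𝒞 A) (X : E.Extension) (T : Subalgebra k (X.coinv k)) :
    (IsFlatLeft.{uA, uA, max uA uC} T A →
      ((∃ ℓ : BimodHom R R C (BTensor T A A), X.IsStrongConnection T ℓ) ↔
        (E.coring.IsGalois k X.grouplike ∧
          IsEquivariantlyProjectiveLeft (X.coinv k) T X.comodule))) ∧
    (IsFlatRight.{uA, uA, max uA uC} T A →
      ((∃ ℓ : BimodHom R R C (BTensor T A A), X.IsStrongConnection T ℓ) ↔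
        (E.coring.IsGalois k X.grouplike ∧
          IsEquivariantlyProjectiveRight (X.coinv k) T X.leftComodule))) := by
  -- Exactness of `B → A → (A ⊗_R C)_ψ`, the second map being `ρ` minus `a ↦ a ρ(1)`. Its target is
  -- the reason for test modules in the universe `max uA uC`.
  have hex : ∀ a : A, X.ρ a - a • X.ρ 1 = 0 → a ∈ X.coinv k := fun a h =>
    (X.mem_coinv k a).2 (sub_eq_zero.1 h)
  constructor
  · intro hf
    refine ⟨fun ⟨ℓ, hℓ⟩ => ?_, fun ⟨hG, hp⟩ =>
      X.exists_isStrongConnection_of_projectiveLeft (X.can_bijective_iff.1 hG.2) hp⟩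
    refine Entwining.Extension.galois_and_projectiveLeft hℓ
      (IsFlatLeft.map_injective_small.{uA, uC, uA, uA} hf (X.coinvRight T)
        Subtype.val_injective) (fun x hx => ?_)
      -- Flatness is applied twice: to `B → A`, and then to the resulting injection `B ⊗_T A → A ⊗_T
      -- A`. This feeds the retract argument for colinearity.
      (IsFlatLeft.map_injective_small.{uA, uC, uA, uA} hf (X.inclLeftBase T)
        (IsFlatLeft.map_injective_small.{uA, uC, uA, uA} hf (X.coinvRight T)
          Subtype.val_injective))
    -- An element on which `ρ` and `a ↦ a ρ(1)` agree in the first factor is killed by their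
    -- difference, hence comes from `B ⊗_T A`.
    refine IsFlatLeft.mem_range_map.{uA, uC, uA, uA} hf (X.coinvRight T)
      (X.ρRight T - X.unitRight T) (fun a ha => ⟨⟨a, hex a ha⟩, rfl⟩) ?_
    rw [BTensor.map_sub_left, hx, sub_self]
  · intro hf
    refine ⟨fun ⟨ℓ, hℓ⟩ => ?_, fun ⟨hG, hp⟩ =>
      X.exists_isStrongConnection_of_projectiveRight (X.can_bijective_iff.1 hG.2) hp⟩
    refine Entwining.Extension.galois_and_projectiveRight hℓ
      (IsFlatRight.map_injective_small.{uA, uC, uA, uA} hf (X.coinvLeft T)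
        Subtype.val_injective) (fun x hx => ?_)
      (IsFlatRight.map_injective_small.{uA, uC, uA, uA} hf (X.inclRightBase T)
        (IsFlatRight.map_injective_small.{uA, uC, uA, uA} hf (X.coinvLeft T)
          Subtype.val_injective))
    refine IsFlatRight.mem_range_map.{uA, uC, uA, uA} hf (X.coinvLeft T)
      (X.ρLeft T - X.unitLeft T) (fun a ha => ⟨⟨a, hex a ha⟩, rfl⟩) ?_
    rw [BTensor.map_sub_right, hx, sub_self]
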